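/- Let $\lambda$ be the security parameter. Let $p=p(\lambda)$ be a prime of polynomial bit length with $1/p$ negligible, and let $k<p$ (number of hash functions), $m\ge 1$ (filter length), $t$, $n$ (numbers of client and server entries), the bit length of keys and the bit length of hash seeds be polynomially bounded in $\lambda$. The client holds $(x_1,s_1),\dots,(x_t,s_t)$ and the server holds $(y_1,g_1),\dots,(y_n,g_n)$ with pairwise distinct $y_l$; keys are bit strings and $s_j,g_l\in\mathbb F_p$. The S-SIP functionality draws uniform $r_1,\dots,r_t\in\mathbb F_p$ and gives the client $(u_j-r_j)_{j\le t}$ and the server $(r_j)_{j\le t}$, where $u_j=s_jg_l$ if $x_j=y_l$ for some $l$, and $u_j=0$ otherwise. The protocol S-SIP$_2$ is as follows. The parties agree on a public uniformly random seed of $k$ polynomial-time hash functions $h_1,\dots,h_k$ with values in $[m]$. The server inserts its keys into a Bloom filter $BF$ and its pairs into a garbled Bloom filter $GBF$ with values in $\mathbb F_p$, filling new positions uniformly at random subject to $\sum_a GBF[h_a(y_l)]=g_l$, and aborts if an insertion finds no free position. For each query $x_j$, independently: (a) The server picks a uniform $\mu\in\mathbb F_p$. By Sum-PIR the client obtains $\mu'=\sum_a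 BF[h_a(x_j)]-\mu$. The server picks a uniform bit $b_1$. In a 1-out-of-$(k+1)$ oblivious transfer (OT) of bits the server offers $b_1$ at every position except position $(k-\mu)\bmod(k+1)$, where it offers $1\oplus b_1$ (elements of $\mathbb F_p$ being represented in $\{0,\dots,p-1\}$ before reduction modulo $k+1$); the client, with choice $\mu'\bmod(k+1)$, receives $b_0$. (b) The server picks a uniform $\rho\in\mathbb F_p$. By scaled Sum-PIR the client obtains $\delta=s_j\sum_a GBF[h_a(x_j)]-\rho$. (c) The client picks a uniform $\Delta\in\mathbb F_p$ and offers $(\Delta+b_0\delta,\ \Delta+(1-b_0)\delta)$ in a 1-out-of-2 OT, in which the server, with choice $b_1$, receives $r$. The server picks a uniform $\alpha\in\mathbb F_p$ and offers $(r+b_1(\rho-\alpha)-(1-b_1)\alpha,\ r+(1-b_1)(\rho-\alpha)-b_1\alpha)$ in a 1-out-of-2 OT, in which the client, with choice $b_0$, receives $r'$. The $j$-th shares are $r'-\Delta$ for the client and $\alpha$ for the server. Here Sum-PIR is the following protocol built from a PIR scheme over a homomorphic encryption scheme with plaintext space $\mathbb F_p$, all of whose algorithms run in probabilistic polynomial time.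 The client generates $(pk,sk)$ and sends $pk$ and one PIR query for each of its $k$ indices; in the scaled variant it also sends $\mathrm{Enc}(pk,s)$. The server homomorphically adds the $k$ PIR answers, in the scaled variant homomorphically multiplies the sum by $\mathrm{Enc}(pk,s)$, homomorphically subtracts its mask, and returns the ciphertext, from which the client extracts its output. A protocol securely realizes a functionality against semi-honest adversaries if for each party there is a probabilistic polynomial-time simulator which, from the public parameters and the input and output of that party, produces a simulated view (input, random choices, received messages) such that the simulated view together with both outputs of the functionality is computationally indistinguishable, for non-uniform probabilistic polynomial-time distinguishers and uniformly in the inputs, from the real view together with the outputs of both parties. **Theorem.** Assume that Sum-PIR and its scaled variant securely realize the functionalities giving the client $\sum_a DB[\zeta_a]-r$, respectively $s\sum_a DB[\zeta_a]-r$ (indices $\zeta_a$ and scalar $s$ of the client, database $DB$ and mask $r$ of the server), and the server nothing, against semi-honest adversaries; that the 1-out-of-$(k+1)$ OT of bits and the 1-out-of-2 OT of elements of $\mathbb F_p$ are given by polynomial-time two-party protocols which securely realize the OT functionality against semi-honest adversaries; and that the Bloom filter parameters are such that, for every set of at most $n$ keys, every key outside the set passes the membership test with at most negligible probability (uniformly)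 over the random hash seed. Then S-SIP$_2$ securely realizes the S-SIP functionality against a semi-honest client and against a semi-honest server. -/

import Mathlib

open scoped BigOperators

noncomputable section

namespace SSIP

/-! ## Data, randomized programs with a step count, polynomial time -/

/-- Data handled by programs: trees whose leaves are natural numbers written in binary. -/
inductive Data : Type
  | num (n : ℕ) : Data
  | pair (a b : Data) : Data
  deriving DecidableEq

namespace Data

/-- Length of the description of a piece of data, in bits (up to a constant factor). -/
def size : Data → ℕ
  | num n => Nat.size n + 1
  | pair a b => size a + size b + 1

def fst : Data → Data
  | num _ => num 0
  | pair a _ => a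

def snd : Data → Data
  | num _ => num 0
  | pair _ b => b

def toNat : Data → ℕ
  | num n => n
  | pair _ _ => 0

/-- Lists, as right-nested pairs that end in `num 0`. -/
def list : List Data → Data
  | [] => num 0
  | a :: l => pair a (list l)

def vec {n : ℕ} (f : Fin n → Data) : Data := list (List.ofFn f)

/-- The number `n` in unary. -/
def unary (n : ℕ) : Data := list (List.replicate n (num 0))

end Data

/-- Arithmetic instructions. -/
inductive Arith : Type
  | add | sub | mul | div | mod

def Arith.eval : Arith → ℕ → ℕ → ℕ
  | add, a, b => a + b
  | sub, a, b => a - b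
  | mul, a, b => a * b
  | div, a, b => a / b
  | mod, a, b => a % b

/-- Randomized programs. A program maps data to data; `fold f` runs `f` once for every entry of a
list, which, with `sizeOf` and pairing, gives any polynomial number of iterations. -/
inductive Code : Type
  | ident : Code
  | const (d : Data) : Code
  | fst : Code
  | snd : Code
  | isNum : Code
  | sizeOf : Code
  | equal : Code
  | arith (o : Arith) : Code
  | rand : Code
  | pair (f g : Code) : Code
  | comp (g f : Code) : Code
  | cond (c f g : Code) : Code
  | fold (f : Code) : Code

/-- The uniform distribution on `{0, …, n - 1}` (and the point mass at `0` for `n = 0`). -/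
def uniformBelow (n : ℕ) : PMF ℕ :=
  if h : (Finset.range n).Nonempty then PMF.uniformOfFinset (Finset.range n) h else PMF.pure 0

namespace Code

/-- `foldRun step l s` : for each entry `a` of the list `l`, in order, replace the state `s` by the
outcome of `step (a, s)`; the costs are added up. -/
def foldRun (step : Data → PMF (Data × ℕ)) : Data → Data → PMF (Data × ℕ)
  | Data.num _, s => PMF.pure (s, 0)
  | Data.pair a l, s =>
      (step (Data.pair a s)).bind fun u =>
        (foldRun step l u.1).bind fun v => PMF.pure (v.1, u.2 + v.2)

/-- An instruction is charged the sizes of its argument and of its result. -/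
def charge (d r : Data) : Data × ℕ := (r, d.size + r.size)

/-- The joint distribution of the result of a program and of its running time. -/
def run : Code → Data → PMF (Data × ℕ)
  | ident, d => PMF.pure (charge d d)
  | const e, d => PMF.pure (charge d e)
  | fst, d => PMF.pure (charge d d.fst)
  | snd, d => PMF.pure (charge d d.snd)
  | isNum, d => PMF.pure (charge d (match d with
      | Data.num _ => Data.num 1
      | Data.pair _ _ => Data.num 0))
  | sizeOf, d => PMF.pure (charge d (Data.unary d.size))
  | equal, d => PMF.pure (charge d (if d.fst = d.snd then Data.num 1 else Data.num 0))
  | arith o, d => PMF.pure (charge d (Data.num (o.eval d.fst.toNat d.snd.toNat)))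
  | rand, d => (uniformBelow d.toNat).bind fun n => PMF.pure (charge d (Data.num n))
  | pair f g, d =>
      (run f d).bind fun u => (run g d).bind fun v =>
        PMF.pure (Data.pair u.1 v.1, u.2 + v.2 + d.size + (Data.pair u.1 v.1).size)
  | comp g f, d =>
      (run f d).bind fun u => (run g u.1).bind fun v => PMF.pure (v.1, u.2 + v.2 + d.size)
  | cond c f g, d =>
      (run c d).bind fun u =>
        (if u.1 = Data.num 0 then run g d else run f d).bind fun v =>
          PMF.pure (v.1, u.2 + v.2 + d.size)
  | fold f, d =>
      (foldRun (run f) d.fst d.snd).bind fun v => PMF.pure (v.1, v.2 + d.size)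

/-- The distribution of the result of a program. -/
def eval (c : Code) (d : Data) : PMF Data := (c.run d).map Prod.fst

/-- The program always stops within a number of steps polynomial in the size of its input. -/
def PolyTime (c : Code) : Prop :=
  ∃ Q : Polynomial ℕ, ∀ d : Data, ∀ o ∈ (c.run d).support, o.2 ≤ Q.eval d.size

end Code

/-- A deterministic function that is computable in polynomial time. -/
structure PolyFun where
  toFun : Data → Data
  polyTime : ∃ c : Code, c.PolyTime ∧ ∀ d, c.eval d = PMF.pure (toFun d)

/-- Bounded by a polynomial in the security parameter. -/
def PolyBounded (f : ℕ → ℕ) : Prop := ∃ Q : Polynomial ℕ, ∀ κ, f κ ≤ Q.eval κ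

/-- A probabilistic polynomial-time algorithm, with its random bits written out: with security
parameter `κ` it uses `coins κ` bits, encoded as an element of `Fin (2 ^ coins κ)`. -/
structure RandAlg where
  alg : PolyFun
  coins : ℕ → ℕ
  coins_poly : PolyBounded coins

/-- The result of an algorithm on an input tuple and random bits. -/
def RandAlg.app (A : RandAlg) {κ : ℕ} (input : List Data) (r : Fin (2 ^ A.coins κ)) : Data :=
  A.alg.toFun (Data.pair (Data.list input) (Data.num r))

/-! ## Computational indistinguishability and semi-honest security -/

/-- Negligible functions of the security parameter. -/
def Negligible (f : ℕ → ℝ) : Prop :=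
  Asymptotics.SuperpolynomialDecay Filter.atTop (fun κ : ℕ => (κ : ℝ)) f

/-- The probability that `D`, given the advice `a` and a sample of `X`, answers `1`. -/
def acceptProb (D : Code) (a : Data) (X : PMF Data) : ℝ :=
  ((X.bind fun v => D.eval (Data.pair a v)) (Data.num 1)).toReal

/-- Computational indistinguishability of two ensembles indexed by the security parameter and an
input, against non-uniform probabilistic polynomial-time distinguishers (polynomial time with
advice of polynomial size). -/
def CompIndist {I : ℕ → Type} (X Y : (κ : ℕ) → I κ → PMF Data) : Prop :=
  ∀ D : Code, D.PolyTime → ∀ adv : ℕ → Data, PolyBounded (fun κ => (adv κ).size) →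
    ∃ ε : ℕ → ℝ, Negligible ε ∧ ∀ (κ : ℕ) (i : I κ),
      |acceptProb D (adv κ) (X κ i) - acceptProb D (adv κ) (Y κ i)| ≤ ε κ

/-- A (possibly randomized) two-party functionality: the joint inputs, the part of them that each
party holds, and the joint distribution of the two outputs. -/
structure Functionality where
  Inp : ℕ → Type
  input : (κ : ℕ) → Inp κ → Fin 2 → Data
  ideal : (κ : ℕ) → Inp κ → PMF (Fin 2 → Data)

/-- What an execution of a two-party protocol leaves behind. The view of a party consists of its
input, its random choices and the messages that it received. -/
structure Outcome where
  view : Fin 2 → Data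
  out : Fin 2 → Data

/-- Executions of a two-party protocol on the inputs of a functionality. -/
abbrev Execution (F : Functionality) : Type := (κ : ℕ) → F.Inp κ → PMF Outcome

/-- The view of party `b` in the execution, jointly with the outputs of both parties. -/
def realWorld (F : Functionality) (E : Execution F) (b : Fin 2) (κ : ℕ) (i : F.Inp κ) :
    PMF Data :=
  (E κ i).map fun o => Data.list [o.view b, o.out 0, o.out 1]

/-- The view of party `b` made up by the simulator `S` from the public parameters, the input and
the output of `b` alone, jointly with the outputs given by the functionality. -/
def idealWorld (pub : ℕ → Data) (F : Functionality) (S : Code) (b : Fin 2) (κ : ℕ)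
    (i : F.Inp κ) : PMF Data := do
  let y ← F.ideal κ i
  let v ← S.eval (Data.list [pub κ, F.input κ i b, y b])
  pure (Data.list [v, y 0, y 1])

/-- The protocol securely realizes the functionality in the presence of semi-honest
adversaries: for each corrupted party there is a probabilistic polynomial-time simulator. -/
def SecurelyRealizes (pub : ℕ → Data) (F : Functionality) (E : Execution F) : Prop :=
  ∀ b : Fin 2, ∃ S : Code, S.PolyTime ∧
    CompIndist (realWorld F E b) (idealWorld pub F S b)

/-! ## Two-party protocols given by next-message functions -/

/-- A two-party protocol: in each round both parties send a message (possibly an empty one),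
computed from the public parameters and their own view. -/
structure Protocol where
  rounds : ℕ → ℕ
  coins : Fin 2 → ℕ → ℕ
  message : Fin 2 → PolyFun
  output : Fin 2 → PolyFun

namespace Protocol

/-- The view of a party: its input, its random bits, the messages it received (latest first). -/
def viewOf (x : Data) (r : ℕ) (received : Data) : Data := Data.list [x, Data.num r, received]

/-- The messages received by each party in the first `j` rounds. -/
def received (T : Protocol) (pub : Data) (x : Fin 2 → Data) (r : Fin 2 → ℕ) :
    ℕ → Fin 2 → Data
  | 0 => fun _ => Data.list []
  | j + 1 => fun b =>
      Data.pair
        ((T.message (1 - b)).toFun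
          (Data.pair pub (viewOf (x (1 - b)) (r (1 - b)) (received T pub x r j (1 - b)))))
        (received T pub x r j b)

/-- The view of party `b` at the end. -/
def view (T : Protocol) (pub : ℕ → Data) (κ : ℕ) (x : Fin 2 → Data) (r : Fin 2 → ℕ)
    (b : Fin 2) : Data :=
  viewOf (x b) (r b) (T.received (pub κ) x r (T.rounds κ) b)

/-- The execution of the protocol with uniform and independent random bits. -/
def exec (T : Protocol) (pub : ℕ → Data) (F : Functionality) : Execution F := fun κ i => do
  let r0 ← PMF.uniformOfFintype (Fin (2 ^ T.coins 0 κ))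
  let r1 ← PMF.uniformOfFintype (Fin (2 ^ T.coins 1 κ))
  let v := T.view pub κ (F.input κ i) ![(r0 : ℕ), (r1 : ℕ)]
  pure { view := v, out := fun b => (T.output b).toFun (Data.pair (pub κ) (v b)) }

/-- The parties run in polynomial time altogether: as each message is computed in polynomial time
from the view, this means that views have polynomial size. -/
def Efficient (T : Protocol) (pub : ℕ → Data) (F : Functionality) : Prop :=
  ∃ Q : Polynomial ℕ, ∀ (κ : ℕ) (i : F.Inp κ) (r : Fin 2 → ℕ) (b : Fin 2),
    (∀ c, r c < 2 ^ T.coins c κ) → (T.view pub κ (F.input κ i) r b).size ≤ Q.eval κ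

end Protocol

/-! ## Parameters -/

/-- Public parameters, as functions of the security parameter: the prime `p` of the field of
values, the number `k` of hash functions, the length `m` of the filters, the number `t` of client
entries, the number `n` of server entries, the bit lengths of keys and of hash seeds. -/
structure Params where
  p : ℕ → ℕ
  k : ℕ → ℕ
  m : ℕ → ℕ
  t : ℕ → ℕ
  n : ℕ → ℕ
  keyLen : ℕ → ℕ
  seedLen : ℕ → ℕ
  p_prime : ∀ κ, (p κ).Prime
  m_pos : ∀ κ, 0 < m κ
  k_lt_p : ∀ κ, k κ < p κ
  p_poly : PolyBounded fun κ => Nat.size (p κ)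
  k_poly : PolyBounded k
  m_poly : PolyBounded m
  t_poly : PolyBounded t
  n_poly : PolyBounded n
  keyLen_poly : PolyBounded keyLen
  seedLen_poly : PolyBounded seedLen

namespace Params

instance (P : Params) (κ : ℕ) : Fact (P.p κ).Prime := ⟨P.p_prime κ⟩

variable (P : Params) (κ : ℕ)

/-- The field of values. -/
abbrev Val : Type := ZMod (P.p κ)

/-- Keys are bit strings. -/
abbrev Key : Type := Fin (2 ^ P.keyLen κ)

abbrev Seed : Type := Fin (2 ^ P.seedLen κ)

/-- A value, as data. -/
def enc {q : ℕ} (v : ZMod q) : Data := Data.num v.val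

/-- The public parameters (which include `1^κ`) as data. -/
def pub : Data :=
  Data.list [Data.unary κ, Data.num (P.p κ), Data.unary (P.k κ), Data.unary (P.m κ),
    Data.unary (P.t κ), Data.unary (P.n κ), Data.unary (P.keyLen κ), Data.unary (P.seedLen κ)]

end Params

open Params (enc)

/-! ## Oblivious transfer -/

/-- 1-out-of-`N` oblivious transfer of elements of `ℤ/q`; party `0` is the sender and party `1`
the receiver. -/
def otF (N q : ℕ → ℕ) : Functionality where
  Inp κ := (Fin (N κ) → ZMod (q κ)) × Fin (N κ)
  input _ i := ![Data.vec fun j => enc (i.1 j), Data.num i.2]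
  ideal _ i := PMF.pure ![Data.list [], enc (i.1 i.2)]

/-! ## Private information retrieval and Sum-PIR -/

/-- The algorithms of a single-server PIR whose answers are ciphertexts of a homomorphic
encryption scheme with plaintext space the field of values. -/
structure PIRScheme where
  keyGen : RandAlg
  query : RandAlg
  answer : RandAlg
  extract : PolyFun
  encrypt : RandAlg
  evalSum : RandAlg
  evalMul : RandAlg

/-- Joint inputs of Sum-PIR: the client holds `k` indices (and a scalar, which is used in the
scaled variant only), the server a database and a mask. -/
structure SumPIRInput (P : Params) (κ : ℕ) where
  idx : Fin (P.k κ) → Fin (P.m κ)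
  scalar : P.Val κ
  db : Fin (P.m κ) → P.Val κ
  mask : P.Val κ

/-- The Sum-PIR functionality: the client (party `0`) learns the masked sum of the entries at its
indices, in the scaled variant the masked multiple of this sum; the server learns nothing. -/
def sumPIRF (P : Params) (scaled : Bool) : Functionality where
  Inp κ := SumPIRInput P κ
  input _ i :=
    ![Data.list ((Data.vec fun a => Data.num (i.idx a)) ::
        (if scaled then [enc i.scalar] else [])),
      Data.list [Data.vec fun a => enc (i.db a), enc i.mask]]
  ideal _ i := PMF.pure
    ![enc ((if scaled then i.scalar else 1) * ∑ a, i.db (i.idx a) - i.mask), Data.list []]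

/-- The Sum-PIR protocol. In the scaled variant the client also sends an encryption of its scalar,
by which the server multiplies the encrypted sum before masking it. -/
def sumPIR (P : Params) (A : PIRScheme) (scaled : Bool) : Execution (sumPIRF P scaled) :=
  fun κ i => do
    let pub := P.pub κ
    -- client: key generation, queries, encryption of the scalar
    let rKey ← PMF.uniformOfFintype (Fin (2 ^ A.keyGen.coins κ))
    let rQuery ← PMF.uniformOfFintype (Fin (P.k κ) → Fin (2 ^ A.query.coins κ))
    let rScalar ← PMF.uniformOfFintype (Fin (2 ^ A.encrypt.coins κ))
    let keys := A.keyGen.app [pub] rKey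
    let pk := keys.fst
    let sk := keys.snd
    let q := fun a => A.query.app [pub, pk, Data.num (i.idx a)] (rQuery a)
    let eScalar := A.encrypt.app [pub, pk, enc i.scalar] rScalar
    -- server: answers, their homomorphic sum, multiplication by the scalar, masking
    let rAnswer ← PMF.uniformOfFintype (Fin (P.k κ) → Fin (2 ^ A.answer.coins κ))
    let rSum ← PMF.uniformOfFintype (Fin (2 ^ A.evalSum.coins κ))
    let rMul ← PMF.uniformOfFintype (Fin (2 ^ A.evalMul.coins κ))
    let rMask ← PMF.uniformOfFintype (Fin (2 ^ A.encrypt.coins κ))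
    let rSub ← PMF.uniformOfFintype (Fin (2 ^ A.evalSum.coins κ))
    let db := Data.vec fun a => enc (i.db a)
    let d := fun a => A.answer.app [pub, pk, q a, db] (rAnswer a)
    let ct := A.evalSum.app [pub, pk, Data.vec d] rSum
    let ctScaled :=
      if scaled then A.evalMul.app [pub, pk, Data.list [ct, eScalar]] rMul else ct
    let ctMask := A.encrypt.app [pub, pk, enc (-i.mask)] rMask
    let ctFinal := A.evalSum.app [pub, pk, Data.list [ctScaled, ctMask]] rSub
    let clientView := Data.list
      ([(sumPIRF P scaled).input κ i 0, Data.num rKey, Data.vec fun a => Data.num (rQuery a)] ++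
        (if scaled then [Data.num rScalar] else []) ++ [ctFinal])
    let serverView := Data.list
      ([(sumPIRF P scaled).input κ i 1, Data.vec fun a => Data.num (rAnswer a), Data.num rSum] ++
        (if scaled then [Data.num rMul] else []) ++ [Data.num rMask, Data.num rSub] ++
        [pk, Data.vec q] ++ (if scaled then [eScalar] else []))
    pure
      { view := ![clientView, serverView]
        out := ![A.extract.toFun (Data.list [pub, sk, ctFinal]), Data.list []] }

/-! ## Bloom filters and garbled Bloom filters -/

/-- A family of hash functions: a polynomial-time function of the public parameters, the (public)
seed, the number of the hash function and the key. -/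
abbrev HashFamily : Type := PolyFun

section Filters

variable (P : Params) (H : HashFamily) {κ : ℕ}

/-- The hash functions given by a seed. -/
def hash (seed : P.Seed κ) (a : Fin (P.k κ)) (x : P.Key κ) : Fin (P.m κ) :=
  ⟨(H.toFun (Data.list [P.pub κ, Data.num seed, Data.num a, Data.num x])).toNat % P.m κ,
    Nat.mod_lt _ (P.m_pos κ)⟩

/-- The server holds key-value pairs with distinct keys. -/
structure ServerInput (P : Params) (κ : ℕ) where
  key : Fin (P.n κ) → P.Key κ
  val : Fin (P.n κ) → P.Val κ
  key_inj : Function.Injective key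

/-- The client holds queries and values associated with them. -/
structure ClientInput (P : Params) (κ : ℕ) where
  key : Fin (P.t κ) → P.Key κ
  val : Fin (P.t κ) → P.Val κ

open Classical in
/-- The Bloom filter of the keys of the server. -/
def bloom (seed : P.Seed κ) (y : ServerInput P κ) (pos : Fin (P.m κ)) : P.Val κ :=
  if ∃ j a, hash P H seed a (y.key j) = pos then 1 else 0

open Classical in
/-- Insertion of a pair into a garbled Bloom filter (`none` marks positions that are not set):
`pos` are the positions of the key and `g` is its value. The positions that are not set yet get
values that are random (`R` supplies them) subject to the sum over all `pos a` being `g`: the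
first of these positions is solved for and the others are taken from `R`. Insertion fails if all
positions are set already. -/
def gbfInsert (R : Fin (P.m κ) → P.Val κ) (pos : Fin (P.k κ) → Fin (P.m κ)) (g : P.Val κ)
    (A : Fin (P.m κ) → Option (P.Val κ)) : Option (Fin (P.m κ) → Option (P.Val κ)) :=
  match (List.finRange (P.k κ)).find? (fun a => (A (pos a)).isNone) with
  | none => none
  | some a0 =>
      let filled : Fin (P.m κ) → P.Val κ := fun l => (A l).getD (R l)
      let mult : ℕ := (Finset.univ.filter fun a => pos a = pos a0).card
      let rest : P.Val κ := ∑ a with pos a ≠ pos a0, filled (pos a)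
      some fun l =>
        if l = pos a0 then some ((g - rest) / (mult : P.Val κ))
        else if ∃ a, pos a = l then some (filled l)
        else A l

/-- The garbled Bloom filter of the pairs of the server, with random values supplied by `R`
(`none` if an insertion fails). Positions that stay free are filled with random values. -/
def gbf (seed : P.Seed κ) (y : ServerInput P κ) (R : Fin (P.m κ) → P.Val κ) :
    Option (Fin (P.m κ) → P.Val κ) :=
  ((List.finRange (P.n κ)).foldlM
      (fun A j => gbfInsert P R (fun a => hash P H seed a (y.key j)) (y.val j) A)
      (fun _ => none)).map
    fun A l => (A l).getD (R l)

/-- The parameters of the Bloom filter are chosen such that, for each set of at most `n` keys, a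
key outside it passes the membership test with negligible probability over the choice of the hash
functions only. -/
def BloomSound : Prop :=
  ∃ ε : ℕ → ℝ, Negligible ε ∧ ∀ (κ : ℕ) (Q : Finset (P.Key κ)) (x : P.Key κ),
    Q.card ≤ P.n κ → x ∉ Q →
      ((PMF.uniformOfFintype (P.Seed κ)).toOuterMeasure
        {seed | ∀ a, ∃ y ∈ Q, ∃ c, hash P H seed c y = hash P H seed a x}).toReal ≤ ε κ

end Filters

/-! ## The S-SIP functionality and the protocol S-SIP₂ -/

/-- The functionality: additive shares `(u - r, r)`, with `r` uniform, of `s_j g_l` for each query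
`x_j` that equals some server key `y_l`, and of `0` for each query that is not a server key. (As
the server keys are distinct, the sum has at most one nonzero term.) -/
def ssipF (P : Params) : Functionality where
  Inp κ := ClientInput P κ × ServerInput P κ
  input _ i :=
    ![Data.vec fun j => Data.pair (Data.num (i.1.key j)) (enc (i.1.val j)),
      Data.vec fun l => Data.pair (Data.num (i.2.key l)) (enc (i.2.val l))]
  ideal κ i := do
    let r ← PMF.uniformOfFintype (Fin (P.t κ) → P.Val κ)
    let u : Fin (P.t κ) → P.Val κ := fun j =>
      ∑ l, if i.1.key j = i.2.key l then i.1.val j * i.2.val l else 0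
    pure ![Data.vec fun j => enc (u j - r j), Data.vec fun j => enc (r j)]

/-- What the processing of one query leaves behind: views and shares of both parties. -/
structure QueryOutcome (P : Params) (κ : ℕ) where
  clientView : Data
  serverView : Data
  clientShare : P.Val κ
  serverShare : P.Val κ

/-- 1-out-of-`(k+1)` oblivious transfer of bits. -/
abbrev otBitF (P : Params) : Functionality := otF (fun κ => P.k κ + 1) (fun _ => 2)

/-- 1-out-of-2 oblivious transfer of field elements. -/
abbrev otValF (P : Params) : Functionality := otF (fun _ => 2) P.p

/-- A bit as a choice between two messages. -/
def choice (b : ZMod 2) : Fin 2 := ⟨b.val, ZMod.val_lt b⟩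

/-- A bit as an element of the field. -/
def bitVal {q : ℕ} (b : ZMod 2) : ZMod q := (b.val : ZMod q)

/-- The online phase for one query at positions `pos` with value `s`, on the filters `BF` and
`GBF`. -/
def processQuery (P : Params) (A : PIRScheme) (otBit otVal : Protocol) (κ : ℕ)
    (BF GBF : Fin (P.m κ) → P.Val κ) (pos : Fin (P.k κ) → Fin (P.m κ)) (s : P.Val κ) :
    PMF (QueryOutcome P κ) := do
  -- secure membership check; bits are added modulo 2
  let μ ← PMF.uniformOfFintype (P.Val κ)
  let o1 ← sumPIR P A false κ { idx := pos, scalar := 0, db := BF, mask := μ }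
  let μ' : P.Val κ := ((o1.out 0).toNat : P.Val κ)
  let bServer ← PMF.uniformOfFintype (ZMod 2)
  let special : ℕ := ((P.k κ : P.Val κ) - μ).val % (P.k κ + 1)
  let bits : Fin (P.k κ + 1) → ZMod 2 := fun a => if (a : ℕ) = special then 1 + bServer else bServer
  let o2 ← otBit.exec P.pub (otBitF P) κ
    (bits, ⟨μ'.val % (P.k κ + 1), Nat.mod_lt _ (Nat.succ_pos _)⟩)
  let bClient : ZMod 2 := ((o2.out 1).toNat : ZMod 2)
  -- secure associated value extraction
  let ρ ← PMF.uniformOfFintype (P.Val κ)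
  let o3 ← sumPIR P A true κ { idx := pos, scalar := s, db := GBF, mask := ρ }
  let δ : P.Val κ := ((o3.out 0).toNat : P.Val κ)
  -- secure component product; the client is the sender of the first transfer
  let Δ ← PMF.uniformOfFintype (P.Val κ)
  let o4 ← otVal.exec P.pub (otValF P) κ
    (![Δ + bitVal bClient * δ, Δ + (1 - bitVal bClient) * δ], choice bServer)
  let r : P.Val κ := ((o4.out 1).toNat : P.Val κ)
  let α ← PMF.uniformOfFintype (P.Val κ)
  let o5 ← otVal.exec P.pub (otValF P) κ
    (![r + bitVal bServer * (ρ - α) - (1 - bitVal bServer) * α,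
       r + (1 - bitVal bServer) * (ρ - α) - bitVal bServer * α], choice bClient)
  let r' : P.Val κ := ((o5.out 1).toNat : P.Val κ)
  pure
    { clientView := Data.list [o1.view 0, o2.view 1, o3.view 0, enc Δ, o4.view 0, o5.view 1]
      serverView := Data.list [enc μ, o1.view 1, enc bServer, o2.view 0, enc ρ, o3.view 1,
        o4.view 1, enc α, o5.view 0]
      clientShare := r' - Δ
      serverShare := α }

/-- The protocol S-SIP₂: the hash functions are fixed by a public random seed, the server sets up
its filters (and aborts if an insertion fails), then the queries are processed independently. -/
def ssip2 (P : Params) (H : HashFamily) (A : PIRScheme) (otBit otVal : Protocol) :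
    Execution (ssipF P) := fun κ i => do
  let seed ← PMF.uniformOfFintype (P.Seed κ)
  let R ← PMF.uniformOfFintype (Fin (P.m κ) → P.Val κ)
  let inC := (ssipF P).input κ i 0
  let inS := (ssipF P).input κ i 1
  let vR := Data.vec fun l => enc (R l)
  match gbf P H seed i.2 R with
  | none =>
      pure
        { view := ![Data.list [inC, Data.num seed], Data.list [inS, Data.num seed, vR]]
          out := fun _ => Data.list [] }
  | some GBF => do
      let q ← (List.finRange (P.t κ)).mapM fun j =>
        processQuery P A otBit otVal κ (bloom P H seed i.2) GBF
          (fun a => hash P H seed a (i.1.key j)) (i.1.val j)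
      pure
        { view := ![Data.list [inC, Data.num seed, Data.list (q.map fun o => o.clientView)],
            Data.list [inS, Data.num seed, vR, Data.list (q.map fun o => o.serverView)]]
          out := ![Data.list (q.map fun o => enc o.clientShare),
            Data.list (q.map fun o => enc o.serverShare)] }

end SSIP

end

/-! One query is treated first; a hybrid argument then passes to all queries.

Correctness of a query. Let `c` of the `k` filter positions be set. The client chooses by the
representative of `c - μ`, the special position comes from that of `k - μ`. Unless the latter is
below `k`, which has probability `k / p` (`wrap_prob_le`), the two differ by exactly `k - c`, so
they agree modulo `k + 1` just when `c = k`. Hence the bits of the two parties add up to the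
membership bit `e` modulo 2 (`QueryInput.clientBit_eq`). The two transfers of field elements then
give the server `Δ + e δ` and the client `Δ + e δ + e ρ - α`, and `δ + ρ` is the wanted product, so
the shares are `result - α` and `α` (`QueryInput.clientRecv_eq`).

Privacy of a query. The functionalities of the subprotocols are deterministic and security speaks of
the view jointly with the outputs, so real outputs are correct up to negligible probability
(`SecurelyRealizes.correct`). Each subprotocol may therefore be run on the ideal inputs
(`processQuery_close`). These are functions of the random values `μ, b, ρ, Δ, α` alone, so given
these values the five executions are independent and their views can be replaced by simulated ones
(`views_context`). What remains is a change of variables: the values that the client sees, `μ'`,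
`b₀`, `δ`, `Δ`, are uniform and independent and its last received value is its share plus `Δ`
(`client_reparam`); the value received by the server is masked by `Δ` (`server_reparam`).

All queries. Given the hash seed and the filter randomness the queries are independent, and
`CompIndist.vec` replaces them one at a time. Indistinguishability survives a random context because
distinguishers are non-uniform: the worst context is hard-coded as advice (`CompIndist.context`).
Seeds for which an insertion fails or a query is a false positive have negligible probability
(`badSeed_prob`); for all others the garbled filter sums to the stored values (`gbfTotal_sum`) and
every query has the result that the functionality prescribes (`queryInput_result`).

Efficiency of the simulators is proved with a calculus of polynomial-time computable families
(`Computes`, `Det`), whose loops need explicit bounds on their state. It culminates in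
`exists_clientCode` and `exists_serverCode`; the latter rebuilds the filters from the server's
input. -/

open scoped BigOperators
open scoped ENNReal

noncomputable section

namespace SSIP

open Params (enc)

/-! ## Expectations, statistical closeness, independent products -/

/-- Expectation of a nonnegative function. -/
def expect {α : Type*} (X : PMF α) (f : α → ℝ≥0∞) : ℝ≥0∞ := ∑' a, X a * f a

theorem expect_pure {α : Type*} (a : α) (f : α → ℝ≥0∞) : expect (PMF.pure a) f = f a := by
  unfold expect
  rw [tsum_eq_single a]
  · simp
  · intro b hb
    simp [PMF.pure_apply_of_ne _ _ hb]

theorem expect_bind {α β : Type*} (X : PMF α) (g : α → PMF β) (f : β → ℝ≥0∞) :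
    expect (X.bind g) f = expect X fun a => expect (g a) f := by
  unfold expect
  simp only [PMF.bind_apply, ← ENNReal.tsum_mul_right, ← ENNReal.tsum_mul_left]
  rw [ENNReal.tsum_comm]
  simp only [mul_assoc]

theorem expect_map {α β : Type*} (X : PMF α) (g : α → β) (f : β → ℝ≥0∞) :
    expect (X.map g) f = expect X fun a => f (g a) := by
  rw [← PMF.bind_pure_comp, expect_bind]
  simp [expect_pure]

theorem expect_add {α : Type*} (X : PMF α) (f g : α → ℝ≥0∞) :
    expect X (fun a => f a + g a) = expect X f + expect X g := by
  unfold expect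
  rw [← ENNReal.tsum_add]
  simp only [mul_add]

theorem expect_const {α : Type*} (X : PMF α) (c : ℝ≥0∞) : expect X (fun _ => c) = c := by
  unfold expect
  rw [ENNReal.tsum_mul_right, PMF.tsum_coe, one_mul]

theorem expect_mono {α : Type*} (X : PMF α) {f g : α → ℝ≥0∞} (h : ∀ a ∈ X.support, f a ≤ g a) :
    expect X f ≤ expect X g := by
  refine ENNReal.tsum_le_tsum fun a => ?_
  by_cases ha : a ∈ X.support
  · gcongr
    exact h a ha
  · rw [(PMF.apply_eq_zero_iff X a).2 ha]
    simp

theorem expect_le_add {α : Type*} (X : PMF α) {f g : α → ℝ≥0∞} {c : ℝ≥0∞}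
    (h : ∀ a ∈ X.support, f a ≤ g a + c) : expect X f ≤ expect X g + c := by
  calc expect X f ≤ expect X (fun a => g a + c) := expect_mono X h
    _ = expect X g + c := by rw [expect_add, expect_const]

theorem expect_le_one {α : Type*} (X : PMF α) {f : α → ℝ≥0∞} (h : ∀ a, f a ≤ 1) :
    expect X f ≤ 1 := by
  rw [← expect_const X 1]
  exact expect_mono X fun a _ => h a

/-- Probability of an event. -/
def probOf {α : Type*} (X : PMF α) (p : α → Prop) : ℝ≥0∞ :=
  open Classical in expect X fun a => if p a then 1 else 0

theorem probOf_mono {α : Type*} (X : PMF α) {p q : α → Prop} (h : ∀ a, p a → q a) :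
    probOf X p ≤ probOf X q := by
  classical
  refine expect_mono X fun a _ => ?_
  by_cases hp : p a
  · simp [hp, h a hp]
  · simp [hp]

theorem probOf_le_one {α : Type*} (X : PMF α) (p : α → Prop) : probOf X p ≤ 1 :=
  expect_le_one X fun a => by split_ifs <;> simp

theorem probOf_or {α : Type*} (X : PMF α) (p q : α → Prop) :
    probOf X (fun a => p a ∨ q a) ≤ probOf X p + probOf X q := by
  classical
  unfold probOf
  rw [← expect_add]
  refine expect_mono X fun a _ => ?_
  by_cases hp : p a <;> by_cases hq : q a <;> simp [hp, hq]

theorem probOf_exists {α ι : Type*} [Fintype ι] (X : PMF α) (p : ι → α → Prop) {c : ℝ≥0∞}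
    (h : ∀ j, probOf X (p j) ≤ c) :
    probOf X (fun a => ∃ j, p j a) ≤ Fintype.card ι * c := by
  classical
  have key : ∀ s : Finset ι, probOf X (fun a => ∃ j ∈ s, p j a) ≤ s.card * c := by
    intro s
    induction s using Finset.induction_on with
    | empty => simp [probOf, expect]
    | insert j s hj ih =>
      calc probOf X (fun a => ∃ l ∈ insert j s, p l a)
          ≤ probOf X (fun a => p j a ∨ ∃ l ∈ s, p l a) :=
            probOf_mono X fun a ha => by simpa using ha
        _ ≤ c + s.card * c := (probOf_or X _ _).trans (add_le_add (h j) ih)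
        _ = (insert j s).card * c := by
            rw [Finset.card_insert_of_notMem hj]
            push_cast
            ring
  simpa using key Finset.univ

theorem probOf_toOuterMeasure {α : Type*} (X : PMF α) (p : α → Prop) :
    probOf X p = X.toOuterMeasure {a | p a} := by
  classical
  rw [PMF.toOuterMeasure_apply]
  unfold probOf expect
  congr 1
  funext a
  by_cases h : p a <;> simp [h]

/-- Total variation distance at most `ε`. -/
def Close {α : Type*} (ε : ℝ≥0∞) (X Y : PMF α) : Prop :=
  ∀ f : α → ℝ≥0∞, (∀ a, f a ≤ 1) →
    expect X f ≤ expect Y f + ε ∧ expect Y f ≤ expect X f + ε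

theorem Close.refl {α : Type*} (X : PMF α) : Close 0 X X := fun f _ => by simp

theorem Close.symm {α : Type*} {ε : ℝ≥0∞} {X Y : PMF α} (h : Close ε X Y) : Close ε Y X :=
  fun f hf => (h f hf).symm

theorem Close.mono {α : Type*} {ε δ : ℝ≥0∞} {X Y : PMF α} (h : Close ε X Y) (hd : ε ≤ δ) :
    Close δ X Y := fun f hf =>
  ⟨(h f hf).1.trans (by gcongr), (h f hf).2.trans (by gcongr)⟩

theorem Close.bind {α β : Type*} {ε : ℝ≥0∞} (X : PMF α) {g g' : α → PMF β}
    (h : ∀ a ∈ X.support, Close ε (g a) (g' a)) : Close ε (X.bind g) (X.bind g') := by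
  intro f hf
  rw [expect_bind, expect_bind]
  exact ⟨expect_le_add X fun a ha => (h a ha f hf).1, expect_le_add X fun a ha => (h a ha f hf).2⟩

theorem Close.map {α β : Type*} {ε : ℝ≥0∞} {X Y : PMF α} (h : Close ε X Y) (g : α → β) :
    Close ε (X.map g) (Y.map g) := by
  intro f hf
  rw [expect_map, expect_map]
  exact h _ fun a => hf _

/-- Two continuations that are close outside an event of small probability. -/
theorem Close.bind_off {α β : Type*} {ε δ : ℝ≥0∞} (X : PMF α) (bad : α → Prop)
    (hbad : probOf X bad ≤ δ) {g g' : α → PMF β}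
    (h : ∀ a, ¬ bad a → Close ε (g a) (g' a)) : Close (δ + ε) (X.bind g) (X.bind g') := by
  classical
  have key : ∀ {g g' : α → PMF β}, (∀ a, ¬ bad a → Close ε (g a) (g' a)) →
      ∀ f : β → ℝ≥0∞, (∀ a, f a ≤ 1) →
      expect (X.bind g) f ≤ expect (X.bind g') f + (δ + ε) := by
    intro g g' h f hf
    rw [expect_bind, expect_bind]
    calc expect X (fun a => expect (g a) f)
        ≤ expect X (fun a => expect (g' a) f + (if bad a then 1 else 0)) + ε := by
          refine expect_le_add X fun a _ => ?_
          by_cases hb : bad a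
          -- On the bad event the expectation is at most 1, and the indicator pays for it.
          · simp only [hb, if_true]
            calc expect (g a) f ≤ 1 := expect_le_one _ hf
              _ ≤ expect (g' a) f + 1 + ε := le_add_right le_add_self
          · simpa [hb] using (h a hb f hf).1
      _ ≤ _ := by
          rw [expect_add, add_assoc]
          gcongr
          exact hbad
  exact fun f hf => ⟨key h f hf, key (fun a ha => (h a ha).symm) f hf⟩

/-- Independent samples. -/
def indep {α : Type} : {n : ℕ} → (Fin n → PMF α) → PMF (Fin n → α)
  | 0, _ => PMF.pure Fin.elim0
  | _ + 1, f => (f 0).bind fun a => (indep fun j => f j.succ).map (Fin.cons a)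

/-- The protocol runs its queries by `mapM` over a list; as an independent family indexed by `Fin n`
they are accessible to the hybrid argument. -/
theorem mapM_finRange {α : Type} {n : ℕ} (f : Fin n → PMF α) :
    (List.finRange n).mapM f = (indep f).map List.ofFn := by
  induction n with
  | zero =>
    simp only [List.finRange_zero, List.mapM_nil, indep, PMF.pure_map, List.ofFn_zero]
    rfl
  | succ n ih =>
    have hm : ∀ l : List (Fin n), (l.map Fin.succ).mapM f = l.mapM fun j => f j.succ := by
      intro l
      induction l with
      | nil => rfl
      | cons a l ihl => simp only [List.map_cons, List.mapM_cons, ihl]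
    rw [List.finRange_succ, List.mapM_cons, hm, ih]
    change (f 0).bind (fun a => PMF.bind _ fun l => PMF.pure (a :: l)) = _
    simp only [indep, PMF.map_bind, PMF.bind_map, PMF.map_comp]
    congr 1
    funext a
    rw [← PMF.bind_pure_comp]
    congr 1
    funext g
    simp [List.ofFn_succ]

theorem indep_support {α : Type} {n : ℕ} {f : Fin n → PMF α} {g : Fin n → α}
    (hg : g ∈ (indep f).support) (j : Fin n) : g j ∈ (f j).support := by
  induction n with
  | zero => exact j.elim0
  | succ n ih =>
    simp only [indep, PMF.mem_support_bind_iff, PMF.mem_support_map_iff] at hg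
    obtain ⟨a, ha, g', hg', rfl⟩ := hg
    refine Fin.cases ?_ (fun j => ?_) j
    · simpa using ha
    · simpa using ih hg' j

theorem indep_apply {α : Type} {n : ℕ} (f : Fin n → PMF α) (g : Fin n → α) :
    indep f g = ∏ j, f j (g j) := by
  classical
  induction n with
  | zero =>
    have : g = Fin.elim0 := Subsingleton.elim _ _
    simp [indep, this]
  | succ n ih =>
    rw [Fin.prod_univ_succ, indep, PMF.bind_apply, tsum_eq_single (g 0)]
    · congr 1
      rw [PMF.map_apply, tsum_eq_single (Fin.tail g)]
      · rw [if_pos (Fin.cons_self_tail g).symm, ih]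
        rfl
      · intro b hb
        rw [if_neg]
        intro hg
        refine hb ?_
        rw [hg, Fin.tail_cons]
    · intro a ha
      rw [PMF.map_apply]
      have : ∀ b : Fin n → α, ¬ g = Fin.cons a b := by
        rintro b rfl
        simp at ha
      simp [this]

/-- Draws that do not depend on each other commute, so the first stage of every coordinate can be
drawn ahead of all second stages. In `ssip_party` this pulls the shares of all queries to the front.
-/
theorem indep_bind {α β : Type} {n : ℕ} (u : Fin n → PMF α) (g : Fin n → α → PMF β) :
    (indep fun j => (u j).bind (g j)) = (indep u).bind fun a => indep fun j => g j (a j) := by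
  induction n with
  | zero => simp [indep]
  | succ n ih =>
    simp only [indep, PMF.bind_bind, PMF.bind_map, ih, PMF.map_bind, Function.comp_def,
      Fin.cons_zero, Fin.cons_succ]
    congr 1
    funext a
    rw [PMF.bind_comm]

theorem indep_pure {α : Type} {n : ℕ} (f : Fin n → α) :
    (indep fun j => PMF.pure (f j)) = PMF.pure f := by
  induction n with
  | zero =>
    simp only [indep]
    congr 1
    exact Subsingleton.elim _ _
  | succ n ih =>
    simp only [indep, PMF.pure_bind, ih, PMF.pure_map]
    congr 1
    exact Fin.cons_self_tail f

theorem indep_map {α β : Type} {n : ℕ} (u : Fin n → PMF α) (e : Fin n → α → β) :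
    (indep fun j => (u j).map (e j)) = (indep u).map fun g j => e j (g j) := by
  have := indep_bind u fun j a => PMF.pure (e j a)
  simp only [indep_pure] at this
  exact this

theorem indep_uniform {α : Type} [Fintype α] [Nonempty α] {n : ℕ} :
    PMF.uniformOfFintype (Fin n → α) = indep fun _ => PMF.uniformOfFintype α := by
  ext g
  rw [indep_apply]
  simp [PMF.uniformOfFintype_apply, ENNReal.inv_pow]

/-- Coordinate `j` is drawn after all the others. The placeholder `h` is arbitrary because its
sample is overwritten. A hybrid step exchanges one coordinate in this form. -/
theorem indep_split {α : Type} {n : ℕ} (f : Fin n → PMF α) (j : Fin n) (h : PMF α) :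
    indep f = (indep (Function.update f j h)).bind fun g =>
      (f j).map fun a => Function.update g j a := by
  induction n with
  | zero => exact j.elim0
  | succ n ih =>
    refine Fin.cases ?_ (fun j => ?_) j
    · simp only [indep, Function.update_self, PMF.bind_bind, PMF.bind_map, Function.comp_def]
      have : (fun j : Fin n => Function.update f 0 h j.succ) = fun j => f j.succ := by
        funext j
        simp [Fin.succ_ne_zero]
      simp only [this, Fin.update_cons_zero, PMF.bind_const]
      rw [← funext fun g => PMF.bind_pure_comp (fun a => (Fin.cons a g : Fin (n + 1) → α)) (f 0),
        PMF.bind_comm]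
      rfl
    · have h1 : (fun l : Fin n => Function.update f j.succ h l.succ)
          = Function.update (fun l => f l.succ) j h := by
        funext l
        by_cases hl : l = j
        · subst hl
          simp
        · simp [hl]
      have h2 : Function.update f j.succ h 0 = f 0 := by
        simp [(Fin.succ_ne_zero j).symm]
      simp only [indep, h1, h2, PMF.bind_bind, PMF.bind_map, Function.comp_def]
      rw [ih (fun l => f l.succ) j]
      congr 1
      funext a
      simp [PMF.map_bind, PMF.map_comp, Function.comp_def, Fin.cons_update]

theorem uniform_map_equiv {α β : Type*} [Fintype α] [Nonempty α] [Fintype β] [Nonempty β]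
    (e : α ≃ β) : (PMF.uniformOfFintype α).map e = PMF.uniformOfFintype β := by
  classical
  ext b
  rw [PMF.map_apply, tsum_eq_single (e.symm b)]
  · simp [PMF.uniformOfFintype_apply, Fintype.card_congr e]
  · intro a ha
    rw [if_neg]
    rintro rfl
    simp at ha

/-- Change of variables for a uniform sample: the form in which masking by a one-time pad is used.
-/
theorem uniform_bind_equiv {α β γ : Type*} [Fintype α] [Nonempty α] [Fintype β] [Nonempty β]
    (e : α ≃ β) (g : β → PMF γ) :
    ((PMF.uniformOfFintype α).bind fun a => g (e a)) = (PMF.uniformOfFintype β).bind g := by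
  rw [← uniform_map_equiv e, PMF.bind_map]
  rfl

/-! ## Negligible functions -/

theorem Negligible.add {f g : ℕ → ℝ} (hf : Negligible f) (hg : Negligible g) :
    Negligible fun κ => f κ + g κ :=
  Asymptotics.SuperpolynomialDecay.add hf hg

theorem Negligible.of_abs_le {f g : ℕ → ℝ} (hg : Negligible g) (h : ∀ κ, |f κ| ≤ |g κ|) :
    Negligible f :=
  Asymptotics.SuperpolynomialDecay.trans_abs_le hg h

theorem negligible_zero : Negligible fun _ => 0 :=
  Asymptotics.superpolynomialDecay_zero _ _

theorem Negligible.abs {f : ℕ → ℝ} (hf : Negligible f) : Negligible fun κ => |f κ| :=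
  hf.of_abs_le fun κ => by simp

/-- Absorbs the factors that come from union bounds and from the number of hybrids. -/
theorem Negligible.polyBounded_mul {f : ℕ → ℝ} (hf : Negligible f) {q : ℕ → ℕ}
    (hq : PolyBounded q) : Negligible fun κ => (q κ : ℝ) * f κ := by
  obtain ⟨Q, hQ⟩ := hq
  have h := Asymptotics.SuperpolynomialDecay.polynomial_mul hf (Q.map (Nat.castRingHom ℝ))
  refine Negligible.of_abs_le h fun κ => ?_
  rw [abs_mul, abs_mul]
  gcongr
  have : (Polynomial.eval (κ : ℝ) (Q.map (Nat.castRingHom ℝ))) = ((Q.eval κ : ℕ) : ℝ) := by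
    rw [Polynomial.eval_natCast_map]
    rfl
  rw [this]
  exact_mod_cast hQ κ

/-! ## Programs: sizes, costs, closure properties of polynomial time -/

theorem polynomial_eval_mono (Q : Polynomial ℕ) {a b : ℕ} (h : a ≤ b) : Q.eval a ≤ Q.eval b := by
  induction Q using Polynomial.induction_on' with
  | add p q hp hq =>
    rw [Polynomial.eval_add, Polynomial.eval_add]
    exact add_le_add hp hq
  | monomial n c =>
    rw [Polynomial.eval_monomial, Polynomial.eval_monomial]
    gcongr

theorem Data.size_pos (d : Data) : 0 < d.size := by
  cases d <;> simp [Data.size]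

@[simp] theorem Data.fst_pair (a b : Data) : (Data.pair a b).fst = a := rfl

@[simp] theorem Data.snd_pair (a b : Data) : (Data.pair a b).snd = b := rfl

@[simp] theorem Data.toNat_num (n : ℕ) : (Data.num n).toNat = n := rfl

theorem Data.size_fst_le (d : Data) : d.fst.size ≤ d.size := by
  cases d with
  | num n => simp [Data.size, Data.fst]
  | pair a b => simp only [Data.size, Data.fst]; omega

theorem Data.size_snd_le (d : Data) : d.snd.size ≤ d.size := by
  cases d with
  | num n => simp [Data.size, Data.snd]
  | pair a b => simp only [Data.size, Data.snd]; omega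

namespace Code

theorem foldRun_size_le {step : Data → PMF (Data × ℕ)}
    (h : ∀ d, ∀ o ∈ (step d).support, o.1.size ≤ o.2) :
    ∀ l s, ∀ o ∈ (foldRun step l s).support, o.1.size ≤ s.size + o.2 := by
  intro l
  induction l with
  | num n =>
    intro s o ho
    simp only [foldRun, PMF.mem_support_pure_iff] at ho
    simp [ho]
  | pair a l _ ih =>
    intro s o ho
    simp only [foldRun, PMF.mem_support_bind_iff, PMF.mem_support_pure_iff] at ho
    obtain ⟨u, hu, v, hv, rfl⟩ := ho
    have h1 := h _ u hu
    have h2 := ih _ v hv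
    simp only
    omega

/-- Every instruction is charged the size of its result. Bounds on running times therefore also
bound the intermediate data on which a composition goes on. -/
theorem size_le_cost (c : Code) : ∀ d, ∀ o ∈ (c.run d).support, o.1.size ≤ o.2 := by
  induction c with
  | ident | const _ | fst | snd | isNum | sizeOf | equal | arith _ =>
    intro d o ho
    simp only [run, PMF.mem_support_pure_iff] at ho
    simp [ho, charge]
  | rand =>
    intro d o ho
    simp only [run, PMF.mem_support_bind_iff, PMF.mem_support_pure_iff] at ho
    obtain ⟨n, -, rfl⟩ := ho
    simp [charge]
  | pair f g _ _ =>
    intro d o ho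
    simp only [run, PMF.mem_support_bind_iff, PMF.mem_support_pure_iff] at ho
    obtain ⟨u, -, v, -, rfl⟩ := ho
    simp
  | comp g f hg _ =>
    intro d o ho
    simp only [run, PMF.mem_support_bind_iff, PMF.mem_support_pure_iff] at ho
    obtain ⟨u, -, v, hv, rfl⟩ := ho
    have := hg _ v hv
    simp only
    omega
  | cond c f g _ hf hg =>
    intro d o ho
    simp only [run, PMF.mem_support_bind_iff, PMF.mem_support_pure_iff] at ho
    obtain ⟨u, -, v, hv, rfl⟩ := ho
    have : v.1.size ≤ v.2 := by
      split_ifs at hv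
      · exact hg _ v hv
      · exact hf _ v hv
    simp only
    omega
  | fold f hf =>
    intro d o ho
    simp only [run, PMF.mem_support_bind_iff, PMF.mem_support_pure_iff] at ho
    obtain ⟨v, hv, rfl⟩ := ho
    have h1 := foldRun_size_le hf _ _ v hv
    have h2 := d.size_snd_le
    simp only
    omega

theorem mem_eval_support {c : Code} {d v : Data} :
    v ∈ (c.eval d).support ↔ ∃ o ∈ (c.run d).support, o.1 = v := by
  simp [eval]

theorem PolyTime.size_bound {c : Code} (h : c.PolyTime) :
    ∃ Q : Polynomial ℕ, ∀ d, ∀ v ∈ (c.eval d).support, v.size ≤ Q.eval d.size := by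
  obtain ⟨Q, hQ⟩ := h
  refine ⟨Q, fun d v hv => ?_⟩
  obtain ⟨o, ho, rfl⟩ := mem_eval_support.1 hv
  exact (size_le_cost c d o ho).trans (hQ d o ho)

/-- The loop of `fold`, without costs. -/
def foldEval (step : Data → PMF Data) : Data → Data → PMF Data
  | Data.num _, s => PMF.pure s
  | Data.pair a l, s => (step (Data.pair a s)).bind fun u => foldEval step l u

theorem foldRun_map_fst (step : Data → PMF (Data × ℕ)) :
    ∀ l s, (foldRun step l s).map Prod.fst = foldEval (fun d => (step d).map Prod.fst) l s := by
  intro l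
  induction l with
  | num n =>
    intro s
    simp [foldRun, foldEval, PMF.pure_map]
  | pair a l _ ih =>
    intro s
    simp only [foldRun, foldEval, PMF.map_bind, PMF.bind_map, PMF.pure_map, Function.comp_def, ← ih]
    rfl

theorem eval_pair (f g : Code) (d : Data) : (pair f g).eval d =
    (f.eval d).bind fun u => (g.eval d).bind fun v => PMF.pure (Data.pair u v) := by
  simp only [eval, run, PMF.map_bind, PMF.bind_map, PMF.pure_map, Function.comp_def]

theorem eval_comp (g f : Code) (d : Data) : (comp g f).eval d = (f.eval d).bind g.eval := by
  simp only [eval, run, PMF.map_bind, PMF.bind_map, PMF.pure_map, Function.comp_def]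
  rfl

theorem eval_cond (c f g : Code) (d : Data) : (cond c f g).eval d =
    (c.eval d).bind fun u => if u = Data.num 0 then g.eval d else f.eval d := by
  simp only [eval, run, PMF.map_bind, PMF.bind_map, PMF.pure_map, Function.comp_def]
  congr 1
  funext u
  split_ifs <;> rfl

theorem eval_fold (f : Code) (d : Data) : (fold f).eval d = foldEval f.eval d.fst d.snd := by
  have := foldRun_map_fst f.run d.fst d.snd
  simp only [eval, run, PMF.map_bind, PMF.pure_map] at this ⊢
  exact this

theorem eval_rand (d : Data) : rand.eval d = (uniformBelow d.toNat).map Data.num := by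
  simp only [eval, run, PMF.map_bind, PMF.pure_map, charge]
  rfl

/-- A loop with efficient steps need not be efficient, since its state may grow. The invariant `I`
between remaining list and state provides one bound `c` for all steps, of which there are at most
`l.size`. -/
theorem foldRun_cost_le {step : Data → PMF (Data × ℕ)} (I : Data → Data → Prop) (c : ℕ)
    (h : ∀ a l s, I (Data.pair a l) s →
      ∀ o ∈ (step (Data.pair a s)).support, I l o.1 ∧ o.2 ≤ c) :
    ∀ l s, I l s → ∀ o ∈ (foldRun step l s).support, o.2 ≤ l.size * c := by
  intro l
  induction l with
  | num n =>
    intro s _ o ho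
    simp only [foldRun, PMF.mem_support_pure_iff] at ho
    simp [ho]
  | pair a l _ ih =>
    intro s hs o ho
    simp only [foldRun, PMF.mem_support_bind_iff, PMF.mem_support_pure_iff] at ho
    obtain ⟨u, hu, v, hv, rfl⟩ := ho
    have h1 := h _ _ _ hs u hu
    have h2 := ih _ h1.1 v hv
    simp only [Data.size]
    nlinarith [h1.2, Nat.zero_le (a.size * c)]

theorem PolyTime.pair {f g : Code} (hf : f.PolyTime) (hg : g.PolyTime) :
    (Code.pair f g).PolyTime := by
  obtain ⟨Qf, hQf⟩ := hf
  obtain ⟨Qg, hQg⟩ := hg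
  refine ⟨Qf + Qg + Polynomial.X + (Qf + Qg + 1), fun d o ho => ?_⟩
  simp only [run, PMF.mem_support_bind_iff, PMF.mem_support_pure_iff] at ho
  obtain ⟨u, hu, v, hv, rfl⟩ := ho
  have h1 := hQf d u hu
  have h2 := hQg d v hv
  have h3 := size_le_cost f d u hu
  have h4 := size_le_cost g d v hv
  simp only [Polynomial.eval_add, Polynomial.eval_X, Polynomial.eval_one, Data.size]
  omega

/-- The second program runs on data no larger than the cost of the first, so the composed polynomial
bounds its cost. -/
theorem PolyTime.comp {f g : Code} (hg : g.PolyTime) (hf : f.PolyTime) :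
    (Code.comp g f).PolyTime := by
  obtain ⟨Qf, hQf⟩ := hf
  obtain ⟨Qg, hQg⟩ := hg
  refine ⟨Qf + Qg.comp Qf + Polynomial.X, fun d o ho => ?_⟩
  simp only [run, PMF.mem_support_bind_iff, PMF.mem_support_pure_iff] at ho
  obtain ⟨u, hu, v, hv, rfl⟩ := ho
  have h1 := hQf d u hu
  have h2 := hQg _ v hv
  have h3 := polynomial_eval_mono Qg ((size_le_cost f d u hu).trans h1)
  simp only [Polynomial.eval_add, Polynomial.eval_X, Polynomial.eval_comp]
  omega

theorem PolyTime.cond {c f g : Code} (hc : c.PolyTime) (hf : f.PolyTime) (hg : g.PolyTime) :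
    (Code.cond c f g).PolyTime := by
  obtain ⟨Qc, hQc⟩ := hc
  obtain ⟨Qf, hQf⟩ := hf
  obtain ⟨Qg, hQg⟩ := hg
  refine ⟨Qc + (Qf + Qg) + Polynomial.X, fun d o ho => ?_⟩
  simp only [run, PMF.mem_support_bind_iff, PMF.mem_support_pure_iff] at ho
  obtain ⟨u, hu, v, hv, rfl⟩ := ho
  have h1 := hQc d u hu
  have h2 : v.2 ≤ Qf.eval d.size + Qg.eval d.size := by
    split_ifs at hv
    · exact (hQg d v hv).trans (by omega)
    · exact (hQf d v hv).trans (by omega)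
  simp only [Polynomial.eval_add, Polynomial.eval_X]
  omega

theorem polyTime_of_bound {c : Code} {r : Data → Data} (h : ∀ d, c.run d = PMF.pure (charge d (r d)))
    (Q : Polynomial ℕ) (hr : ∀ d, (r d).size ≤ Q.eval d.size) : c.PolyTime := by
  refine ⟨Polynomial.X + Q, fun d o ho => ?_⟩
  rw [h, PMF.mem_support_pure_iff] at ho
  rw [ho]
  simp only [charge, Polynomial.eval_add, Polynomial.eval_X]
  have := hr d
  omega

end Code

/-! ### Sizes of numbers and of results of arithmetic -/

theorem Data.unary_size (n : ℕ) : (Data.unary n).size = 2 * n + 1 := by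
  induction n with
  | zero => simp [Data.unary, Data.list, Data.size]
  | succ n ih =>
    simp only [Data.unary, List.replicate_succ, Data.list, Data.size] at ih ⊢
    rw [ih]
    simp
    omega

theorem Data.size_num_toNat_le (d : Data) : Nat.size d.toNat ≤ d.size := by
  cases d <;> simp [Data.toNat, Data.size]

theorem natSize_le_of_le {a b : ℕ} (h : a ≤ b) : Nat.size a ≤ Nat.size b := Nat.size_le_size h

theorem natSize_add_le (a b : ℕ) : Nat.size (a + b) ≤ Nat.size a + Nat.size b + 1 := by
  rw [Nat.size_le]
  have h1 := Nat.lt_size_self a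
  have h2 := Nat.lt_size_self b
  have h3 : 2 ^ Nat.size a ≤ 2 ^ (Nat.size a + Nat.size b) :=
    Nat.pow_le_pow_right (by norm_num) (by omega)
  have h4 : 2 ^ Nat.size b ≤ 2 ^ (Nat.size a + Nat.size b) :=
    Nat.pow_le_pow_right (by norm_num) (by omega)
  rw [pow_succ]
  omega

theorem natSize_mul_le (a b : ℕ) : Nat.size (a * b) ≤ Nat.size a + Nat.size b := by
  rw [Nat.size_le, pow_add]
  exact Nat.mul_lt_mul'' (Nat.lt_size_self a) (Nat.lt_size_self b)

theorem natSize_le_self (n : ℕ) : Nat.size n ≤ n := by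
  rw [Nat.size_le]
  exact Nat.lt_two_pow_self

theorem Arith.size_eval_le (o : Arith) (a b : ℕ) :
    Nat.size (o.eval a b) ≤ Nat.size a + Nat.size b + 1 := by
  cases o with
  | add => exact natSize_add_le a b
  | sub => exact (natSize_le_of_le (Nat.sub_le a b)).trans (by omega)
  | mul => exact (natSize_mul_le a b).trans (by omega)
  | div => exact (natSize_le_of_le (Nat.div_le_self a b)).trans (by omega)
  | mod => exact (natSize_le_of_le (Nat.mod_le a b)).trans (by omega)

/-! ## Computable families -/

/-- The randomized polynomial-time computation of `out i` from `inp i`. -/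
def Computes {ι : Type} (inp : ι → Data) (out : ι → PMF Data) : Prop :=
  ∃ c : Code, c.PolyTime ∧ ∀ i, c.eval (inp i) = out i

/-- The deterministic polynomial-time computation of `f i` from `inp i`. -/
abbrev Det {ι : Type} (inp f : ι → Data) : Prop := Computes inp fun i => PMF.pure (f i)

/-- Randomized maps on data that are computable in polynomial time. -/
abbrev PPT (F : Data → PMF Data) : Prop := Computes (fun d : Data => d) F

section Basic

variable {ι : Type} {inp : ι → Data}

theorem Computes.congr {X Y : ι → PMF Data} (h : Computes inp X) (he : ∀ i, X i = Y i) :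
    Computes inp Y := by
  obtain rfl : X = Y := funext he
  exact h

theorem Det.congr {f g : ι → Data} (h : Det inp f) (he : ∀ i, f i = g i) : Det inp g := by
  obtain rfl : f = g := funext he
  exact h

theorem Computes.reindex {ι' : Type} {X : ι → PMF Data} (h : Computes inp X) (g : ι' → ι) :
    Computes (fun i => inp (g i)) fun i => X (g i) := by
  obtain ⟨c, hc, he⟩ := h
  exact ⟨c, hc, fun i => he (g i)⟩

theorem Det.id : Det inp inp :=
  ⟨Code.ident, Code.polyTime_of_bound (r := fun d => d) (fun _ => rfl) Polynomial.X (by simp),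
    fun i => by simp [Code.eval, Code.run, PMF.pure_map, Code.charge]⟩

theorem Det.const (d : Data) : Det inp fun _ => d :=
  ⟨Code.const d, Code.polyTime_of_bound (r := fun _ => d) (fun _ => rfl) (Polynomial.C d.size)
    (by simp), fun i => by simp [Code.eval, Code.run, PMF.pure_map, Code.charge]⟩

theorem Computes.precomp {f : ι → Data} {X : ι → PMF Data} (hX : Computes f X) (hf : Det inp f) :
    Computes inp X := by
  obtain ⟨c, hc, hce⟩ := hX
  obtain ⟨b, hb, hbe⟩ := hf
  exact ⟨Code.comp c b, hc.comp hb, fun i => by rw [Code.eval_comp, hbe, PMF.pure_bind, hce]⟩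

theorem Computes.app {F : Data → PMF Data} (hF : PPT F) {f : ι → Data} (hf : Det inp f) :
    Computes inp fun i => F (f i) :=
  (hF.reindex f).precomp hf

theorem Det.fst {f : ι → Data} (hf : Det inp f) : Det inp fun i => (f i).fst := by
  refine Computes.app (F := fun d => PMF.pure d.fst) ⟨Code.fst, ?_, fun d => ?_⟩ hf
  · exact Code.polyTime_of_bound (r := Data.fst) (fun _ => rfl) Polynomial.X
      (by simpa using Data.size_fst_le)
  · simp [Code.eval, Code.run, PMF.pure_map, Code.charge]

theorem Det.snd {f : ι → Data} (hf : Det inp f) : Det inp fun i => (f i).snd := by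
  refine Computes.app (F := fun d => PMF.pure d.snd) ⟨Code.snd, ?_, fun d => ?_⟩ hf
  · exact Code.polyTime_of_bound (r := Data.snd) (fun _ => rfl) Polynomial.X
      (by simpa using Data.size_snd_le)
  · simp [Code.eval, Code.run, PMF.pure_map, Code.charge]

/-- Applied to `Det.id`, for an input that is a pair, this and its companion read variables off the
context. -/
theorem Det.pair_fst {f g : ι → Data} (h : Det inp fun i => Data.pair (f i) (g i)) : Det inp f :=
  h.fst

theorem Det.pair_snd {f g : ι → Data} (h : Det inp fun i => Data.pair (f i) (g i)) : Det inp g :=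
  h.snd

theorem Computes.pair {X Y : ι → PMF Data} (hX : Computes inp X) (hY : Computes inp Y) :
    Computes inp fun i => (X i).bind fun u => (Y i).bind fun v => PMF.pure (Data.pair u v) := by
  obtain ⟨c, hc, hce⟩ := hX
  obtain ⟨b, hb, hbe⟩ := hY
  exact ⟨Code.pair c b, hc.pair hb, fun i => by rw [Code.eval_pair, hbe, hce]⟩

theorem Det.pair {f g : ι → Data} (hf : Det inp f) (hg : Det inp g) :
    Det inp fun i => Data.pair (f i) (g i) :=
  (Computes.pair hf hg).congr fun i => by simp

theorem Det.cons {f : ι → Data} {l : ι → List Data} (hf : Det inp f)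
    (hl : Det inp fun i => Data.list (l i)) : Det inp fun i => Data.list (f i :: l i) :=
  hf.pair hl

theorem Det.nil : Det inp fun _ => Data.list [] := Det.const _

/-- Typed sequential composition. -/
theorem Computes.bind {τ : ι → Type} {U : ∀ i, PMF (τ i)} {e : ∀ i, τ i → Data}
    {out : ∀ i, τ i → PMF Data} (hU : Computes inp fun i => (U i).map (e i))
    (h : Computes (fun x : Σ i, τ i => Data.pair (inp x.1) (e x.1 x.2)) fun x => out x.1 x.2) :
    Computes inp fun i => (U i).bind (out i) := by
  obtain ⟨c, hc, hce⟩ := hU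
  obtain ⟨b, hb, hbe⟩ := h
  -- `Code.ident` keeps the input next to the sample, so that the second stage sees both.
  refine ⟨Code.comp b (Code.pair Code.ident c), hb.comp (Code.PolyTime.pair ?_ hc), fun i => ?_⟩
  · exact Code.polyTime_of_bound (r := fun d => d) (fun _ => rfl) Polynomial.X (by simp)
  · rw [Code.eval_comp, Code.eval_pair, hce]
    simp only [Code.eval, Code.run, PMF.pure_map, Code.charge, PMF.pure_bind, PMF.bind_bind,
      PMF.bind_map, Function.comp_def]
    congr 1
    funext a
    exact hbe ⟨i, a⟩

theorem Det.equal {f g : ι → Data} (hf : Det inp f) (hg : Det inp g) :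
    Det inp fun i => Data.num (if f i = g i then 1 else 0) := by
  refine (Computes.app (F := fun d => PMF.pure (Data.num (if d.fst = d.snd then 1 else 0)))
    ⟨Code.equal, ?_, fun d => ?_⟩ (hf.pair hg))
  · refine Code.polyTime_of_bound (r := fun d => if d.fst = d.snd then Data.num 1 else Data.num 0)
      (fun _ => rfl) 2 fun d => ?_
    have : Polynomial.eval d.size (2 : Polynomial ℕ) = 2 := Polynomial.eval_ofNat _ _
    rw [this]
    split_ifs <;> simp [Data.size]
  · simp only [Code.eval, Code.run, PMF.pure_map, Code.charge]
    split_ifs <;> rfl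

theorem Det.isNum {f : ι → Data} (hf : Det inp f) :
    Det inp fun i => Data.num (match f i with
      | Data.num _ => 1
      | Data.pair _ _ => 0) := by
  refine (Computes.app (F := fun d => PMF.pure (Data.num (match d with
      | Data.num _ => 1
      | Data.pair _ _ => 0)))
    ⟨Code.isNum, ?_, fun d => ?_⟩ hf)
  · refine Code.polyTime_of_bound (r := fun d => match d with
      | Data.num _ => Data.num 1
      | Data.pair _ _ => Data.num 0)
      (fun _ => rfl) 2 fun d => ?_
    have : Polynomial.eval d.size (2 : Polynomial ℕ) = 2 := Polynomial.eval_ofNat _ _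
    rw [this]
    cases d <;> simp [Data.size]
  · simp only [Code.eval, Code.run, PMF.pure_map, Code.charge]
    cases d <;> rfl

theorem Det.arith (o : Arith) {a b : ι → ℕ} (ha : Det inp fun i => Data.num (a i))
    (hb : Det inp fun i => Data.num (b i)) :
    Det inp fun i => Data.num (o.eval (a i) (b i)) := by
  refine (Computes.app (F := fun d => PMF.pure (Data.num (o.eval d.fst.toNat d.snd.toNat)))
    ⟨Code.arith o, ?_, fun d => ?_⟩ (ha.pair hb))
  · refine Code.polyTime_of_bound (r := fun d => Data.num (o.eval d.fst.toNat d.snd.toNat))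
      (fun _ => rfl) (Polynomial.X + Polynomial.X + 2) fun d => ?_
    have h2 : Polynomial.eval d.size (2 : Polynomial ℕ) = 2 := Polynomial.eval_ofNat _ _
    have h3 := o.size_eval_le d.fst.toNat d.snd.toNat
    have h4 := d.fst.size_num_toNat_le
    have h5 := d.snd.size_num_toNat_le
    have h6 := d.size_fst_le
    have h7 := d.size_snd_le
    simp only [Polynomial.eval_add, Polynomial.eval_X, h2, Data.size]
    omega
  · simp [Code.eval, Code.run, PMF.pure_map, Code.charge]

theorem Det.add {a b : ι → ℕ} (ha : Det inp fun i => Data.num (a i))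
    (hb : Det inp fun i => Data.num (b i)) : Det inp fun i => Data.num (a i + b i) :=
  Det.arith Arith.add ha hb

theorem Det.sub {a b : ι → ℕ} (ha : Det inp fun i => Data.num (a i))
    (hb : Det inp fun i => Data.num (b i)) : Det inp fun i => Data.num (a i - b i) :=
  Det.arith Arith.sub ha hb

theorem Det.mul {a b : ι → ℕ} (ha : Det inp fun i => Data.num (a i))
    (hb : Det inp fun i => Data.num (b i)) : Det inp fun i => Data.num (a i * b i) :=
  Det.arith Arith.mul ha hb

theorem Det.div {a b : ι → ℕ} (ha : Det inp fun i => Data.num (a i))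
    (hb : Det inp fun i => Data.num (b i)) : Det inp fun i => Data.num (a i / b i) :=
  Det.arith Arith.div ha hb

theorem Det.mod {a b : ι → ℕ} (ha : Det inp fun i => Data.num (a i))
    (hb : Det inp fun i => Data.num (b i)) : Det inp fun i => Data.num (a i % b i) :=
  Det.arith Arith.mod ha hb

theorem Det.num (n : ℕ) : Det inp fun _ => Data.num n := Det.const _

theorem Det.toNat {f : ι → Data} (hf : Det inp f) : Det inp fun i => Data.num (f i).toNat := by
  refine (Computes.app (F := fun d => PMF.pure (Data.num d.toNat)) ?_ hf)
  -- Adding zero coerces the argument to a number; a pair becomes `0`.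
  obtain ⟨c, hc, hce⟩ : Det (ι := Data) (fun d => Data.pair d (Data.num 0)) fun d =>
      Data.num (Arith.add.eval d.toNat 0) := by
    refine ⟨Code.arith Arith.add, ?_, fun d => ?_⟩
    · refine Code.polyTime_of_bound
        (r := fun d => Data.num (Arith.add.eval d.fst.toNat d.snd.toNat))
        (fun _ => rfl) (Polynomial.X + Polynomial.X + 2) fun d => ?_
      have h2 : Polynomial.eval d.size (2 : Polynomial ℕ) = 2 := Polynomial.eval_ofNat _ _
      have h3 := Arith.add.size_eval_le d.fst.toNat d.snd.toNat
      have h4 := d.fst.size_num_toNat_le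
      have h5 := d.snd.size_num_toNat_le
      have h6 := d.size_fst_le
      have h7 := d.size_snd_le
      simp only [Polynomial.eval_add, Polynomial.eval_X, h2, Data.size]
      omega
    · simp [Code.eval, Code.run, PMF.pure_map, Code.charge, Data.fst, Data.snd, Data.toNat]
  exact Computes.precomp ⟨c, hc, hce⟩ (Det.id.pair (Det.const _))

theorem Computes.cond {c : ι → ℕ} {X Y : ι → PMF Data} (hc : Det inp fun i => Data.num (c i))
    (hX : Computes inp X) (hY : Computes inp Y) :
    Computes inp fun i => if c i = 0 then Y i else X i := by
  obtain ⟨c0, hc0, hce⟩ := hc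
  obtain ⟨a, ha, hae⟩ := hX
  obtain ⟨b, hb, hbe⟩ := hY
  refine ⟨Code.cond c0 a b, hc0.cond ha hb, fun i => ?_⟩
  rw [Code.eval_cond, hce, PMF.pure_bind, hae, hbe]
  simp

theorem Det.cond {c : ι → ℕ} {f g : ι → Data} (hc : Det inp fun i => Data.num (c i))
    (hf : Det inp f) (hg : Det inp g) : Det inp fun i => if c i = 0 then g i else f i :=
  (Computes.cond hc hf hg).congr fun i => by by_cases h : c i = 0 <;> simp [h]

/-- Decidable predicates, as numbers. -/
abbrev DetP (inp : ι → Data) (p : ι → Prop) [∀ i, Decidable (p i)] : Prop :=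
  Det inp fun i => Data.num (if p i then 1 else 0)

theorem Det.ite {p : ι → Prop} [∀ i, Decidable (p i)] {f g : ι → Data}
    (hp : DetP inp p) (hf : Det inp f) (hg : Det inp g) :
    Det inp fun i => if p i then f i else g i :=
  (Det.cond hp hf hg).congr fun i => by split_ifs <;> simp_all

theorem DetP.natEq {a b : ι → ℕ} (ha : Det inp fun i => Data.num (a i))
    (hb : Det inp fun i => Data.num (b i)) : DetP inp fun i => a i = b i :=
  (Det.equal ha hb).congr fun i => by simp

theorem DetP.le {a b : ι → ℕ} (ha : Det inp fun i => Data.num (a i))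
    (hb : Det inp fun i => Data.num (b i)) : DetP inp fun i => a i ≤ b i :=
  (DetP.natEq (Det.sub ha hb) (Det.num 0)).congr fun i => by simp [Nat.sub_eq_zero_iff_le]

theorem Computes.size_bound {X : ι → PMF Data} (h : Computes inp X) :
    ∃ Q : Polynomial ℕ, ∀ i, ∀ v ∈ (X i).support, v.size ≤ Q.eval (inp i).size := by
  obtain ⟨c, hc, hce⟩ := h
  obtain ⟨Q, hQ⟩ := hc.size_bound
  exact ⟨Q, fun i v hv => hQ _ v (by rwa [hce])⟩

theorem Det.size_bound {f : ι → Data} (h : Det inp f) :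
    ∃ Q : Polynomial ℕ, ∀ i, (f i).size ≤ Q.eval (inp i).size := by
  obtain ⟨Q, hQ⟩ := Computes.size_bound h
  exact ⟨Q, fun i => hQ i _ (by simp)⟩

theorem Det.polyFun (H : PolyFun) {f : ι → Data} (hf : Det inp f) :
    Det inp fun i => H.toFun (f i) :=
  Computes.app (F := fun d => PMF.pure (H.toFun d)) H.polyTime hf

theorem Det.polyEval (Q : Polynomial ℕ) {a : ι → ℕ} (ha : Det inp fun i => Data.num (a i)) :
    Det inp fun i => Data.num (Q.eval (a i)) := by
  induction Q using Polynomial.induction_on with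
  | C c => simpa using Det.num c
  | add p q hp hq => simpa using Det.add hp hq
  | monomial n c h =>
    refine (Det.mul h ha).congr fun i => ?_
    simp [pow_succ, mul_assoc]

end Basic

/-! ## Loops -/

open Code (foldEval)

/-- The invariant relates the original input, the remaining list and the state. It is required for
every input and not only for meaningful ones, because `PolyTime` quantifies over all data; its
purpose is to keep the argument of each step below a polynomial in the size of the original input.
-/
theorem Computes.foldEval {F : Data → PMF Data} (hF : PPT F) {P : Data → Data}
    (hP : Det (fun d => d) P) (B : Polynomial ℕ) (I : Data → Data → Data → Prop)
    (h0 : ∀ d, I d (P d).fst (P d).snd)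
    (hs : ∀ d a l s, I d (Data.pair a l) s → (Data.pair a s).size ≤ B.eval d.size ∧
      ∀ o ∈ (F (Data.pair a s)).support, I d l o) :
    PPT fun d => foldEval F (P d).fst (P d).snd := by
  obtain ⟨f, ⟨Qf, hQf⟩, hfe⟩ := hF
  obtain ⟨p, ⟨Qp, hQp⟩, hpe⟩ := hP
  have hfe' : f.eval = F := funext hfe
  refine ⟨Code.comp (Code.fold f) p,
    ⟨Qp + (Qp * Qf.comp B + Qp) + Polynomial.X, fun d o ho => ?_⟩, fun d => ?_⟩
  · simp only [Code.run, PMF.mem_support_bind_iff, PMF.mem_support_pure_iff] at ho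
    obtain ⟨u, hu, _, ⟨v, hv, rfl⟩, rfl⟩ := ho
    have hu1 : u.1 = P d := by
      have : u.1 ∈ (p.eval d).support := Code.mem_eval_support.2 ⟨u, hu, rfl⟩
      simp only [hpe] at this
      simpa using this
    have h1 := hQp d u hu
    have h2 := Code.size_le_cost p d u hu
    have h3 : v.2 ≤ u.1.fst.size * Qf.eval (B.eval d.size) := by
      refine Code.foldRun_cost_le (I d) _ (fun a l s hI o ho => ⟨?_, ?_⟩) _ _ ?_ v hv
      · refine (hs d a l s hI).2 _ ?_
        rw [← hfe']
        exact Code.mem_eval_support.2 ⟨o, ho, rfl⟩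
      · exact (hQf _ o ho).trans (polynomial_eval_mono _ (hs d a l s hI).1)
      · rw [hu1]
        exact h0 d
    have h4 := u.1.size_fst_le
    have h5 : u.1.fst.size * Qf.eval (B.eval d.size)
        ≤ Qp.eval d.size * Qf.eval (B.eval d.size) := Nat.mul_le_mul_right _ (by omega)
    simp only [Polynomial.eval_add, Polynomial.eval_X, Polynomial.eval_comp, Polynomial.eval_mul]
    omega
  · rw [Code.eval_comp, hpe, PMF.pure_bind, Code.eval_fold, hfe']

theorem foldEval_pure_list (L M : List Data) :
    foldEval PMF.pure (Data.list L) (Data.list M) = PMF.pure (Data.list (L.reverse ++ M)) := by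
  induction L generalizing M with
  | nil => simp [Data.list, foldEval]
  | cons a L ih =>
    have := ih (a :: M)
    simp only [Data.list, foldEval, PMF.pure_bind] at this ⊢
    rw [this]
    simp

section Loops

variable {ι : Type} {inp : ι → Data}

theorem Det.reverse {l : ι → List Data} (hl : Det inp fun i => Data.list (l i)) :
    Det inp fun i => Data.list (l i).reverse := by
  have h : PPT fun d => Code.foldEval PMF.pure (Data.pair d (Data.num 0)).fst
      (Data.pair d (Data.num 0)).snd :=
    Computes.foldEval (F := PMF.pure) Det.id (P := fun d => Data.pair d (Data.num 0))
      (Det.id.pair (Det.const _)) (Polynomial.X + 1)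
      -- Reversal moves entries from the list to the state, which preserves the total size; the `1`
      -- is the empty list at the start.
      (fun d l s => l.size + s.size ≤ d.size + 1)
      (fun d => by simp [Data.fst_pair, Data.snd_pair, Data.size]) (fun d a l s h => by
        simp only [Data.size, Polynomial.eval_add, Polynomial.eval_X, Polynomial.eval_one] at h ⊢
        have := l.size_pos
        refine ⟨by omega, fun o ho => ?_⟩
        rw [PMF.mem_support_pure_iff] at ho
        rw [ho]
        simp only [Data.size]
        omega)
  refine (Computes.app h hl).congr fun i => ?_
  have := foldEval_pure_list (l i) []
  simpa [Data.fst_pair, Data.snd_pair, Data.list] using this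

theorem Det.length {l : ι → List Data} (hl : Det inp fun i => Data.list (l i)) :
    Det inp fun i => Data.num (l i).length := by
  have h : PPT fun d => Code.foldEval (fun d => PMF.pure (Data.num (d.snd.toNat + 1)))
      (Data.pair d (Data.num 0)).fst (Data.pair d (Data.num 0)).snd :=
    Computes.foldEval (Det.add (Det.toNat (Det.snd Det.id)) (Det.num 1))
      (P := fun d => Data.pair d (Data.num 0))
      (Det.id.pair (Det.const _)) (Polynomial.X + 1)
      (fun d l s => l.size + s.size ≤ d.size + 1)
      (fun d => by simp [Data.fst_pair, Data.snd_pair, Data.size]) (fun d a l s h => by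
        simp only [Data.size, Polynomial.eval_add, Polynomial.eval_X, Polynomial.eval_one] at h ⊢
        have := l.size_pos
        have := a.size_pos
        refine ⟨by omega, fun o ho => ?_⟩
        rw [PMF.mem_support_pure_iff] at ho
        rw [ho]
        have h1 : Nat.size (s.toNat + 1) + 1 ≤ s.size + 1 := by
          cases s with
          | num n =>
            simp only [Data.toNat, Data.size]
            have : Nat.size (n + 1) ≤ Nat.size n + 1 := by
              rw [Nat.size_le, pow_succ]
              have := Nat.lt_size_self n
              omega
            omega
          | pair x y =>
            simp [Data.toNat, Data.size]
        simp only [Data.size, Data.snd_pair]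
        omega)
  have key : ∀ (L : List Data) (n : ℕ),
      Code.foldEval (fun d => PMF.pure (Data.num (d.snd.toNat + 1))) (Data.list L) (Data.num n)
        = PMF.pure (Data.num (n + L.length)) := by
    intro L
    induction L with
    | nil => intro n; simp [Data.list, Code.foldEval]
    | cons a L ih =>
      intro n
      simp only [Data.list, Code.foldEval, PMF.pure_bind, Data.snd_pair, Data.toNat_num, ih]
      congr 2
      simp only [List.length_cons]
      omega
  refine (Computes.app h hl).congr fun i => ?_
  have := key (l i) 0
  simpa [Data.fst_pair, Data.snd_pair, Data.list] using this

theorem Det.ofUnary {n : ι → ℕ} (hn : Det inp fun i => Data.unary (n i)) :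
    Det inp fun i => Data.num (n i) :=
  (Det.length hn).congr fun i => by simp

theorem Det.size {f : ι → Data} (hf : Det inp f) : Det inp fun i => Data.num (f i).size := by
  have h : Det (fun d : Data => d) fun d => Data.unary d.size := by
    refine ⟨Code.sizeOf, ?_, fun d => by simp [Code.eval, Code.run, PMF.pure_map, Code.charge]⟩
    refine Code.polyTime_of_bound (r := fun d => Data.unary d.size) (fun _ => rfl)
      (Polynomial.X + Polynomial.X + 1) fun d => ?_
    rw [Data.unary_size]
    simp only [Polynomial.eval_add, Polynomial.eval_X, Polynomial.eval_one]
    omega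
  exact Det.ofUnary (Computes.app h hf)

/-- The list `[0, …, n - 1]`. -/
abbrev rangeData (n : ℕ) : Data := Data.vec fun j : Fin n => Data.num j

theorem rangeData_eq (n : ℕ) : rangeData n = Data.list ((List.range n).map Data.num) := by
  unfold rangeData Data.vec
  congr 1
  rw [List.ofFn_eq_map, ← List.map_coe_finRange_eq_range, List.map_map]
  rfl

theorem Det.range {n : ι → ℕ} (hn : Det inp fun i => Data.unary (n i)) :
    Det inp fun i => rangeData (n i) := by
  let F : Data → PMF Data := fun d =>
    PMF.pure (Data.pair (Data.num (d.snd.fst.toNat + 1)) (Data.pair d.snd.fst d.snd.snd))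
  have hF : PPT F :=
    (Det.add (Det.toNat (Det.fst (Det.snd Det.id))) (Det.num 1)).pair
      ((Det.fst (Det.snd Det.id)).pair (Det.snd (Det.snd Det.id)))
  let P : Data → Data := fun d => Data.pair d (Data.pair (Data.num 0) (Data.num 0))
  have h : PPT fun d => Code.foldEval F (P d).fst (P d).snd := by
    refine Computes.foldEval hF (P := P) (Det.id.pair (Det.const _))
      (Polynomial.X + Polynomial.X + Polynomial.X * (Polynomial.X + 3) + 3)
      -- The counter gains at most one bit per entry. Each remaining entry holds a budget of `d.size
      -- + 3`, enough to push one more counter value onto the accumulator.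
      (fun d l s => l.size ≤ d.size ∧ ∃ c acc, s = Data.pair c acc ∧ l.size + c.size ≤ d.size + 1 ∧
        acc.size + l.size * (d.size + 3) ≤ d.size * (d.size + 3) + 1)
      (fun d => ⟨le_rfl, Data.num 0, Data.num 0, rfl, by simp [P, Data.fst_pair, Data.size],
        by simp [P, Data.fst_pair, Data.size, add_comm]⟩) ?_
    rintro d a l s ⟨h1, c, acc, rfl, h2, h3⟩
    have hl := l.size_pos
    have ha := a.size_pos
    simp only [Data.size] at h1 h2 h3
    have h3' : acc.size + (a.size + 1) * (d.size + 3) + l.size * (d.size + 3)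
        ≤ d.size * (d.size + 3) + 1 := by nlinarith
    have h5 : d.size + 3 ≤ (a.size + 1) * (d.size + 3) := Nat.le_mul_of_pos_left _ (by omega)
    constructor
    · simp only [Data.size, Polynomial.eval_add, Polynomial.eval_X, Polynomial.eval_mul,
        Polynomial.eval_ofNat]
      omega
    · intro o ho
      simp only [F, PMF.mem_support_pure_iff, Data.fst_pair, Data.snd_pair] at ho
      refine ⟨by omega, _, _, ho, ?_, ?_⟩
      · have h1 : Nat.size (c.toNat + 1) + 1 ≤ c.size + 1 := by
          cases c with
          | num n =>
            simp only [Data.toNat, Data.size]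
            have : Nat.size (n + 1) ≤ Nat.size n + 1 := by
              rw [Nat.size_le, pow_succ]
              have := Nat.lt_size_self n
              omega
            omega
          | pair x y =>
            simp [Data.toNat, Data.size]
        simp only [Data.size]
        omega
      · simp only [Data.size]
        omega
  have key : ∀ (k j : ℕ) (M : List Data),
      Code.foldEval F (Data.unary k) (Data.pair (Data.num j) (Data.list M)) =
        PMF.pure (Data.pair (Data.num (j + k))
          (Data.list (((List.range' j k).map Data.num).reverse ++ M))) := by
    intro k
    induction k with
    | zero => intro j M; simp [Data.unary, Data.list, Code.foldEval]
    | succ k ih =>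
      intro j M
      have := ih (j + 1) (Data.num j :: M)
      simp only [Data.unary, List.replicate_succ, Data.list, Code.foldEval, F, PMF.pure_bind,
        Data.fst_pair, Data.snd_pair, Data.toNat_num] at this ⊢
      rw [this, List.range'_succ]
      simp [add_assoc, add_comm 1 k]
  have h2 : Det inp fun i => Data.list ((List.range (n i)).map Data.num).reverse := by
    have h3 : Det inp fun i => Data.pair (Data.num (n i))
        (Data.list ((List.range (n i)).map Data.num).reverse) := by
      refine (Computes.app h hn).congr fun i => ?_
      have := key (n i) 0 []
      simpa [P, Data.fst_pair, Data.snd_pair, Data.list, List.range_eq_range'] using this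
    exact h3.pair_snd
  exact (Det.reverse h2).congr fun i => by rw [List.reverse_reverse, rangeData_eq]

/-- The program is a fold whose state consists of the context and the reversed list of results so
far. Each step sees only the context and its own index, so the results are independent and the state
grows by a bounded amount per step. -/
theorem Computes.vec {n : ι → ℕ} (hn : Det inp fun i => Data.unary (n i))
    {f : ∀ i, Fin (n i) → PMF Data}
    (hf : Computes (fun x : Σ i, Fin (n i) => Data.pair (inp x.1) (Data.num x.2))
      fun x => f x.1 x.2) :
    Computes inp fun i => (indep (f i)).map Data.vec := by
  obtain ⟨c, hc, hce⟩ := hf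
  have hcC : PPT c.eval := ⟨c, hc, fun _ => rfl⟩
  obtain ⟨Qc, hQc⟩ := hc.size_bound
  let F : Data → PMF Data := fun d =>
    (c.eval (Data.pair d.snd.fst d.fst)).bind fun v =>
      PMF.pure (Data.pair d.snd.fst (Data.pair v d.snd.snd))
  have hF : PPT F := by
    have h1 : Det (fun d : Data => d) fun d => d.snd.fst := Det.fst (Det.snd Det.id)
    refine (Computes.pair h1 (Computes.pair
      (Computes.app hcC (h1.pair (Det.fst Det.id))) (Det.snd (Det.snd Det.id)))).congr fun d => ?_
    simp [F]
  let P : Data → Data := fun d => Data.pair d.fst (Data.pair d.snd (Data.num 0))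
  have h : PPT fun d => Code.foldEval F (P d).fst (P d).snd := by
    -- Bound for one result: the body is run on the context paired with one list entry, each of size
    -- at most `d.size`.
    let K : Polynomial ℕ := Qc.comp (Polynomial.X + Polynomial.X + 1)
    refine Computes.foldEval hF (P := P)
      ((Det.fst Det.id).pair ((Det.snd Det.id).pair (Det.const _)))
      (Polynomial.X + Polynomial.X + (Polynomial.X * (K + 1) + 1) + 2)
      (fun d l s => l.size ≤ d.size ∧ ∃ acc, s = Data.pair d.snd acc ∧
        acc.size + l.size * (K.eval d.size + 1) ≤ d.size * (K.eval d.size + 1) + 1)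
      (fun d => ⟨d.size_fst_le, _, rfl, ?_⟩) ?_
    · simp only [P, Data.fst_pair, Data.size, Nat.size_zero]
      have := Nat.mul_le_mul_right (K.eval d.size + 1) d.size_fst_le
      omega
    rintro d a l s ⟨h1, acc, rfl, h2⟩
    simp only [Data.size] at h1 h2
    have h2' : acc.size + (a.size + 1) * (K.eval d.size + 1) + l.size * (K.eval d.size + 1)
        ≤ d.size * (K.eval d.size + 1) + 1 := by nlinarith
    have h5 : K.eval d.size + 1 ≤ (a.size + 1) * (K.eval d.size + 1) :=
      Nat.le_mul_of_pos_left _ (by omega)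
    have h6 := d.size_snd_le
    constructor
    · simp only [Data.size, Polynomial.eval_add, Polynomial.eval_X, Polynomial.eval_mul,
        Polynomial.eval_ofNat, Polynomial.eval_one]
      omega
    · intro o ho
      simp only [F, PMF.mem_support_bind_iff, PMF.mem_support_pure_iff, Data.fst_pair, Data.snd_pair] at ho
      obtain ⟨v, hv, rfl⟩ := ho
      refine ⟨by omega, _, rfl, ?_⟩
      have h7 : v.size ≤ K.eval d.size := by
        refine (hQc _ v hv).trans ?_
        simp only [K, Polynomial.eval_comp, Polynomial.eval_add, Polynomial.eval_X,
          Polynomial.eval_one]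
        refine polynomial_eval_mono _ ?_
        simp only [Data.size]
        omega
      simp only [Data.size]
      omega
  have key : ∀ (n : ℕ) (ctx : Data) (a : Fin n → Data) (M : List Data),
      Code.foldEval F (Data.vec a) (Data.pair ctx (Data.list M)) =
        (indep fun j => c.eval (Data.pair ctx (a j))).map
          fun g => Data.pair ctx (Data.list ((List.ofFn g).reverse ++ M)) := by
    intro n ctx
    induction n with
    | zero =>
      intro a M
      simp [Data.vec, Data.list, Code.foldEval, indep, PMF.pure_map]
    | succ n ih =>
      intro a M
      have h1 := fun v => ih (fun j => a j.succ) (v :: M)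
      simp only [Data.vec, List.ofFn_succ, Data.list, Code.foldEval] at h1 ⊢
      rw [show F (Data.pair (a 0) (Data.pair ctx (Data.list M))) =
        (c.eval (Data.pair ctx (a 0))).bind fun v =>
          PMF.pure (Data.pair ctx (Data.pair v (Data.list M))) from rfl]
      simp only [PMF.bind_bind, PMF.pure_bind, indep, PMF.map_bind, PMF.map_comp,
        Function.comp_def]
      congr 1
      funext v
      rw [h1]
      simp
  have h2 : Computes inp fun i => (indep (f i)).map fun g =>
      Data.pair (inp i) (Data.list (List.ofFn g).reverse) := by
    refine (Computes.app h ((Det.range hn).pair Det.id)).congr fun i => ?_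
    have := key (n i) (inp i) (fun j => Data.num j) []
    simp only [P, Data.fst_pair, Data.snd_pair, Data.list, List.append_nil] at this ⊢
    rw [this]
    congr 2
    funext j
    exact hce ⟨i, j⟩
  refine ((Computes.bind (U := fun i => indep (f i))
    (e := fun i g => Data.pair (inp i) (Data.list (List.ofFn g).reverse))
    (out := fun i g => PMF.pure (Data.vec g)) h2 ?_)).congr fun i => ?_
  · refine (Det.reverse (l := fun x : Σ i, (Fin (n i) → Data) => (List.ofFn x.2).reverse)
      (Det.pair_snd (Det.pair_snd Det.id))).congr fun x => ?_
    simp [Data.vec]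
  · rfl

theorem Det.vec {n : ι → ℕ} (hn : Det inp fun i => Data.unary (n i))
    {f : ∀ i, Fin (n i) → Data}
    (hf : Det (fun x : Σ i, Fin (n i) => Data.pair (inp x.1) (Data.num x.2))
      fun x => f x.1 x.2) :
    Det inp fun i => Data.vec (f i) :=
  (Computes.vec hn (f := fun i j => PMF.pure (f i j)) hf).congr fun i => by
    rw [indep_pure, PMF.pure_map]

/-- Loops whose state stays of polynomial size. -/
theorem Det.iterate {n : ι → ℕ} (hn : Det inp fun i => Data.unary (n i)) {s : ι → ℕ → Data}
    (h0 : Det inp fun i => s i 0)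
    (hs : Det (fun x : Σ i, Fin (n i) =>
      Data.pair (inp x.1) (Data.pair (Data.num x.2) (s x.1 x.2))) fun x => s x.1 (x.2 + 1))
    (Q : Polynomial ℕ) (hQ : ∀ i j, j ≤ n i → (s i j).size ≤ Q.eval (inp i).size) :
    Det inp fun i => s i (n i) := by
  obtain ⟨c, hc, hce⟩ := hs
  have hcC : PPT c.eval := ⟨c, hc, fun _ => rfl⟩
  -- The bound on the states is known on the family only, while the program has to be
  -- polynomial-time on all data. Discarding oversized states enforces the bound everywhere and
  -- changes nothing on the family.
  let clamp : ℕ → Data → Data := fun b v => if v.size ≤ b then v else Data.num 0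
  let F : Data → PMF Data := fun d =>
    (c.eval (Data.pair d.snd.fst.snd (Data.pair d.fst d.snd.snd))).bind fun v =>
      PMF.pure (Data.pair d.snd.fst (clamp d.snd.fst.fst.toNat v))
  have hF : PPT F := by
    have h1 : Det (fun d : Data => d) fun d => d.snd.fst := Det.fst (Det.snd Det.id)
    refine Computes.bind (ι := Data) (τ := fun _ => Data) (e := fun _ v => v)
      (U := fun d => c.eval (Data.pair d.snd.fst.snd (Data.pair d.fst d.snd.snd)))
      (out := fun d v => PMF.pure (Data.pair d.snd.fst (clamp d.snd.fst.fst.toNat v))) ?_ ?_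
    · refine (Computes.app hcC ((Det.snd h1).pair
        ((Det.fst Det.id).pair (Det.snd (Det.snd Det.id))))).congr fun d => ?_
      exact (PMF.map_id _).symm
    · have hd : Det (fun x : Σ _ : Data, Data => Data.pair x.1 x.2) fun x => x.1 :=
        Det.pair_fst Det.id
      have hv : Det (fun x : Σ _ : Data, Data => Data.pair x.1 x.2) fun x => x.2 :=
        Det.pair_snd Det.id
      have he := hd.snd.fst
      exact he.pair (Det.ite (DetP.le hv.size he.fst.toNat) hv (Det.const _))
  -- The input is `((list of indices, initial state), context)`. The size bound and the context are
  -- moved into the state, where every step can read them.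
  let P : Data → Data := fun d =>
    Data.pair d.fst.fst (Data.pair (Data.pair (Data.num (Q.eval d.snd.size)) d.snd) d.fst.snd)
  have hP : Det (fun d => d) P := by
    have h1 : Det (fun d : Data => d) fun d => d.fst := Det.fst Det.id
    have h2 : Det (fun d : Data => d) fun d => d.snd := Det.snd Det.id
    exact h1.fst.pair (((Det.polyEval Q h2.size).pair h2).pair h1.snd)
  have h : PPT fun d => Code.foldEval F (P d).fst (P d).snd := by
    refine Computes.foldEval hF hP
      (Polynomial.X + (Q + 1 + Polynomial.X + 1) + (Q + Polynomial.X + 1) + 2)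
      (fun d l s => l.size ≤ d.size ∧
        ∃ st, s = Data.pair (Data.pair (Data.num (Q.eval d.snd.size)) d.snd) st ∧
          st.size ≤ Q.eval d.size + d.size + 1)
      (fun d => ⟨d.fst.size_fst_le.trans d.size_fst_le, _, rfl, ?_⟩) ?_
    · have := d.fst.size_snd_le
      have h1 := d.size_fst_le
      exact this.trans (by omega)
    rintro d a l s ⟨h1, st, rfl, h2⟩
    have h3 := polynomial_eval_mono Q d.size_snd_le
    have h4 := natSize_le_self (Q.eval d.snd.size)
    have h5 := d.size_snd_le
    simp only [Data.size] at h1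
    constructor
    · simp only [Data.size, Polynomial.eval_add, Polynomial.eval_X,
        Polynomial.eval_ofNat, Polynomial.eval_one]
      omega
    · intro o ho
      simp only [F, PMF.mem_support_bind_iff, PMF.mem_support_pure_iff, Data.fst_pair, Data.snd_pair] at ho
      obtain ⟨v, hv, rfl⟩ := ho
      refine ⟨by omega, _, rfl, ?_⟩
      simp only [clamp, Data.toNat_num]
      split_ifs with hb
      · omega
      · simp [Data.size]
  have key : ∀ (i : ι) (k j : ℕ), j + k = n i →
      Code.foldEval F (Data.list ((List.range' j k).map Data.num))
        (Data.pair (Data.pair (Data.num (Q.eval (inp i).size)) (inp i)) (s i j)) =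
      PMF.pure (Data.pair (Data.pair (Data.num (Q.eval (inp i).size)) (inp i)) (s i (n i))) := by
    intro i k
    induction k with
    | zero =>
      intro j hj
      obtain rfl : j = n i := by omega
      simp [Data.list, Code.foldEval]
    | succ k ih =>
      intro j hj
      have h1 := hce ⟨i, ⟨j, by omega⟩⟩
      simp only at h1
      have h2 : F (Data.pair (Data.num j)
          (Data.pair (Data.pair (Data.num (Q.eval (inp i).size)) (inp i)) (s i j))) =
          PMF.pure (Data.pair (Data.pair (Data.num (Q.eval (inp i).size)) (inp i))
            (s i (j + 1))) := by
        have h3 : clamp (Q.eval (inp i).size) (s i (j + 1)) = s i (j + 1) :=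
          if_pos (hQ i (j + 1) (by omega))
        simp only [F, Data.fst_pair, Data.snd_pair, h1, PMF.pure_bind, Data.toNat_num, h3]
      simp only [List.range'_succ, List.map_cons, Data.list, Code.foldEval, h2, PMF.pure_bind]
      exact ih (j + 1) (by omega)
  refine Det.pair_snd (f := fun i => Data.pair (Data.num (Q.eval (inp i).size)) (inp i)) ?_
  refine (Computes.app h (((Det.range hn).pair h0).pair Det.id)).congr fun i => ?_
  have := key i (n i) 0 (by omega)
  simp only [P, Data.fst_pair, Data.snd_pair, rangeData_eq, List.range_eq_range']
  exact this

end Loops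

/-! ### Access to the entries of a list -/

section Access

variable {ι : Type} {inp : ι → Data}

theorem Computes.weaken {ι' : Type} {g : ι' → ι} {e : ι' → Data} {X : ι → PMF Data}
    (h : Computes inp X) :
    Computes (fun x => Data.pair (inp (g x)) (e x)) fun x => X (g x) :=
  (h.reindex g).precomp Det.id.pair_fst

theorem Data.size_iterate_snd_le (d : Data) (c : ℕ) : (Data.snd^[c] d).size ≤ d.size := by
  induction c with
  | zero => simp
  | succ c ih =>
    rw [Function.iterate_succ_apply']
    exact (Data.size_snd_le _).trans ih

/-- The entry number `j` of a list. -/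
def Data.entry (d : Data) (j : ℕ) : Data := (Data.snd^[j] d).fst

theorem Data.entry_vec {n : ℕ} (f : Fin n → Data) (j : Fin n) :
    (Data.vec f).entry j = f j := by
  unfold Data.entry
  induction n with
  | zero => exact j.elim0
  | succ n ih =>
    have hv : Data.vec f = Data.pair (f 0) (Data.vec fun j => f j.succ) := by
      simp [Data.vec, List.ofFn_succ, Data.list]
    refine Fin.cases ?_ (fun j => ?_) j
    · simp [hv]
    · rw [Fin.val_succ, Function.iterate_succ_apply, hv, Data.snd_pair, ih fun j => f j.succ]

theorem Det.entry {n : ι → ℕ} (hn : Det inp fun i => Data.unary (n i)) {d : ι → Data}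
    (hd : Det inp d) {j : ∀ i, Fin (n i)} (hj : Det inp fun i => Data.num (j i)) :
    Det inp fun i => (d i).entry (j i) := by
  obtain ⟨Q, hQ⟩ := hd.size_bound
  -- The loop has `n i` rounds but passes to the tail only in the first `j i` of them; since `j i <
  -- n i`, the minimum disappears in the end.
  have h : Det inp fun i => Data.snd^[min (n i) (j i)] (d i) := by
    refine Det.iterate hn (s := fun i c => Data.snd^[min c (j i)] (d i)) ?_ ?_ Q
      fun i c _ => (Data.size_iterate_snd_le _ _).trans (hQ i)
    · simpa using hd
    · have hst : Det (fun x : Σ i, Fin (n i) => Data.pair (inp x.1)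
          (Data.pair (Data.num x.2) (Data.snd^[min x.2 (j x.1)] (d x.1))))
          fun x => Data.snd^[min x.2 (j x.1)] (d x.1) := Det.id.pair_snd.pair_snd
      have hc : Det (fun x : Σ i, Fin (n i) => Data.pair (inp x.1)
          (Data.pair (Data.num x.2) (Data.snd^[min x.2 (j x.1)] (d x.1))))
          fun x => Data.num x.2 := Det.id.pair_snd.pair_fst
      refine (Det.ite (DetP.le (hc.add (Det.num 1)) hj.weaken) hst.snd hst).congr fun x => ?_
      split_ifs with h
      · rw [min_eq_left h, min_eq_left (by omega), Function.iterate_succ_apply']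
      · rw [min_eq_right (by omega), min_eq_right (by omega)]
  refine h.fst.congr fun i => ?_
  rw [min_eq_right (j i).2.le, Data.entry]

theorem Det.nth {n : ι → ℕ} (hn : Det inp fun i => Data.unary (n i)) {f : ∀ i, Fin (n i) → Data}
    (hf : Det inp fun i => Data.vec (f i)) {j : ∀ i, Fin (n i)}
    (hj : Det inp fun i => Data.num (j i)) : Det inp fun i => f i (j i) :=
  (Det.entry hn hf hj).congr fun i => Data.entry_vec _ _

theorem Data.size_vec_le {n : ℕ} {f : Fin n → Data} {B : ℕ} (h : ∀ j, (f j).size ≤ B) :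
    (Data.vec f).size ≤ n * (B + 1) + 1 := by
  induction n with
  | zero => simp [Data.vec, Data.list, Data.size]
  | succ n ih =>
    have hv : Data.vec f = Data.pair (f 0) (Data.vec fun j => f j.succ) := by
      simp [Data.vec, List.ofFn_succ, Data.list]
    have h1 := ih (f := fun j => f j.succ) fun j => h _
    have h2 := h 0
    rw [hv, Data.size]
    nlinarith

end Access

/-! ## Computational indistinguishability -/

/-- Advantages are real numbers, whereas expectations live in `ℝ≥0∞`, where subtraction truncates.
Two inequalities without subtraction are what can be averaged there. -/
theorem abs_toReal_sub_le_iff {a b : ℝ≥0∞} {c : ℝ} (ha : a ≤ 1) (hb : b ≤ 1) (hc : 0 ≤ c) :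
    |a.toReal - b.toReal| ≤ c ↔ a ≤ b + ENNReal.ofReal c ∧ b ≤ a + ENNReal.ofReal c := by
  have key : ∀ {a b : ℝ≥0∞}, a ≤ 1 → b ≤ 1 →
      (a.toReal - b.toReal ≤ c ↔ a ≤ b + ENNReal.ofReal c) := by
    intro a b ha hb
    have ha' : a ≠ ⊤ := ne_top_of_le_ne_top ENNReal.one_ne_top ha
    have hb' : b ≠ ⊤ := ne_top_of_le_ne_top ENNReal.one_ne_top hb
    rw [← ENNReal.toReal_le_toReal ha' (by simp [hb']), ENNReal.toReal_add hb' (by simp),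
      ENNReal.toReal_ofReal hc]
    constructor <;> intro h <;> linarith
  rw [abs_le, ← key ha hb, ← key hb ha]
  constructor
  · rintro ⟨h1, h2⟩
    exact ⟨h2, by linarith⟩
  · rintro ⟨h1, h2⟩
    exact ⟨by linarith, h1⟩

theorem acceptProb_eq (D : Code) (a : Data) (X : PMF Data) :
    acceptProb D a X = (expect X fun v => D.eval (Data.pair a v) (Data.num 1)).toReal := rfl

theorem acceptProb_bind {α : Type*} (D : Code) (a : Data) (Z : PMF α) (X : α → PMF Data) :
    acceptProb D a (Z.bind X) =
      (expect Z fun z => expect (X z) fun v => D.eval (Data.pair a v) (Data.num 1)).toReal := by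
  rw [acceptProb_eq, expect_bind]

theorem acceptExpect_le_one (D : Code) (a : Data) (X : PMF Data) :
    expect X (fun v => D.eval (Data.pair a v) (Data.num 1)) ≤ 1 :=
  expect_le_one _ fun _ => PMF.coe_le_one _ _

theorem abs_acceptProb_sub_le_one (D : Code) (a : Data) (X Y : PMF Data) :
    |acceptProb D a X - acceptProb D a Y| ≤ 1 := by
  rw [acceptProb_eq, acceptProb_eq, abs_toReal_sub_le_iff (acceptExpect_le_one _ _ _)
    (acceptExpect_le_one _ _ _) zero_le_one, ENNReal.ofReal_one]
  exact ⟨(acceptExpect_le_one _ _ _).trans le_add_self,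
    (acceptExpect_le_one _ _ _).trans le_add_self⟩

theorem Close.acceptProb {ε : ℝ} (hε : 0 ≤ ε) {X Y : PMF Data}
    (h : Close (ENNReal.ofReal ε) X Y) (D : Code) (a : Data) :
    |acceptProb D a X - acceptProb D a Y| ≤ ε := by
  rw [acceptProb_eq, acceptProb_eq, abs_toReal_sub_le_iff (acceptExpect_le_one _ _ _)
    (acceptExpect_le_one _ _ _) hε]
  exact h _ fun _ => PMF.coe_le_one _ _

theorem CompIndist.refl {I : ℕ → Type} (X : (κ : ℕ) → I κ → PMF Data) : CompIndist X X :=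
  fun _ _ _ _ => ⟨fun _ => 0, negligible_zero, by simp⟩

theorem CompIndist.trans {I : ℕ → Type} {X Y Z : (κ : ℕ) → I κ → PMF Data}
    (h : CompIndist X Y) (h' : CompIndist Y Z) : CompIndist X Z := by
  intro D hD adv hadv
  obtain ⟨ε, hε, h1⟩ := h D hD adv hadv
  obtain ⟨δ, hδ, h2⟩ := h' D hD adv hadv
  exact ⟨_, hε.add hδ, fun κ i => (abs_sub_le _ _ _).trans (add_le_add (h1 κ i) (h2 κ i))⟩

theorem CompIndist.reindex {I J : ℕ → Type} {X Y : (κ : ℕ) → I κ → PMF Data}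
    (h : CompIndist X Y) (g : (κ : ℕ) → J κ → I κ) :
    CompIndist (fun κ j => X κ (g κ j)) fun κ j => Y κ (g κ j) := by
  intro D hD adv hadv
  obtain ⟨ε, hε, h1⟩ := h D hD adv hadv
  exact ⟨ε, hε, fun κ i => h1 κ _⟩

theorem CompIndist.congr {I : ℕ → Type} {X Y X' Y' : (κ : ℕ) → I κ → PMF Data}
    (h : CompIndist X Y) (hX : ∀ κ i, X κ i = X' κ i) (hY : ∀ κ i, Y κ i = Y' κ i) :
    CompIndist X' Y' := by
  obtain rfl : X = X' := funext fun κ => funext fun i => hX κ i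
  obtain rfl : Y = Y' := funext fun κ => funext fun i => hY κ i
  exact h

theorem CompIndist.of_close {I : ℕ → Type} {X Y : (κ : ℕ) → I κ → PMF Data} {ε : ℕ → ℝ}
    (hε : Negligible ε) (h : ∀ κ i, Close (ENNReal.ofReal (ε κ)) (X κ i) (Y κ i)) :
    CompIndist X Y := by
  intro D _ adv _
  refine ⟨fun κ => |ε κ|, hε.abs, fun κ i => ?_⟩
  exact Close.acceptProb (abs_nonneg _)
    ((h κ i).mono (ENNReal.ofReal_le_ofReal (le_abs_self _))) D _

/-- Indistinguishability is preserved by efficient postprocessing that depends on a random context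
of polynomial size, on which the input of the two ensembles may depend, too. -/
theorem CompIndist.context {I J : ℕ → Type} {X Y : (κ : ℕ) → I κ → PMF Data}
    (h : CompIndist X Y) {τ : (κ : ℕ) → J κ → Type} (Z : ∀ κ j, PMF (τ κ j))
    (a : ∀ κ j, τ κ j → Data) (i : ∀ κ j, τ κ j → I κ) (out : ∀ κ j, τ κ j → Data → PMF Data)
    (hout : Computes (fun y : Σ κ, Σ j : J κ, τ κ j × Data =>
      Data.pair (a y.1 y.2.1 y.2.2.1) y.2.2.2) fun y => out y.1 y.2.1 y.2.2.1 y.2.2.2)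
    (ha : ∃ Q : Polynomial ℕ, ∀ κ j, ∀ z ∈ (Z κ j).support, (a κ j z).size ≤ Q.eval κ) :
    CompIndist (fun κ j => (Z κ j).bind fun z => (X κ (i κ j z)).bind fun x => out κ j z x)
      (fun κ j => (Z κ j).bind fun z => (Y κ (i κ j z)).bind fun x => out κ j z x) := by
  intro D hD adv hadv
  obtain ⟨Q, hQ⟩ := ha
  obtain ⟨f, hf, hfe⟩ := hout
  have hf' : PPT f.eval := ⟨f, hf, fun _ => rfl⟩
  have hD' : PPT D.eval := ⟨D, hD, fun _ => rfl⟩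
  -- The reduction: its advice is the advice of `D` together with a context; it applies the
  -- postprocessing for this context and then `D`.
  obtain ⟨D', hD', hDe⟩ : PPT fun d =>
      (f.eval (Data.pair d.fst.snd d.snd)).bind fun v => D.eval (Data.pair d.fst.fst v) := by
    refine Computes.bind (ι := Data) (τ := fun _ => Data) (e := fun _ v => v)
      (U := fun d => f.eval (Data.pair d.fst.snd d.snd))
      (out := fun d v => D.eval (Data.pair d.fst.fst v)) ?_ ?_
    · refine (Computes.app hf' (Det.id.fst.snd.pair Det.id.snd)).congr fun d => ?_
      exact (PMF.map_id _).symm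
    · have hd : Det (fun x : Σ _ : Data, Data => Data.pair x.1 x.2) fun x => x.1 := Det.id.pair_fst
      exact Computes.app hD' (hd.fst.fst.pair Det.id.pair_snd)
  let g : ∀ κ, Data → I κ → ℝ := fun κ b i =>
    |acceptProb D' (Data.pair (adv κ) b) (X κ i) - acceptProb D' (Data.pair (adv κ) b) (Y κ i)|
  -- The context is random and depends on the input, but advice may depend on `κ` only, so a worst
  -- context is fixed. The supremum of the advantages over contexts and inputs need not be attained;
  -- a context that reaches half of it is taken, whence the factor 2. The `+ 1` leaves room for
  -- `Data.num 0`, used when no advantage is positive.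
  have hworst : ∀ κ, ∃ b : Data, b.size ≤ Q.eval κ + 1 ∧
      ∀ b', b'.size ≤ Q.eval κ → ∀ i, ∃ i', g κ b' i ≤ 2 * g κ b i' := by
    intro κ
    let T : Set ℝ := {r | ∃ b i, b.size ≤ Q.eval κ ∧ r = g κ b i}
    have hT : BddAbove T := ⟨1, by rintro r ⟨b, i, -, rfl⟩; exact abs_acceptProb_sub_le_one _ _ _ _⟩
    by_cases hpos : ∃ r ∈ T, 0 < r
    · obtain ⟨r, hr, hr0⟩ := hpos
      have hS : 0 < sSup T := hr0.trans_le (le_csSup hT hr)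
      obtain ⟨r', ⟨b, i, hb, rfl⟩, hr'⟩ := exists_lt_of_lt_csSup ⟨r, hr⟩ (half_lt_self hS)
      refine ⟨b, by omega, fun b' hb' i' => ⟨i, ?_⟩⟩
      have := le_csSup hT ⟨b', i', hb', rfl⟩
      linarith
    · refine ⟨Data.num 0, by simp [Data.size], fun b' hb' i' => ⟨i', ?_⟩⟩
      have h1 : g κ b' i' ≤ 0 := by
        by_contra hlt
        exact hpos ⟨_, ⟨b', i', hb', rfl⟩, not_le.1 hlt⟩
      exact h1.trans (mul_nonneg zero_le_two (abs_nonneg _))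
  choose b hb hbw using hworst
  obtain ⟨ε, hε, hle⟩ := h D' hD' (fun κ => Data.pair (adv κ) (b κ)) (by
    obtain ⟨R, hR⟩ := hadv
    refine ⟨R + (Q + 1) + 1, fun κ => ?_⟩
    simp only [Data.size, Polynomial.eval_add, Polynomial.eval_one]
    have h1 : (adv κ).size ≤ _ := hR κ
    have h2 := hb κ
    omega)
  refine ⟨fun κ => 2 * |ε κ|, by simpa using (hε.abs.add hε.abs).of_abs_le fun κ => by rw [two_mul],
    fun κ j => ?_⟩
  have hc : (0 : ℝ) ≤ 2 * |ε κ| := by positivity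
  have heq : ∀ (z : τ κ j) (W : PMF Data), (expect (W.bind fun x => out κ j z x) fun v =>
      D.eval (Data.pair (adv κ) v) (Data.num 1)) =
      expect W fun v => D'.eval (Data.pair (Data.pair (adv κ) (a κ j z)) v) (Data.num 1) := by
    intro z W
    rw [expect_bind]
    congr 1
    funext x
    have h1 : f.eval (Data.pair (a κ j z) x) = out κ j z x := hfe ⟨κ, j, z, x⟩
    have h2 := hDe (Data.pair (Data.pair (adv κ) (a κ j z)) x)
    simp only [Data.fst_pair, Data.snd_pair, h1] at h2
    rw [h2]
    rfl
  rw [acceptProb_bind, acceptProb_bind, abs_toReal_sub_le_iff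
    (expect_le_one _ fun z => acceptExpect_le_one _ _ _)
    (expect_le_one _ fun z => acceptExpect_le_one _ _ _) hc]
  -- The bound holds for each single context in the support and is then averaged over the contexts.
  have hz : ∀ z ∈ (Z κ j).support, _ :=
    fun z hz => (abs_toReal_sub_le_iff (acceptExpect_le_one D (adv κ)
      ((X κ (i κ j z)).bind fun x => out κ j z x)) (acceptExpect_le_one D (adv κ)
      ((Y κ (i κ j z)).bind fun x => out κ j z x)) hc).1 (by
        rw [heq, heq]
        obtain ⟨i', hi'⟩ := hbw κ _ (hQ κ j z hz) (i κ j z)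
        refine hi'.trans ?_
        gcongr
        exact (hle κ i').trans (le_abs_self _))
  exact ⟨expect_le_add _ fun z h => (hz z h).1, expect_le_add _ fun z h => (hz z h).2⟩

/-- All samples have polynomial size. -/
def PolySized {I : ℕ → Type} (X : (κ : ℕ) → I κ → PMF Data) : Prop :=
  ∃ Q : Polynomial ℕ, ∀ κ i, ∀ v ∈ (X κ i).support, v.size ≤ Q.eval κ

/-- Independent pairs. -/
def pairPMF (X Y : PMF Data) : PMF Data :=
  X.bind fun u => Y.bind fun v => PMF.pure (Data.pair u v)

theorem PolySized.pairPMF {I : ℕ → Type} {X Y : (κ : ℕ) → I κ → PMF Data}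
    (hX : PolySized X) (hY : PolySized Y) : PolySized fun κ i => pairPMF (X κ i) (Y κ i) := by
  obtain ⟨Q, hQ⟩ := hX
  obtain ⟨R, hR⟩ := hY
  refine ⟨Q + R + 1, fun κ i v hv => ?_⟩
  simp only [SSIP.pairPMF, PMF.mem_support_bind_iff, PMF.mem_support_pure_iff] at hv
  obtain ⟨u, hu, w, hw, rfl⟩ := hv
  have h1 := hQ κ i u hu
  have h2 := hR κ i w hw
  simp only [Data.size, Polynomial.eval_add, Polynomial.eval_one]
  omega

/-- Two hybrids, from `A, B` to `A, B'` to `A', B'`. In each step the component that stays is the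
context, which is why exactly `A` and `B'` have to be of polynomial size. -/
theorem CompIndist.pairPMF {I : ℕ → Type} {A A' B B' : (κ : ℕ) → I κ → PMF Data}
    (hA : CompIndist A A') (hB : CompIndist B B') (hAs : PolySized A) (hBs : PolySized B') :
    CompIndist (fun κ i => pairPMF (A κ i) (B κ i)) fun κ i => pairPMF (A' κ i) (B' κ i) := by
  have h1 : CompIndist (fun κ i => SSIP.pairPMF (A κ i) (B κ i))
      fun κ i => SSIP.pairPMF (A κ i) (B' κ i) :=
    CompIndist.context hB A (fun _ _ u => u) (fun _ i _ => i)
      (fun _ _ u x => PMF.pure (Data.pair u x)) Det.id hAs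
  have h2 := CompIndist.context hA B' (fun _ _ u => u) (fun _ i _ => i)
      (fun _ _ u x => PMF.pure (Data.pair x u)) (Det.id.pair_snd.pair Det.id.pair_fst) hBs
  refine h1.trans (h2.congr (fun κ i => ?_) fun κ i => ?_)
  · rw [SSIP.pairPMF, PMF.bind_comm]
  · rw [SSIP.pairPMF, PMF.bind_comm]

theorem CompIndist.map {I : ℕ → Type} {X Y : (κ : ℕ) → I κ → PMF Data} (h : CompIndist X Y)
    {f : Data → Data} (hf : Det (fun d => d) f) :
    CompIndist (fun κ i => (X κ i).map f) fun κ i => (Y κ i).map f := by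
  have := CompIndist.context h (J := I) (τ := fun _ _ => Unit) (fun _ _ => PMF.pure ())
    (fun _ _ _ => Data.num 0) (fun _ i _ => i) (fun _ _ _ x => PMF.pure (f x))
    (Computes.app hf Det.id.pair_snd) ⟨1, by simp [Data.size]⟩
  refine this.congr (fun κ i => ?_) fun κ i => ?_ <;>
  · rw [PMF.pure_bind]
    rfl

/-- The standard hybrid argument: polynomially many independent samples. -/
theorem CompIndist.vec {I : ℕ → Type} {X Y : (κ : ℕ) → I κ → PMF Data} (h : CompIndist X Y)
    (hX : PolySized X) (hY : PolySized Y) {t : ℕ → ℕ} (ht : PolyBounded t) :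
    CompIndist (I := fun κ => Fin (t κ) → I κ)
      (fun κ i => (indep fun j => X κ (i j)).map Data.vec)
      (fun κ i => (indep fun j => Y κ (i j)).map Data.vec) := by
  -- Hybrid `l` takes its first `l` coordinates from `Y` and the others from `X`.
  let M : (κ : ℕ) → (Fin (t κ) → I κ) → ℕ → Fin (t κ) → PMF Data := fun κ i l j =>
    if (j : ℕ) < l then Y κ (i j) else X κ (i j)
  let Hyb : (κ : ℕ) → (Fin (t κ) → I κ) → ℕ → PMF Data := fun κ i l =>
    (indep (M κ i l)).map Data.vec
  have hM : ∀ κ i (l : Fin (t κ)), Function.update (M κ i l) l (PMF.pure (Data.num 0)) =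
      Function.update (M κ i (l + 1)) l (PMF.pure (Data.num 0)) := by
    intro κ i l
    funext j
    by_cases hj : j = l
    · subst hj
      simp
    · have : (j : ℕ) ≠ l := fun h => hj (Fin.ext h)
      simp only [Function.update_of_ne hj, M]
      have h2 : (j : ℕ) < l ↔ (j : ℕ) < l + 1 := by omega
      simp [h2]
  -- The number of the hybrid is made part of the input, so that one negligible bound serves all
  -- steps and the sum is at most `t` times it.
  have hstep : CompIndist (I := fun κ => Fin (t κ) × (Fin (t κ) → I κ))
      (fun κ x => Hyb κ x.2 x.1) (fun κ x => Hyb κ x.2 (x.1 + 1)) := by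
    have := CompIndist.context h (J := fun κ => Fin (t κ) × (Fin (t κ) → I κ))
      (τ := fun κ _ => Fin (t κ) → Data)
      (fun κ x => indep (Function.update (M κ x.2 x.1) x.1 (PMF.pure (Data.num 0))))
      (fun κ x g => Data.pair (Data.pair (Data.unary (t κ)) (Data.num x.1)) (Data.vec g))
      (fun κ x _ => x.2 x.1)
      (fun κ x g d => PMF.pure (Data.vec (Function.update g x.1 d))) ?_ ?_
    · refine this.congr (fun κ x => ?_) fun κ x => ?_
      · simp only [Hyb]
        rw [indep_split (M κ x.2 x.1) x.1 (PMF.pure (Data.num 0)), PMF.map_bind]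
        congr 1
        funext g
        rw [PMF.map_comp]
        simp only [M, lt_irrefl, if_false]
        rfl
      · simp only [Hyb]
        rw [indep_split (M κ x.2 (x.1 + 1)) x.1 (PMF.pure (Data.num 0)), PMF.map_bind, hM]
        congr 1
        funext g
        rw [PMF.map_comp]
        simp only [M, Nat.lt_succ_self, if_true]
        rfl
    · let K : Type := Σ κ, Σ _ : Fin (t κ) × (Fin (t κ) → I κ), (Fin (t κ) → Data) × Data
      let inp : K → Data := fun y => Data.pair (Data.pair (Data.pair (Data.unary (t y.1))
        (Data.num y.2.1.1)) (Data.vec y.2.2.1)) y.2.2.2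
      have hctx : Det inp inp := Det.id
      have hn : Det inp fun y => Data.unary (t y.1) := hctx.pair_fst.pair_fst.pair_fst
      have hl : Det inp fun y => Data.num y.2.1.1 := hctx.pair_fst.pair_fst.pair_snd
      have hg : Det inp fun y => Data.vec y.2.2.1 := hctx.pair_fst.pair_snd
      have hd : Det inp fun y => y.2.2.2 := hctx.pair_snd
      refine Det.vec hn (f := fun y : K => Function.update y.2.2.1 y.2.1.1 y.2.2.2) ?_
      have hj : Det (fun x : Σ y : K, Fin (t y.1) => Data.pair (inp x.1) (Data.num x.2))
        fun x => Data.num x.2 := Det.id.pair_snd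
      refine (Det.ite (DetP.natEq hj hl.weaken) hd.weaken
        (Det.nth (f := fun (x : Σ y : K, Fin (t y.1)) j => x.1.2.2.1 j) (j := fun x => x.2)
          hn.weaken hg.weaken hj)).congr fun x => ?_
      by_cases hx : x.2 = x.1.2.1.1
      · rw [if_pos (congrArg _ hx), hx, Function.update_self]
      · rw [if_neg (fun h => hx (Fin.ext h)), Function.update_of_ne hx]
    · obtain ⟨QX, hQX⟩ := hX
      obtain ⟨QY, hQY⟩ := hY
      obtain ⟨T, hT⟩ := ht
      refine ⟨((2 * T + 1) + (T + 1) + 1) + (T * (QX + QY + 1 + 1) + 1) + 1, fun κ x g hg => ?_⟩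
      have h1 : ∀ j, (g j).size ≤ QX.eval κ + QY.eval κ + 1 := by
        intro j
        have := indep_support hg j
        by_cases hj : j = x.1
        · subst hj
          rw [Function.update_self, PMF.mem_support_pure_iff] at this
          rw [this]
          simp [Data.size]
        · rw [Function.update_of_ne hj] at this
          simp only [M] at this
          split_ifs at this
          · exact (hQY κ _ _ this).trans (by omega)
          · exact (hQX κ _ _ this).trans (by omega)
      have h2 := Data.size_vec_le h1
      have h3 := hT κ
      have h4 : t κ * (QX.eval κ + QY.eval κ + 1 + 1)
          ≤ T.eval κ * (QX.eval κ + QY.eval κ + 1 + 1) := Nat.mul_le_mul_right _ h3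
      have h5 := natSize_le_self (x.1 : ℕ)
      have h6 := x.1.2
      simp only [Data.size, Data.unary_size, Polynomial.eval_add, Polynomial.eval_mul,
        Polynomial.eval_one, Polynomial.eval_ofNat]
      omega
  intro D hD adv hadv
  obtain ⟨ε, hε, hle⟩ := hstep D hD adv hadv
  refine ⟨_, hε.polyBounded_mul ht, fun κ i => ?_⟩
  have hind : ∀ l, l ≤ t κ → |acceptProb D (adv κ) (Hyb κ i 0) - acceptProb D (adv κ) (Hyb κ i l)|
      ≤ l * ε κ := by
    intro l
    induction l with
    | zero => simp
    | succ l ih =>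
      intro hl
      have h1 := ih (by omega)
      have h2 := hle κ (⟨l, hl⟩, i)
      refine (abs_sub_le _ _ _).trans ((add_le_add h1 h2).trans (le_of_eq ?_))
      push_cast
      ring
  have := hind (t κ) le_rfl
  simpa [Hyb, M] using this

theorem bind_eq_bind {α β : Type} (X : PMF α) (f : α → PMF β) : (X >>= f) = X.bind f := rfl

theorem pure_eq_pure {α : Type} (a : α) : (Pure.pure a : PMF α) = PMF.pure a := rfl

/-! ## Families of data of polynomial size -/

/-- Data of size polynomial in the security parameter. -/
def PB {I : ℕ → Type} (f : (κ : ℕ) → I κ → Data) : Prop :=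
  ∃ Q : Polynomial ℕ, ∀ κ i, (f κ i).size ≤ Q.eval κ

section PB

variable {I : ℕ → Type}

theorem PB.reindex {J : ℕ → Type} {f : (κ : ℕ) → I κ → Data} (h : PB f)
    (g : (κ : ℕ) → J κ → I κ) : PB fun κ j => f κ (g κ j) := by
  obtain ⟨Q, hQ⟩ := h
  exact ⟨Q, fun κ j => hQ κ _⟩

theorem PB.pair {f g : (κ : ℕ) → I κ → Data} (hf : PB f) (hg : PB g) :
    PB fun κ i => Data.pair (f κ i) (g κ i) := by
  obtain ⟨Q, hQ⟩ := hf
  obtain ⟨R, hR⟩ := hg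
  refine ⟨Q + R + 1, fun κ i => ?_⟩
  have h1 := hQ κ i
  have h2 := hR κ i
  simp only [Data.size, Polynomial.eval_add, Polynomial.eval_one]
  omega

theorem PB.fst {f : (κ : ℕ) → I κ → Data} (hf : PB f) : PB fun κ i => (f κ i).fst := by
  obtain ⟨Q, hQ⟩ := hf
  exact ⟨Q, fun κ i => (Data.size_fst_le _).trans (hQ κ i)⟩

theorem PB.nil : PB (I := I) fun _ _ => Data.list [] := ⟨1, by simp [Data.list, Data.size]⟩

theorem PB.cons {f : (κ : ℕ) → I κ → Data} {l : (κ : ℕ) → I κ → List Data} (hf : PB f)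
    (hl : PB fun κ i => Data.list (l κ i)) : PB fun κ i => Data.list (f κ i :: l κ i) :=
  hf.pair hl

theorem Data.size_list_append (l m : List Data) :
    (Data.list (l ++ m)).size ≤ (Data.list l).size + (Data.list m).size := by
  induction l with
  | nil => simp [Data.list]
  | cons a l ih =>
    simp only [List.cons_append, Data.list, Data.size]
    omega

theorem PB.append {l m : (κ : ℕ) → I κ → List Data} (hl : PB fun κ i => Data.list (l κ i))
    (hm : PB fun κ i => Data.list (m κ i)) : PB fun κ i => Data.list (l κ i ++ m κ i) := by
  obtain ⟨Q, hQ⟩ := hl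
  obtain ⟨R, hR⟩ := hm
  refine ⟨Q + R, fun κ i => (Data.size_list_append _ _).trans ?_⟩
  rw [Polynomial.eval_add]
  exact add_le_add (hQ κ i) (hR κ i)

theorem PB.ite (b : Prop) [Decidable b] {f g : (κ : ℕ) → I κ → Data} (hf : PB f) (hg : PB g) :
    PB fun κ i => if b then f κ i else g κ i := by
  split_ifs <;> assumption

theorem PB.listIte (b : Prop) [Decidable b] {f g : (κ : ℕ) → I κ → List Data}
    (hf : PB fun κ i => Data.list (f κ i)) (hg : PB fun κ i => Data.list (g κ i)) :
    PB fun κ i => Data.list (if b then f κ i else g κ i) := by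
  split_ifs <;> assumption

theorem PB.num {x : (κ : ℕ) → I κ → ℕ} {c : ℕ → ℕ} (hc : PolyBounded c)
    (h : ∀ κ i, Nat.size (x κ i) ≤ c κ) : PB fun κ i => Data.num (x κ i) := by
  obtain ⟨Q, hQ⟩ := hc
  refine ⟨Q + 1, fun κ i => ?_⟩
  simp only [Data.size, Polynomial.eval_add, Polynomial.eval_one]
  exact Nat.succ_le_succ ((h κ i).trans (hQ κ))

theorem PB.numFin {n : ℕ → ℕ} (hn : PolyBounded n) {x : (κ : ℕ) → I κ → Fin (n κ)} :
    PB fun κ i => Data.num (x κ i) :=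
  PB.num hn fun κ i => (natSize_le_self _).trans (x κ i).2.le

theorem PB.coins {n : ℕ → ℕ} (hn : PolyBounded n) {x : (κ : ℕ) → I κ → Fin (2 ^ n κ)} :
    PB fun κ i => Data.num (x κ i) :=
  PB.num hn fun κ i => Nat.size_le.2 (x κ i).2

theorem PB.unary {n : ℕ → ℕ} (hn : PolyBounded n) : PB (I := I) fun κ _ => Data.unary (n κ) := by
  obtain ⟨Q, hQ⟩ := hn
  refine ⟨2 * Q + 1, fun κ _ => ?_⟩
  rw [Data.unary_size]
  have := hQ κ
  simp only [Polynomial.eval_add, Polynomial.eval_mul, Polynomial.eval_one, Polynomial.eval_ofNat]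
  omega

theorem PB.vec {n : ℕ → ℕ} (hn : PolyBounded n) {f : (κ : ℕ) → I κ → Fin (n κ) → Data}
    (hf : PB (I := fun κ => I κ × Fin (n κ)) fun κ x => f κ x.1 x.2) :
    PB fun κ i => Data.vec (f κ i) := by
  obtain ⟨Q, hQ⟩ := hf
  obtain ⟨R, hR⟩ := hn
  refine ⟨R * (Q + 1) + 1, fun κ i => (Data.size_vec_le fun j => hQ κ (i, j)).trans ?_⟩
  simp only [Polynomial.eval_add, Polynomial.eval_mul, Polynomial.eval_one]
  have := Nat.mul_le_mul_right (Q.eval κ + 1) (hR κ)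
  omega

theorem PB.det {F : Data → Data} (hF : Det (fun d => d) F) {f : (κ : ℕ) → I κ → Data}
    (hf : PB f) : PB fun κ i => F (f κ i) := by
  obtain ⟨Q, hQ⟩ := hF.size_bound
  obtain ⟨R, hR⟩ := hf
  refine ⟨Q.comp R, fun κ i => (hQ _).trans ?_⟩
  rw [Polynomial.eval_comp]
  exact polynomial_eval_mono Q (hR κ i)

theorem PB.polyFun (H : PolyFun) {f : (κ : ℕ) → I κ → Data} (hf : PB f) :
    PB fun κ i => H.toFun (f κ i) :=
  PB.det H.polyTime hf

theorem PB.app (A : RandAlg) {l : (κ : ℕ) → I κ → List Data}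
    {r : (κ : ℕ) → I κ → Fin (2 ^ A.coins κ)} (hl : PB fun κ i => Data.list (l κ i)) :
    PB fun κ i => A.app (l κ i) (r κ i) :=
  PB.polyFun A.alg (hl.pair (PB.coins A.coins_poly))

theorem PB.value (P : Params) {v : (κ : ℕ) → I κ → P.Val κ} : PB fun κ i => enc (v κ i) :=
  PB.num P.p_poly fun _ _ => natSize_le_of_le (ZMod.val_lt _).le

theorem PB.pub (P : Params) : PB (I := I) fun κ _ => P.pub κ := by
  refine PB.cons (PB.unary ⟨Polynomial.X, by simp⟩) (PB.cons (PB.num P.p_poly fun _ _ => le_rfl) ?_)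
  exact PB.cons (PB.unary P.k_poly) (PB.cons (PB.unary P.m_poly) (PB.cons (PB.unary P.t_poly)
    (PB.cons (PB.unary P.n_poly) (PB.cons (PB.unary P.keyLen_poly)
      (PB.cons (PB.unary P.seedLen_poly) PB.nil)))))

theorem PB.polySized {f : (κ : ℕ) → I κ → Data} (hf : PB f) :
    PolySized fun κ i => PMF.pure (f κ i) := by
  obtain ⟨Q, hQ⟩ := hf
  refine ⟨Q, fun κ i v hv => ?_⟩
  rw [PMF.mem_support_pure_iff] at hv
  rw [hv]
  exact hQ κ i

theorem PolySized.eval {S : Code} (hS : S.PolyTime) {f : (κ : ℕ) → I κ → Data} (hf : PB f) :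
    PolySized fun κ i => S.eval (f κ i) := by
  obtain ⟨Q, hQ⟩ := hS.size_bound
  obtain ⟨R, hR⟩ := hf
  refine ⟨Q.comp R, fun κ i v hv => (hQ _ v hv).trans ?_⟩
  rw [Polynomial.eval_comp]
  exact polynomial_eval_mono Q (hR κ i)

theorem PolySized.reindex {J : ℕ → Type} {X : (κ : ℕ) → I κ → PMF Data} (h : PolySized X)
    (g : (κ : ℕ) → J κ → I κ) : PolySized fun κ j => X κ (g κ j) := by
  obtain ⟨Q, hQ⟩ := h
  exact ⟨Q, fun κ j => hQ κ _⟩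

theorem PolySized.bind {J : ℕ → Type} {τ : (κ : ℕ) → J κ → Type} (Z : ∀ κ j, PMF (τ κ j))
    {X : ∀ κ j, τ κ j → PMF Data}
    (h : PolySized (I := fun κ => Σ j, τ κ j) fun κ x => X κ x.1 x.2) :
    PolySized fun κ j => (Z κ j).bind (X κ j) := by
  obtain ⟨Q, hQ⟩ := h
  refine ⟨Q, fun κ j v hv => ?_⟩
  simp only [PMF.mem_support_bind_iff] at hv
  obtain ⟨z, -, hz⟩ := hv
  exact hQ κ ⟨j, z⟩ v hz

end PB

/-! ## What security of a subprotocol gives -/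

section Security

variable {pub : ℕ → Data} {F : Functionality} {E : Execution F}

/-- For a deterministic functionality, views can be simulated. -/
theorem SecurelyRealizes.view (h : SecurelyRealizes pub F E) {y : ∀ κ, F.Inp κ → Fin 2 → Data}
    (hy : ∀ κ i, F.ideal κ i = PMF.pure (y κ i)) (b : Fin 2) :
    ∃ S : Code, S.PolyTime ∧ CompIndist (fun κ i => (E κ i).map fun o => o.view b)
      fun κ i => S.eval (Data.list [pub κ, F.input κ i b, y κ i b]) := by
  obtain ⟨S, hS, hind⟩ := h b
  refine ⟨S, hS, (hind.map Det.id.fst).congr (fun κ i => ?_) fun κ i => ?_⟩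
  · rw [realWorld, PMF.map_comp]
    rfl
  · simp only [idealWorld, bind_eq_bind, pure_eq_pure, hy, PMF.pure_bind, PMF.map_bind,
      PMF.pure_map, Data.list, Data.fst_pair]
    exact PMF.bind_pure _

/-- For a deterministic functionality, outputs are correct except with negligible probability. -/
theorem SecurelyRealizes.correct (h : SecurelyRealizes pub F E)
    {y : ∀ κ, F.Inp κ → Fin 2 → Data} (hy : ∀ κ i, F.ideal κ i = PMF.pure (y κ i)) (c : Fin 2)
    (hsize : PB fun κ i => y κ i c) :
    ∃ ε : ℕ → ℝ, Negligible ε ∧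
      ∀ κ i, probOf (E κ i) (fun o => o.out c ≠ y κ i c) ≤ ENNReal.ofReal (ε κ) := by
  -- The joint distribution contains both outputs, so the simulator for either party would do,
  -- whatever `c` is.
  obtain ⟨S, hS, hind⟩ := h 0
  let get : Data → Data := fun d => if c = 0 then d.snd.fst else d.snd.snd.fst
  have hget : Det (fun d => d) get := by
    by_cases hc : c = 0
    · exact Det.id.snd.fst.congr fun d => by simp [get, hc]
    · exact Det.id.snd.snd.fst.congr fun d => by simp [get, hc]
  have hgl : ∀ (v : Data) (o : Fin 2 → Data), get (Data.list [v, o 0, o 1]) = o c := by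
    intro v o
    by_cases hc : c = 0
    · simp [get, hc, Data.list]
    · obtain rfl : c = 1 := by omega
      simp [get, Data.list]
  -- The expected output is supplied as context and the postprocessing compares the actual output
  -- with it. The ideal world passes this test with probability one, so the real world fails it only
  -- with negligible probability.
  have hctx := CompIndist.context hind (J := F.Inp) (τ := fun _ _ => Unit) (fun _ _ => PMF.pure ())
    (fun κ i _ => y κ i c) (fun _ i _ => i)
    (fun κ i _ x => PMF.pure (Data.num (if get x = y κ i c then 1 else 0)))
    (Det.equal (Computes.app hget Det.id.pair_snd) Det.id.pair_fst) (by
      obtain ⟨Q, hQ⟩ := hsize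
      exact ⟨Q, fun κ i _ _ => hQ κ i⟩)
  obtain ⟨D, hD, hDe⟩ : Det (fun d : Data => d) fun d => d.snd := Det.id.snd
  obtain ⟨ε, hε, hle⟩ := hctx D hD (fun _ => Data.num 0) ⟨1, by simp [Data.size]⟩
  refine ⟨fun κ => |ε κ|, hε.abs, fun κ i => ?_⟩
  classical
  have hD1 : ∀ v : Data, D.eval (Data.pair (Data.num 0) v) (Data.num 1) =
      if v = Data.num 1 then 1 else 0 := by
    intro v
    rw [hDe]
    simp [PMF.pure_apply, eq_comm]
  have hite : ∀ q : Prop, [Decidable q] → ((if Data.num (if q then 1 else 0) = Data.num 1 then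
      (1 : ℝ≥0∞) else 0) = if q then 1 else 0) := by
    intro q _
    by_cases hq : q <;> simp [hq]
  have h1 := (hle κ i).trans (le_abs_self _)
  simp only [PMF.pure_bind, acceptProb_bind, expect_pure, hD1, hite] at h1
  rw [abs_toReal_sub_le_iff (expect_le_one _ fun a => by split_ifs <;> simp)
    (expect_le_one _ fun a => by split_ifs <;> simp) (abs_nonneg _)] at h1
  have h2 : expect (idealWorld pub F S 0 κ i) (fun x => if get x = y κ i c then 1 else 0) = 1 := by
    simp only [idealWorld, bind_eq_bind, pure_eq_pure, hy, PMF.pure_bind, expect_bind, expect_pure,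
      hgl, if_true, expect_const]
  have h3 : expect (realWorld F E 0 κ i) (fun x => if get x = y κ i c then 1 else 0) =
      expect (E κ i) fun o => if o.out c = y κ i c then 1 else 0 := by
    rw [realWorld, expect_map]
    simp only [hgl]
  rw [h2, h3] at h1
  have h4 : probOf (E κ i) (fun o => o.out c ≠ y κ i c) +
      expect (E κ i) (fun o => if o.out c = y κ i c then 1 else 0) = 1 := by
    rw [probOf, ← expect_add]
    refine Eq.trans ?_ (expect_const (E κ i) 1)
    congr 1
    funext o
    by_cases ho : o.out c = y κ i c <;> simp [ho]
  have h5 : expect (E κ i) (fun o => if o.out c = y κ i c then (1 : ℝ≥0∞) else 0) ≠ ⊤ :=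
    ne_top_of_le_ne_top ENNReal.one_ne_top (expect_le_one _ fun a => by split_ifs <;> simp)
  refine (ENNReal.add_le_add_iff_right h5).1 ?_
  rw [h4, add_comm]
  exact h1.2

end Security

/-! ## Real views have polynomial size -/

theorem Protocol.Efficient.polySized {T : Protocol} {pub : ℕ → Data} {F : Functionality}
    (h : T.Efficient pub F) (b : Fin 2) :
    PolySized fun κ i => (T.exec pub F κ i).map fun o => o.view b := by
  obtain ⟨Q, hQ⟩ := h
  refine ⟨Q, fun κ i v hv => ?_⟩
  simp only [Protocol.exec, bind_eq_bind, pure_eq_pure, PMF.mem_support_map_iff,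
    PMF.mem_support_bind_iff, PMF.mem_support_pure_iff] at hv
  obtain ⟨o, ⟨r0, -, r1, -, rfl⟩, rfl⟩ := hv
  refine hQ κ i _ b fun c => ?_
  refine Fin.cases ?_ (fun c => ?_) c
  · exact r0.2
  · rw [Subsingleton.elim c 0]
    exact r1.2

theorem sumPIR_polySized (P : Params) (A : PIRScheme) (scaled : Bool) (b : Fin 2) :
    PolySized fun κ i => (sumPIR P A scaled κ i).map fun o => o.view b := by
  -- The input and all random choices are collected in one index. Each message is then a
  -- deterministic function of the index, to which the closure properties of `PB` apply.
  let J : ℕ → Type := fun κ => SumPIRInput P κ × Fin (2 ^ A.keyGen.coins κ) ×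
    (Fin (P.k κ) → Fin (2 ^ A.query.coins κ)) × Fin (2 ^ A.encrypt.coins κ) ×
    (Fin (P.k κ) → Fin (2 ^ A.answer.coins κ)) × Fin (2 ^ A.evalSum.coins κ) ×
    Fin (2 ^ A.evalMul.coins κ) × Fin (2 ^ A.encrypt.coins κ) × Fin (2 ^ A.evalSum.coins κ)
  let keys : (κ : ℕ) → J κ → Data := fun κ j => A.keyGen.app [P.pub κ] j.2.1
  let pk : (κ : ℕ) → J κ → Data := fun κ j => (keys κ j).fst
  let q : (κ : ℕ) → (j : J κ) → Fin (P.k κ) → Data := fun κ j a =>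
    A.query.app [P.pub κ, pk κ j, Data.num (j.1.idx a)] (j.2.2.1 a)
  let eScalar : (κ : ℕ) → J κ → Data := fun κ j =>
    A.encrypt.app [P.pub κ, pk κ j, enc j.1.scalar] j.2.2.2.1
  let db : (κ : ℕ) → J κ → Data := fun κ j => Data.vec fun a => enc (j.1.db a)
  let d : (κ : ℕ) → (j : J κ) → Fin (P.k κ) → Data := fun κ j a =>
    A.answer.app [P.pub κ, pk κ j, q κ j a, db κ j] (j.2.2.2.2.1 a)
  let ct : (κ : ℕ) → J κ → Data := fun κ j =>
    A.evalSum.app [P.pub κ, pk κ j, Data.vec (d κ j)] j.2.2.2.2.2.1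
  let ctScaled : (κ : ℕ) → J κ → Data := fun κ j =>
    if scaled then A.evalMul.app [P.pub κ, pk κ j, Data.list [ct κ j, eScalar κ j]]
      j.2.2.2.2.2.2.1 else ct κ j
  let ctMask : (κ : ℕ) → J κ → Data := fun κ j =>
    A.encrypt.app [P.pub κ, pk κ j, enc (-j.1.mask)] j.2.2.2.2.2.2.2.1
  let ctFinal : (κ : ℕ) → J κ → Data := fun κ j =>
    A.evalSum.app [P.pub κ, pk κ j, Data.list [ctScaled κ j, ctMask κ j]] j.2.2.2.2.2.2.2.2
  have hkeys : PB keys := PB.app _ (PB.cons (PB.pub P) PB.nil)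
  have hpk : PB pk := hkeys.fst
  have hq : PB (I := fun κ => J κ × Fin (P.k κ)) fun κ x => q κ x.1 x.2 :=
    PB.app _ (PB.cons (PB.pub P) (PB.cons (hpk.reindex fun κ (x : J κ × Fin (P.k κ)) => x.1)
      (PB.cons (PB.numFin P.m_poly) PB.nil)))
  have heS : PB eScalar := PB.app _ (PB.cons (PB.pub P) (PB.cons hpk (PB.cons (PB.value P) PB.nil)))
  have hdb : PB db := PB.vec P.m_poly (PB.value P)
  have hd : PB (I := fun κ => J κ × Fin (P.k κ)) fun κ x => d κ x.1 x.2 :=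
    PB.app _ (PB.cons (PB.pub P) (PB.cons (hpk.reindex fun κ (x : J κ × Fin (P.k κ)) => x.1)
      (PB.cons hq (PB.cons (hdb.reindex fun κ (x : J κ × Fin (P.k κ)) => x.1) PB.nil))))
  have hct : PB ct := PB.app _ (PB.cons (PB.pub P) (PB.cons hpk
    (PB.cons (PB.vec P.k_poly hd) PB.nil)))
  have hctS : PB ctScaled := PB.ite _ (PB.app _ (PB.cons (PB.pub P) (PB.cons hpk
    (PB.cons (PB.cons hct (PB.cons heS PB.nil)) PB.nil)))) hct
  have hctM : PB ctMask := PB.app _ (PB.cons (PB.pub P) (PB.cons hpk (PB.cons (PB.value P) PB.nil)))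
  have hctF : PB ctFinal := PB.app _ (PB.cons (PB.pub P) (PB.cons hpk
    (PB.cons (PB.cons hctS (PB.cons hctM PB.nil)) PB.nil)))
  let view : Fin 2 → (κ : ℕ) → J κ → Data := fun b κ j =>
    (![Data.list
      ([(sumPIRF P scaled).input κ j.1 0, Data.num j.2.1,
          Data.vec fun a => Data.num (j.2.2.1 a)] ++
        (if scaled then [Data.num j.2.2.2.1] else []) ++ [ctFinal κ j]),
      Data.list
      ([(sumPIRF P scaled).input κ j.1 1, Data.vec fun a => Data.num (j.2.2.2.2.1 a),
          Data.num j.2.2.2.2.2.1] ++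
        (if scaled then [Data.num j.2.2.2.2.2.2.1] else []) ++
        [Data.num j.2.2.2.2.2.2.2.1, Data.num j.2.2.2.2.2.2.2.2] ++
        [pk κ j, Data.vec (q κ j)] ++ (if scaled then [eScalar κ j] else []))] : Fin 2 → Data) b
  have hview : ∀ b, PB (view b) := by
    intro b
    have hin0 : PB (I := J) fun κ j => (sumPIRF P scaled).input κ j.1 0 :=
      PB.cons (PB.vec P.k_poly (PB.numFin P.m_poly))
        (PB.listIte (scaled = true) (PB.cons (PB.value P) PB.nil) PB.nil)
    have hin1 : PB (I := J) fun κ j => (sumPIRF P scaled).input κ j.1 1 :=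
      PB.cons hdb (PB.cons (PB.value P) PB.nil)
    have hrq : PB (I := J) fun κ j => Data.vec fun a => Data.num (j.2.2.1 a) :=
      PB.vec (I := J) (f := fun κ j a => Data.num (j.2.2.1 a)) P.k_poly (PB.coins A.query.coins_poly)
    have hra : PB (I := J) fun κ j => Data.vec fun a => Data.num (j.2.2.2.2.1 a) :=
      PB.vec (I := J) (f := fun κ j a => Data.num (j.2.2.2.2.1 a)) P.k_poly
        (PB.coins A.answer.coins_poly)
    have h1 : PB (I := J) fun κ j => Data.num j.2.1 := PB.coins A.keyGen.coins_poly
    have h3 : PB (I := J) fun κ j => Data.num j.2.2.2.1 := PB.coins A.encrypt.coins_poly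
    have h5 : PB (I := J) fun κ j => Data.num j.2.2.2.2.2.1 := PB.coins A.evalSum.coins_poly
    have h6 : PB (I := J) fun κ j => Data.num j.2.2.2.2.2.2.1 := PB.coins A.evalMul.coins_poly
    have h7 : PB (I := J) fun κ j => Data.num j.2.2.2.2.2.2.2.1 := PB.coins A.encrypt.coins_poly
    have h8 : PB (I := J) fun κ j => Data.num j.2.2.2.2.2.2.2.2 := PB.coins A.evalSum.coins_poly
    match b with
    | 0 =>
      exact PB.append (PB.append (PB.cons hin0 (PB.cons h1 (PB.cons hrq PB.nil)))
        (PB.listIte (scaled = true) (PB.cons h3 PB.nil) PB.nil)) (PB.cons hctF PB.nil)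
    | 1 =>
      exact PB.append (PB.append (PB.append (PB.append
        (PB.cons hin1 (PB.cons hra (PB.cons h5 PB.nil)))
        (PB.listIte (scaled = true) (PB.cons h6 PB.nil) PB.nil))
        (PB.cons h7 (PB.cons h8 PB.nil)))
        (PB.cons hpk (PB.cons (PB.vec P.k_poly hq) PB.nil)))
        (PB.listIte (scaled = true) (PB.cons heS PB.nil) PB.nil)
  obtain ⟨Q, hQ⟩ := hview b
  refine ⟨Q, fun κ i v hv => ?_⟩
  simp only [sumPIR, bind_eq_bind, pure_eq_pure, PMF.mem_support_map_iff,
    PMF.mem_support_bind_iff, PMF.mem_support_pure_iff] at hv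
  obtain ⟨o, ⟨r1, -, r2, -, r3, -, r4, -, r5, -, r6, -, r7, -, r8, -, rfl⟩, rfl⟩ := hv
  exact hQ κ (i, r1, r2, r3, r4, r5, r6, r7, r8)

/-! ## The processing of one query -/

/-- What the processing of a query depends on. -/
structure QueryInput (P : Params) (κ : ℕ) where
  BF : Fin (P.m κ) → P.Val κ
  zero_or_one : ∀ l, BF l = 0 ∨ BF l = 1
  GBF : Fin (P.m κ) → P.Val κ
  pos : Fin (P.k κ) → Fin (P.m κ)
  val : P.Val κ

section Query

variable {P : Params} {κ : ℕ}

/-- The query passes the membership test. -/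
def QueryInput.Passes (q : QueryInput P κ) : Prop := ∀ a, q.BF (q.pos a) = 1

open Classical in
def QueryInput.bit (q : QueryInput P κ) : ZMod 2 := if q.Passes then 1 else 0

open Classical in
/-- The value shared by the parties in the end. -/
def QueryInput.result (q : QueryInput P κ) : P.Val κ :=
  if q.Passes then q.val * ∑ a, q.GBF (q.pos a) else 0

def specialPos (P : Params) (κ : ℕ) (μ : P.Val κ) : ℕ :=
  ((P.k κ : P.Val κ) - μ).val % (P.k κ + 1)

def testBits (P : Params) (κ : ℕ) (μ : P.Val κ) (b : ZMod 2) : Fin (P.k κ + 1) → ZMod 2 :=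
  fun a => if (a : ℕ) = specialPos P κ μ then 1 + b else b

def testIdx (P : Params) (κ : ℕ) (x : P.Val κ) : Fin (P.k κ + 1) :=
  ⟨x.val % (P.k κ + 1), Nat.mod_lt _ (Nat.succ_pos _)⟩

def clientMsgs {F : Type} [Ring F] (f : ZMod 2 → F) (b : ZMod 2) (δ Δ : F) : Fin 2 → F :=
  ![Δ + f b * δ, Δ + (1 - f b) * δ]

def serverMsgs {F : Type} [Ring F] (f : ZMod 2 → F) (r : F) (b : ZMod 2) (ρ α : F) : Fin 2 → F :=
  ![r + f b * (ρ - α) - (1 - f b) * α, r + (1 - f b) * (ρ - α) - f b * α]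

/-- The bit that the client obtains from the first transfer. -/
def QueryInput.clientBit (q : QueryInput P κ) (μ : P.Val κ) (b : ZMod 2) : ZMod 2 :=
  testBits P κ μ b (testIdx P κ (∑ a, q.BF (q.pos a) - μ))

def QueryInput.delta (q : QueryInput P κ) (ρ : P.Val κ) : P.Val κ :=
  q.val * ∑ a, q.GBF (q.pos a) - ρ

/-- What the server receives in the second transfer. -/
def QueryInput.serverRecv (q : QueryInput P κ) (b₀ b : ZMod 2) (ρ Δ : P.Val κ) : P.Val κ :=
  clientMsgs bitVal b₀ (q.delta ρ) Δ (choice b)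

/-- What the client receives in the third transfer. -/
def QueryInput.clientRecv (q : QueryInput P κ) (b₀ b : ZMod 2) (ρ Δ α : P.Val κ) : P.Val κ :=
  serverMsgs bitVal (q.serverRecv b₀ b ρ Δ) b ρ α (choice b₀)

/-- The protocol for one query in which every subprotocol is run on the inputs that arise when all
subprotocols give correct outputs. -/
def decoupledQuery (A : PIRScheme) (otBit otVal : Protocol) (q : QueryInput P κ) :
    PMF (QueryOutcome P κ) :=
  (PMF.uniformOfFintype (P.Val κ)).bind fun μ =>
  (sumPIR P A false κ { idx := q.pos, scalar := 0, db := q.BF, mask := μ }).bind fun o1 =>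
  (PMF.uniformOfFintype (ZMod 2)).bind fun b =>
  (otBit.exec P.pub (otBitF P) κ
    (testBits P κ μ b, testIdx P κ (∑ a, q.BF (q.pos a) - μ))).bind fun o2 =>
  (PMF.uniformOfFintype (P.Val κ)).bind fun ρ =>
  (sumPIR P A true κ { idx := q.pos, scalar := q.val, db := q.GBF, mask := ρ }).bind fun o3 =>
  (PMF.uniformOfFintype (P.Val κ)).bind fun Δ =>
  (otVal.exec P.pub (otValF P) κ
    (clientMsgs bitVal (q.clientBit μ b) (q.delta ρ) Δ, choice b)).bind fun o4 =>
  (PMF.uniformOfFintype (P.Val κ)).bind fun α =>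
  (otVal.exec P.pub (otValF P) κ
    (serverMsgs bitVal (q.serverRecv (q.clientBit μ b) b ρ Δ) b ρ α,
      choice (q.clientBit μ b))).bind fun o5 =>
  PMF.pure
    { clientView := Data.list [o1.view 0, o2.view 1, o3.view 0, enc Δ, o4.view 0, o5.view 1]
      serverView := Data.list [enc μ, o1.view 1, enc b, o2.view 0, enc ρ, o3.view 1,
        o4.view 1, enc α, o5.view 0]
      clientShare := q.clientRecv (q.clientBit μ b) b ρ Δ α - Δ
      serverShare := α }

theorem enc_toNat_cast {q : ℕ} [NeZero q] (v : ZMod q) : (((enc v).toNat : ℕ) : ZMod q) = v := by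
  simp [enc]

end Query

theorem pir_correct {P : Params} {A : PIRScheme} {scaled : Bool}
    (h : SecurelyRealizes P.pub (sumPIRF P scaled) (sumPIR P A scaled)) :
    ∃ ε : ℕ → ℝ, Negligible ε ∧ ∀ κ i, probOf (sumPIR P A scaled κ i)
      (fun o => o.out 0 ≠ enc ((if scaled then i.scalar else 1) *
        ∑ a, i.db (i.idx a) - i.mask)) ≤ ENNReal.ofReal (ε κ) :=
  SecurelyRealizes.correct h (y := fun κ (i : SumPIRInput P κ) =>
    ![enc ((if scaled then i.scalar else 1) * ∑ a, i.db (i.idx a) - i.mask), Data.list []])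
    (fun _ _ => rfl) 0 (PB.value P)

theorem ot_correct {pub : ℕ → Data} {N q : ℕ → ℕ} {T : Protocol}
    (hq : ∀ κ, q κ ≠ 0) (hqs : PolyBounded fun κ => Nat.size (q κ))
    (h : SecurelyRealizes pub (otF N q) (T.exec pub (otF N q))) :
    ∃ ε : ℕ → ℝ, Negligible ε ∧ ∀ κ i, probOf (T.exec pub (otF N q) κ i)
      (fun o => o.out 1 ≠ enc (i.1 i.2)) ≤ ENNReal.ofReal (ε κ) := by
  refine SecurelyRealizes.correct h (y := fun κ (i : (Fin (N κ) → ZMod (q κ)) × Fin (N κ)) =>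
    ![Data.list [], enc (i.1 i.2)]) (fun _ _ => rfl) 1 ?_
  refine PB.num hqs fun κ i => natSize_le_of_le ?_
  have : NeZero (q κ) := ⟨hq κ⟩
  exact (ZMod.val_lt _).le

/-- Outputs of subprotocols are replaced, one after the other, by the values of their
functionalities, each at the cost of the probability that the output is wrong. Afterwards no
subprotocol takes its input from the execution of another one, which makes the executions
independent given the random values. -/
theorem processQuery_close {P : Params} {A : PIRScheme} {otBit otVal : Protocol}
    (hPIR : ∀ scaled : Bool, SecurelyRealizes P.pub (sumPIRF P scaled) (sumPIR P A scaled))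
    (hOTBit : SecurelyRealizes P.pub (otBitF P) (otBit.exec P.pub (otBitF P)))
    (hOTVal : SecurelyRealizes P.pub (otValF P) (otVal.exec P.pub (otValF P))) :
    ∃ ε : ℕ → ℝ, Negligible ε ∧ ∀ κ (q : QueryInput P κ), Close (ENNReal.ofReal (ε κ))
      (processQuery P A otBit otVal κ q.BF q.GBF q.pos q.val)
      (decoupledQuery A otBit otVal q) := by
  obtain ⟨ε1, hε1, h1⟩ := pir_correct (hPIR false)
  obtain ⟨ε2, hε2, h2⟩ := ot_correct (by simp) ⟨2, fun _ => by
    rw [Polynomial.eval_ofNat]; exact natSize_le_self 2⟩ hOTBit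
  obtain ⟨ε3, hε3, h3⟩ := pir_correct (hPIR true)
  obtain ⟨ε4, hε4, h4⟩ := ot_correct (fun κ => (P.p_prime κ).ne_zero) P.p_poly hOTVal
  refine ⟨fun κ => |ε1 κ| + (|ε2 κ| + (|ε3 κ| + (|ε4 κ| + |ε4 κ|))),
    hε1.abs.add (hε2.abs.add (hε3.abs.add (hε4.abs.add hε4.abs))), fun κ q => ?_⟩
  -- One summand per subprotocol, nested in the way `Close.bind_off` accumulates them; the transfer
  -- of field elements occurs twice.
  suffices h : Close (ENNReal.ofReal (ε1 κ) + (ENNReal.ofReal (ε2 κ) + (ENNReal.ofReal (ε3 κ) +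
      (ENNReal.ofReal (ε4 κ) + (ENNReal.ofReal (ε4 κ) + 0)))))
      (processQuery P A otBit otVal κ q.BF q.GBF q.pos q.val)
      (decoupledQuery A otBit otVal q) by
    refine h.mono ?_
    rw [add_zero, ENNReal.ofReal_add (by positivity) (by positivity),
      ENNReal.ofReal_add (by positivity) (by positivity),
      ENNReal.ofReal_add (by positivity) (by positivity),
      ENNReal.ofReal_add (by positivity) (by positivity)]
    gcongr <;> exact le_abs_self _
  unfold processQuery decoupledQuery
  simp only [bind_eq_bind, pure_eq_pure]
  refine Close.bind _ fun μ _ => ?_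
  refine Close.bind_off _ _ (h1 κ _) fun o1 ho1 => ?_
  rw [not_not] at ho1
  simp only [ho1, enc_toNat_cast, Bool.false_eq_true, if_false, one_mul]
  refine Close.bind _ fun b _ => ?_
  refine Close.bind_off _ _ (h2 κ _) fun o2 ho2 => ?_
  rw [not_not] at ho2
  simp only [ho2, enc_toNat_cast]
  refine Close.bind _ fun ρ _ => ?_
  refine Close.bind_off _ _ (h3 κ _) fun o3 ho3 => ?_
  rw [not_not] at ho3
  simp only [ho3, enc_toNat_cast, if_true]
  refine Close.bind _ fun Δ _ => ?_
  refine Close.bind_off _ _ (h4 κ _) fun o4 ho4 => ?_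
  rw [not_not] at ho4
  simp only [ho4, enc_toNat_cast]
  refine Close.bind _ fun α _ => ?_
  refine Close.bind_off _ _ (h4 κ _) fun o5 ho5 => ?_
  rw [not_not] at ho5
  simp only [ho5, enc_toNat_cast]
  exact Close.refl _

/-! ## Correctness of the membership test and of the extraction of values -/

section Correctness

variable {P : Params} {κ : ℕ}

open Classical in
-- The entries are `0` or `1`, so the sum counts the hash functions whose position is set.
theorem QueryInput.sum_BF (q : QueryInput P κ) :
    ∑ a, q.BF (q.pos a) = ((Finset.univ.filter fun a => q.BF (q.pos a) = 1).card : P.Val κ) := by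
  rw [Finset.card_filter, Nat.cast_sum]
  refine Finset.sum_congr rfl fun a _ => ?_
  rcases q.zero_or_one (q.pos a) with h | h <;> simp [h]

/-- A number that is at most `k` is divisible by `k + 1` only if it vanishes. This is why the
transfer has `k + 1` positions. -/
theorem mod_eq_iff_of_add {x d k : ℕ} (hd : d ≤ k) : x % (k + 1) = (x + d) % (k + 1) ↔ d = 0 := by
  constructor
  · intro h
    have h1 : k + 1 ∣ x + d - x := (Nat.modEq_iff_dvd' (Nat.le_add_right x d)).1 h
    rw [Nat.add_sub_cancel_left] at h1
    exact Nat.eq_zero_of_dvd_of_lt h1 (by omega)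
  · rintro rfl
    rfl

/-- If `c` positions are set, the client's index comes from `c - μ` and the special one from `k -
μ`. By `hμ`, subtracting `k - c ≤ k` from the latter does not wrap around `p`. The representatives
thus differ by `k - c`, and their residues modulo `k + 1` agree exactly when `c = k`, that is, when
the query passes. -/
theorem QueryInput.clientBit_eq (q : QueryInput P κ) (μ : P.Val κ) (b : ZMod 2)
    (hμ : P.k κ ≤ ((P.k κ : P.Val κ) - μ).val) : q.clientBit μ b = b + q.bit := by
  classical
  set c := (Finset.univ.filter fun a => q.BF (q.pos a) = 1).card with hc
  have hck : c ≤ P.k κ := by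
    simpa using Finset.card_filter_le (Finset.univ : Finset (Fin (P.k κ))) _
  have hpass : q.Passes ↔ P.k κ - c = 0 := by
    have h1 : q.Passes ↔ (Finset.univ.filter fun a => q.BF (q.pos a) = 1) = Finset.univ := by
      rw [Finset.filter_eq_self]
      simp [QueryInput.Passes]
    rw [h1, ← Finset.card_eq_iff_eq_univ, ← hc, Fintype.card_fin]
    omega
  have hval : ((∑ a, q.BF (q.pos a)) - μ).val + (P.k κ - c) = ((P.k κ : P.Val κ) - μ).val := by
    have h1 : ((∑ a, q.BF (q.pos a)) - μ) =
        ((P.k κ : P.Val κ) - μ) - ((P.k κ - c : ℕ) : P.Val κ) := by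
      rw [q.sum_BF, Nat.cast_sub hck]
      ring
    -- Here `k < p` is needed.
    have h2 : ((P.k κ - c : ℕ) : P.Val κ).val = P.k κ - c :=
      ZMod.val_cast_of_lt (lt_of_le_of_lt (Nat.sub_le _ _) (P.k_lt_p κ))
    rw [h1, ZMod.val_sub (by rw [h2]; omega), h2]
    omega
  have hiff : ((testIdx P κ (∑ a, q.BF (q.pos a) - μ) : Fin (P.k κ + 1)) : ℕ) = specialPos P κ μ ↔
      q.Passes := by
    rw [hpass, testIdx, specialPos, ← hval]
    exact mod_eq_iff_of_add (Nat.sub_le _ _)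
  unfold QueryInput.clientBit testBits QueryInput.bit
  simp only [hiff]
  split_ifs
  · rw [add_comm]
  · rw [add_zero]

theorem probOf_uniform_eq {α : Type*} [Fintype α] [Nonempty α] (a : α) :
    probOf (PMF.uniformOfFintype α) (fun x => x = a) = (Fintype.card α : ℝ≥0∞)⁻¹ := by
  classical
  unfold probOf expect
  rw [tsum_eq_single a]
  · simp [PMF.uniformOfFintype_apply]
  · intro b hb
    simp [hb]

/-- The masks that wrap around are `k - j` with `j < k`, each of probability `1 / p`. -/
theorem wrap_prob_le (P : Params) (κ : ℕ) :
    probOf (PMF.uniformOfFintype (P.Val κ))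
      (fun μ => ¬ P.k κ ≤ ((P.k κ : P.Val κ) - μ).val) ≤
      ENNReal.ofReal ((P.k κ : ℝ) * (1 / (P.p κ : ℝ))) := by
  have h1 : probOf (PMF.uniformOfFintype (P.Val κ))
      (fun μ => ¬ P.k κ ≤ ((P.k κ : P.Val κ) - μ).val) ≤
      probOf (PMF.uniformOfFintype (P.Val κ))
        (fun μ => ∃ j : Fin (P.k κ), μ = (P.k κ : P.Val κ) - (j : ℕ)) := by
    refine probOf_mono _ fun μ hμ => ⟨⟨_, not_le.1 hμ⟩, ?_⟩
    rw [ZMod.natCast_zmod_val]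
    ring
  refine h1.trans ((probOf_exists _ _ fun j => (probOf_uniform_eq _).le).trans ?_)
  rw [ZMod.card, Fintype.card_fin, ENNReal.ofReal_mul (by positivity), ENNReal.ofReal_natCast,
    one_div, ENNReal.ofReal_inv_of_pos (by exact_mod_cast (P.p_prime κ).pos),
    ENNReal.ofReal_natCast]

theorem bitVal_zero {q : ℕ} : (bitVal 0 : ZMod q) = 0 := by simp [bitVal]

theorem bitVal_one {q : ℕ} : (bitVal 1 : ZMod q) = 1 := by
  have : (1 : ZMod 2).val = 1 := rfl
  simp [bitVal, this]

theorem choice_zero : choice 0 = 0 := rfl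

theorem choice_one : choice 1 = 1 := rfl

theorem zmod_two_cases (b : ZMod 2) : b = 0 ∨ b = 1 := by
  revert b
  decide

theorem one_add_one_zmod_two : (1 + 1 : ZMod 2) = 0 := by decide

/-- With `e` the membership bit, the server receives `Δ + e δ`, whatever `b` is, and the client
receives this plus `e ρ - α`. As `δ + ρ` is the scaled sum over the garbled filter, the sum is `Δ +
result - α`. The four cases of `b` and `e` are checked. -/
theorem QueryInput.clientRecv_eq (q : QueryInput P κ) (b : ZMod 2) (ρ Δ α : P.Val κ) :
    q.clientRecv (b + q.bit) b ρ Δ α - Δ = q.result - α := by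
  unfold QueryInput.clientRecv QueryInput.serverRecv QueryInput.delta QueryInput.bit
    QueryInput.result
  rcases zmod_two_cases b with rfl | rfl <;> by_cases h : q.Passes <;>
    simp [h, one_add_one_zmod_two, serverMsgs, clientMsgs, bitVal_zero, bitVal_one, choice_zero,
      choice_one] <;> ring

/-- `Δ` is a summand of both offered messages, so it is a one-time pad for the one that the server
receives. -/
theorem QueryInput.serverRecv_eq (q : QueryInput P κ) (b₀ b : ZMod 2) (ρ Δ : P.Val κ) :
    q.serverRecv b₀ b ρ Δ = Δ + q.serverRecv b₀ b ρ 0 := by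
  unfold QueryInput.serverRecv
  rcases zmod_two_cases b with rfl | rfl <;>
    simp [clientMsgs, choice_zero, choice_one]

end Correctness

/-! ## Reordering of samples -/

/-- A draw that does not depend on the earlier ones may come first. This and its longer versions
move the coins of a query ahead of the subprotocols, and the share ahead of the other coins. -/
theorem bind_comm₂ {α₁ α₂ υ β : Type} (X₁ : PMF α₁) (X₂ : PMF α₂) (U : PMF υ)
    (f : α₁ → α₂ → υ → PMF β) :
    (X₁.bind fun a₁ => X₂.bind fun a₂ => U.bind (f a₁ a₂)) =
      U.bind fun u => X₁.bind fun a₁ => X₂.bind fun a₂ => f a₁ a₂ u := by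
  rw [PMF.bind_comm U X₁]
  congr 1
  funext a₁
  exact PMF.bind_comm _ _ _

theorem bind_comm₃ {α₁ α₂ α₃ υ β : Type} (X₁ : PMF α₁) (X₂ : PMF α₂) (X₃ : PMF α₃) (U : PMF υ)
    (f : α₁ → α₂ → α₃ → υ → PMF β) :
    (X₁.bind fun a₁ => X₂.bind fun a₂ => X₃.bind fun a₃ => U.bind (f a₁ a₂ a₃)) =
      U.bind fun u => X₁.bind fun a₁ => X₂.bind fun a₂ => X₃.bind fun a₃ => f a₁ a₂ a₃ u := by
  rw [PMF.bind_comm U X₁]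
  congr 1
  funext a₁
  exact bind_comm₂ _ _ _ _

theorem bind_comm₄ {α₁ α₂ α₃ α₄ υ β : Type} (X₁ : PMF α₁) (X₂ : PMF α₂) (X₃ : PMF α₃)
    (X₄ : PMF α₄) (U : PMF υ) (f : α₁ → α₂ → α₃ → α₄ → υ → PMF β) :
    (X₁.bind fun a₁ => X₂.bind fun a₂ => X₃.bind fun a₃ => X₄.bind fun a₄ =>
      U.bind (f a₁ a₂ a₃ a₄)) =
      U.bind fun u => X₁.bind fun a₁ => X₂.bind fun a₂ => X₃.bind fun a₃ => X₄.bind fun a₄ =>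
        f a₁ a₂ a₃ a₄ u := by
  rw [PMF.bind_comm U X₁]
  congr 1
  funext a₁
  exact bind_comm₃ _ _ _ _ _

section Views

variable {P : Params} {κ : ℕ}

/-- The values that the parties choose when they process a query: `μ`, the bit of the server,
`ρ`, `Δ` and `α`. -/
structure QueryCoins (P : Params) (κ : ℕ) where
  μ : P.Val κ
  b : ZMod 2
  ρ : P.Val κ
  Δ : P.Val κ
  α : P.Val κ

def queryCoins (P : Params) (κ : ℕ) : PMF (QueryCoins P κ) :=
  (PMF.uniformOfFintype (P.Val κ)).bind fun μ =>
  (PMF.uniformOfFintype (ZMod 2)).bind fun b =>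
  (PMF.uniformOfFintype (P.Val κ)).bind fun ρ =>
  (PMF.uniformOfFintype (P.Val κ)).bind fun Δ =>
  (PMF.uniformOfFintype (P.Val κ)).bind fun α => PMF.pure ⟨μ, b, ρ, Δ, α⟩

variable (A : PIRScheme) (otBit otVal : Protocol) (q : QueryInput P κ) (w : QueryCoins P κ)

def subPIR : PMF Outcome :=
  sumPIR P A false κ { idx := q.pos, scalar := 0, db := q.BF, mask := w.μ }

def subOTBit : PMF Outcome :=
  otBit.exec P.pub (otBitF P) κ
    (testBits P κ w.μ w.b, testIdx P κ (∑ a, q.BF (q.pos a) - w.μ))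

def subScaledPIR : PMF Outcome :=
  sumPIR P A true κ { idx := q.pos, scalar := q.val, db := q.GBF, mask := w.ρ }

def subOTClient : PMF Outcome :=
  otVal.exec P.pub (otValF P) κ
    (clientMsgs bitVal (q.clientBit w.μ w.b) (q.delta w.ρ) w.Δ, choice w.b)

def subOTServer : PMF Outcome :=
  otVal.exec P.pub (otValF P) κ
    (serverMsgs bitVal (q.serverRecv (q.clientBit w.μ w.b) w.b w.ρ w.Δ) w.b w.ρ w.α,
      choice (q.clientBit w.μ w.b))

/-- The shares, when the client holds the bit `b₀`. -/
def shares (b₀ : ZMod 2) (v : Data) : Data :=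
  Data.list [v, enc (q.clientRecv b₀ w.b w.ρ w.Δ w.α - w.Δ), enc w.α]

/-- The inputs of the subprotocols depend on the coins only, so all coins can be drawn first; given
the coins the five executions are independent. -/
theorem decoupledQuery_eq {β : Type} (f : QueryOutcome P κ → β) :
    (decoupledQuery A otBit otVal q).map f = (queryCoins P κ).bind fun w =>
      (subPIR A q w).bind fun o1 => (subOTBit otBit q w).bind fun o2 =>
      (subScaledPIR A q w).bind fun o3 => (subOTClient otVal q w).bind fun o4 =>
      (subOTServer otVal q w).bind fun o5 => PMF.pure (f
    { clientView := Data.list [o1.view 0, o2.view 1, o3.view 0, enc w.Δ, o4.view 0, o5.view 1]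
      serverView := Data.list [enc w.μ, o1.view 1, enc w.b, o2.view 0, enc w.ρ, o3.view 1,
        o4.view 1, enc w.α, o5.view 0]
      clientShare := q.clientRecv (q.clientBit w.μ w.b) w.b w.ρ w.Δ w.α - w.Δ
      serverShare := w.α }) := by
  simp only [decoupledQuery, queryCoins, PMF.map_bind, PMF.bind_bind, PMF.pure_bind, PMF.pure_map,
    subPIR, subOTBit, subScaledPIR, subOTClient, subOTServer]
  congr 1
  funext μ
  rw [PMF.bind_comm]
  congr 1
  funext b
  rw [bind_comm₂]
  congr 1
  funext ρ
  rw [bind_comm₃]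
  congr 1
  funext Δ
  rw [bind_comm₄]

end Views

/-! ## Simulation of the processing of one query -/

theorem PB.bit {I : ℕ → Type} {v : (κ : ℕ) → I κ → ZMod 2} : PB fun κ i => enc (v κ i) :=
  PB.num (c := fun _ => 2) ⟨2, by simp⟩ fun _ _ =>
    (natSize_le_self _).trans (ZMod.val_lt _).le

theorem PB.vecTwo {I : ℕ → Type} (P : Params) {v : (κ : ℕ) → I κ → Fin 2 → P.Val κ} :
    PB fun κ i => Data.vec fun j => enc (v κ i j) :=
  PB.vec (n := fun _ => 2) ⟨2, by simp⟩ (PB.value P)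

theorem PB.vecVal {I : ℕ → Type} (P : Params) {v : (κ : ℕ) → I κ → Fin (P.m κ) → P.Val κ} :
    PB fun κ i => Data.vec fun j => enc (v κ i j) :=
  PB.vec P.m_poly (PB.value P)

theorem PB.vecPos {I : ℕ → Type} (P : Params) {v : (κ : ℕ) → I κ → Fin (P.k κ) → Fin (P.m κ)} :
    PB fun κ i => Data.vec fun a => Data.num (v κ i a) :=
  PB.vec (f := fun κ i a => Data.num (v κ i a)) P.k_poly (PB.numFin P.m_poly)

theorem PB.vecBits {I : ℕ → Type} (P : Params)
    {v : (κ : ℕ) → I κ → Fin (P.k κ + 1) → ZMod 2} :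
    PB fun κ i => Data.vec fun a => enc (v κ i a) := by
  obtain ⟨Q, hQ⟩ := P.k_poly
  refine PB.vec (n := fun κ => P.k κ + 1) ⟨Q + 1, fun κ => ?_⟩ PB.bit
  rw [Polynomial.eval_add, Polynomial.eval_one]
  exact Nat.succ_le_succ (hQ κ)

theorem PolySized.list3 {I : ℕ → Type} {X : (κ : ℕ) → I κ → PMF Data} (hX : PolySized X)
    {a b : (κ : ℕ) → I κ → Data} (ha : PB a) (hb : PB b) :
    PolySized fun κ i => (X κ i).map fun v => Data.list [v, a κ i, b κ i] := by
  obtain ⟨Q, hQ⟩ := hX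
  obtain ⟨R, hR⟩ := PB.cons ha (PB.cons hb PB.nil)
  refine ⟨Q + R + 1, fun κ i v hv => ?_⟩
  rw [PMF.mem_support_map_iff] at hv
  obtain ⟨u, hu, rfl⟩ := hv
  have h1 := hQ κ i u hu
  have h2 : (Data.list [a κ i, b κ i]).size ≤ _ := hR κ i
  rw [Data.list, Data.size]
  simp only [Polynomial.eval_add, Polynomial.eval_one]
  omega

section Sim

variable {P : Params} {κ : ℕ}

/-- Simulated views of the client in the subprotocols. -/
def clientViews (S : Fin 5 → Code) (pos : Fin (P.k κ) → Fin (P.m κ)) (s μ' : P.Val κ)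
    (b₀ : ZMod 2) (δ Δ r' : P.Val κ) : PMF Data :=
  pairPMF ((S 0).eval (Data.list [P.pub κ, Data.list [Data.vec fun a => Data.num (pos a)],
    enc μ'])) <|
  pairPMF ((S 1).eval (Data.list [P.pub κ, Data.num (testIdx P κ μ'), enc b₀])) <|
  pairPMF ((S 2).eval (Data.list [P.pub κ,
    Data.list [Data.vec fun a => Data.num (pos a), enc s], enc δ])) <|
  pairPMF (PMF.pure (enc Δ)) <|
  pairPMF ((S 3).eval (Data.list [P.pub κ, Data.vec fun j => enc (clientMsgs bitVal b₀ δ Δ j),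
    Data.list []])) <|
  pairPMF ((S 4).eval (Data.list [P.pub κ, Data.num (choice b₀), enc r']))
    (PMF.pure (Data.list []))

/-- Simulated view of the client in a query, from its share. -/
def clientSim (S : Fin 5 → Code) (pos : Fin (P.k κ) → Fin (P.m κ)) (s share : P.Val κ) :
    PMF Data :=
  (PMF.uniformOfFintype (P.Val κ)).bind fun μ' =>
  (PMF.uniformOfFintype (ZMod 2)).bind fun b₀ =>
  (PMF.uniformOfFintype (P.Val κ)).bind fun δ =>
  (PMF.uniformOfFintype (P.Val κ)).bind fun Δ =>
  clientViews S pos s μ' b₀ δ Δ (share + Δ)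

/-- Simulated views of the server in the subprotocols. -/
def serverViews (S : Fin 5 → Code) (BF GBF : Fin (P.m κ) → P.Val κ) (μ : P.Val κ)
    (b : ZMod 2) (ρ r α : P.Val κ) : PMF Data :=
  pairPMF (PMF.pure (enc μ)) <|
  pairPMF ((S 0).eval (Data.list [P.pub κ, Data.list [Data.vec fun a => enc (BF a), enc μ],
    Data.list []])) <|
  pairPMF (PMF.pure (enc b)) <|
  pairPMF ((S 1).eval (Data.list [P.pub κ, Data.vec fun a => enc (testBits P κ μ b a),
    Data.list []])) <|
  pairPMF (PMF.pure (enc ρ)) <|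
  pairPMF ((S 2).eval (Data.list [P.pub κ, Data.list [Data.vec fun a => enc (GBF a), enc ρ],
    Data.list []])) <|
  pairPMF ((S 3).eval (Data.list [P.pub κ, Data.num (choice b), enc r])) <|
  pairPMF (PMF.pure (enc α)) <|
  pairPMF ((S 4).eval (Data.list [P.pub κ, Data.vec fun j => enc (serverMsgs bitVal r b ρ α j),
    Data.list []]))
    (PMF.pure (Data.list []))

/-- Simulated view of the server in a query, from its share. -/
def serverSim (S : Fin 5 → Code) (BF GBF : Fin (P.m κ) → P.Val κ) (share : P.Val κ) :
    PMF Data :=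
  (PMF.uniformOfFintype (P.Val κ)).bind fun μ =>
  (PMF.uniformOfFintype (ZMod 2)).bind fun b =>
  (PMF.uniformOfFintype (P.Val κ)).bind fun ρ =>
  (PMF.uniformOfFintype (P.Val κ)).bind fun r =>
  serverViews S BF GBF μ b ρ r share

end Sim

theorem clientViews_polySized {P : Params} {S : Fin 5 → Code} (hS : ∀ j, (S j).PolyTime)
    {I : ℕ → Type} {pos : ∀ κ, I κ → Fin (P.k κ) → Fin (P.m κ)}
    {s μ' : ∀ κ, I κ → P.Val κ} {b₀ : ∀ κ, I κ → ZMod 2} {δ Δ r' : ∀ κ, I κ → P.Val κ} :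
    PolySized fun κ i => clientViews S (pos κ i) (s κ i) (μ' κ i) (b₀ κ i) (δ κ i) (Δ κ i)
      (r' κ i) := by
  unfold clientViews
  refine PolySized.pairPMF (PolySized.eval (hS 0) ?_) <|
    PolySized.pairPMF (PolySized.eval (hS 1) ?_) <|
    PolySized.pairPMF (PolySized.eval (hS 2) ?_) <|
    PolySized.pairPMF (PB.polySized ?_) <|
    PolySized.pairPMF (PolySized.eval (hS 3) ?_) <|
    PolySized.pairPMF (PolySized.eval (hS 4) ?_) (PB.polySized ?_)
  · exact PB.cons (PB.pub P) (PB.cons (PB.cons (PB.vecPos P) PB.nil)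
      (PB.cons (PB.value P) PB.nil))
  · exact PB.cons (PB.pub P) (PB.cons
      (PB.num P.k_poly fun _ _ => (natSize_le_self _).trans (Nat.lt_succ_iff.1 (Fin.is_lt _)))
      (PB.cons PB.bit PB.nil))
  · exact PB.cons (PB.pub P) (PB.cons (PB.cons (PB.vecPos P)
      (PB.cons (PB.value P) PB.nil)) (PB.cons (PB.value P) PB.nil))
  · exact PB.value P
  · exact PB.cons (PB.pub P) (PB.cons (PB.vecTwo P) (PB.cons PB.nil PB.nil))
  · exact PB.cons (PB.pub P) (PB.cons
      (PB.numFin (n := fun _ => 2) ⟨2, by simp⟩) (PB.cons (PB.value P) PB.nil))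
  · exact PB.nil

theorem serverViews_polySized {P : Params} {S : Fin 5 → Code} (hS : ∀ j, (S j).PolyTime)
    {I : ℕ → Type} {BF GBF : ∀ κ, I κ → Fin (P.m κ) → P.Val κ}
    {μ : ∀ κ, I κ → P.Val κ} {b : ∀ κ, I κ → ZMod 2} {ρ r α : ∀ κ, I κ → P.Val κ} :
    PolySized fun κ i => serverViews S (BF κ i) (GBF κ i) (μ κ i) (b κ i) (ρ κ i) (r κ i)
      (α κ i) := by
  unfold serverViews
  refine PolySized.pairPMF (PB.polySized ?_) <|
    PolySized.pairPMF (PolySized.eval (hS 0) ?_) <|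
    PolySized.pairPMF (PB.polySized ?_) <|
    PolySized.pairPMF (PolySized.eval (hS 1) ?_) <|
    PolySized.pairPMF (PB.polySized ?_) <|
    PolySized.pairPMF (PolySized.eval (hS 2) ?_) <|
    PolySized.pairPMF (PolySized.eval (hS 3) ?_) <|
    PolySized.pairPMF (PB.polySized ?_) <|
    PolySized.pairPMF (PolySized.eval (hS 4) ?_) (PB.polySized ?_)
  · exact PB.value P
  · exact PB.cons (PB.pub P) (PB.cons (PB.cons (PB.vecVal P)
      (PB.cons (PB.value P) PB.nil)) (PB.cons PB.nil PB.nil))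
  · exact PB.bit
  · exact PB.cons (PB.pub P) (PB.cons (PB.vecBits P) (PB.cons PB.nil PB.nil))
  · exact PB.value P
  · exact PB.cons (PB.pub P) (PB.cons (PB.cons (PB.vecVal P)
      (PB.cons (PB.value P) PB.nil)) (PB.cons PB.nil PB.nil))
  · exact PB.cons (PB.pub P) (PB.cons
      (PB.numFin (n := fun _ => 2) ⟨2, by simp⟩) (PB.cons (PB.value P) PB.nil))
  · exact PB.value P
  · exact PB.cons (PB.pub P) (PB.cons (PB.vecTwo P) (PB.cons PB.nil PB.nil))
  · exact PB.nil

section Indist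

variable {P : Params} {A : PIRScheme} {otBit otVal : Protocol}

theorem subPIR_polySized (b : Fin 2) :
    PolySized (I := fun κ => QueryInput P κ × QueryCoins P κ) fun κ x =>
      (subPIR A x.1 x.2).map fun o => o.view b :=
  (sumPIR_polySized P A false b).reindex fun κ (x : QueryInput P κ × QueryCoins P κ) =>
    { idx := x.1.pos, scalar := 0, db := x.1.BF, mask := x.2.μ }

theorem subScaledPIR_polySized (b : Fin 2) :
    PolySized (I := fun κ => QueryInput P κ × QueryCoins P κ) fun κ x =>
      (subScaledPIR A x.1 x.2).map fun o => o.view b :=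
  (sumPIR_polySized P A true b).reindex fun κ (x : QueryInput P κ × QueryCoins P κ) =>
    { idx := x.1.pos, scalar := x.1.val, db := x.1.GBF, mask := x.2.ρ }

theorem subOTBit_polySized (h : otBit.Efficient P.pub (otBitF P)) (b : Fin 2) :
    PolySized (I := fun κ => QueryInput P κ × QueryCoins P κ) fun κ x =>
      (subOTBit otBit x.1 x.2).map fun o => o.view b :=
  (h.polySized b).reindex fun κ (x : QueryInput P κ × QueryCoins P κ) =>
    (testBits P κ x.2.μ x.2.b, testIdx P κ (∑ a, x.1.BF (x.1.pos a) - x.2.μ))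

theorem subOTClient_polySized (h : otVal.Efficient P.pub (otValF P)) (b : Fin 2) :
    PolySized (I := fun κ => QueryInput P κ × QueryCoins P κ) fun κ x =>
      (subOTClient otVal x.1 x.2).map fun o => o.view b :=
  (h.polySized b).reindex fun κ (x : QueryInput P κ × QueryCoins P κ) =>
    (clientMsgs bitVal (x.1.clientBit x.2.μ x.2.b) (x.1.delta x.2.ρ) x.2.Δ, choice x.2.b)

theorem subOTServer_polySized (h : otVal.Efficient P.pub (otValF P)) (b : Fin 2) :
    PolySized (I := fun κ => QueryInput P κ × QueryCoins P κ) fun κ x =>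
      (subOTServer otVal x.1 x.2).map fun o => o.view b :=
  (h.polySized b).reindex fun κ (x : QueryInput P κ × QueryCoins P κ) =>
    (serverMsgs bitVal (x.1.serverRecv (x.1.clientBit x.2.μ x.2.b) x.2.b x.2.ρ x.2.Δ) x.2.b
      x.2.ρ x.2.α, choice (x.1.clientBit x.2.μ x.2.b))

theorem subPIR_view (h : SecurelyRealizes P.pub (sumPIRF P false) (sumPIR P A false))
    (b : Fin 2) : ∃ S : Code, S.PolyTime ∧
      CompIndist (I := fun κ => QueryInput P κ × QueryCoins P κ)
        (fun κ x => (subPIR A x.1 x.2).map fun o => o.view b) fun κ x =>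
        S.eval (Data.list [P.pub κ,
          (![Data.list [Data.vec fun a => Data.num (x.1.pos a)],
            Data.list [Data.vec fun a => enc (x.1.BF a), enc x.2.μ]] : Fin 2 → Data) b,
          (![enc (∑ a, x.1.BF (x.1.pos a) - x.2.μ), Data.list []] : Fin 2 → Data) b]) := by
  obtain ⟨S, hS, hi⟩ := SecurelyRealizes.view h (fun κ i => rfl) b
  refine ⟨S, hS, (hi.reindex fun κ (x : QueryInput P κ × QueryCoins P κ) =>
    { idx := x.1.pos, scalar := 0, db := x.1.BF, mask := x.2.μ }).congr (fun _ _ => rfl)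
    fun κ x => ?_⟩
  simp [sumPIRF]

theorem subScaledPIR_view (h : SecurelyRealizes P.pub (sumPIRF P true) (sumPIR P A true))
    (b : Fin 2) : ∃ S : Code, S.PolyTime ∧
      CompIndist (I := fun κ => QueryInput P κ × QueryCoins P κ)
        (fun κ x => (subScaledPIR A x.1 x.2).map fun o => o.view b) fun κ x =>
        S.eval (Data.list [P.pub κ,
          (![Data.list [Data.vec fun a => Data.num (x.1.pos a), enc x.1.val],
            Data.list [Data.vec fun a => enc (x.1.GBF a), enc x.2.ρ]] : Fin 2 → Data) b,
          (![enc (x.1.delta x.2.ρ), Data.list []] : Fin 2 → Data) b]) := by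
  obtain ⟨S, hS, hi⟩ := SecurelyRealizes.view h (fun κ i => rfl) b
  refine ⟨S, hS, (hi.reindex fun κ (x : QueryInput P κ × QueryCoins P κ) =>
    { idx := x.1.pos, scalar := x.1.val, db := x.1.GBF, mask := x.2.ρ }).congr (fun _ _ => rfl)
    fun κ x => ?_⟩
  simp [sumPIRF, QueryInput.delta]

theorem ot_view {N q : ℕ → ℕ} {T : Protocol}
    (h : SecurelyRealizes P.pub (otF N q) (T.exec P.pub (otF N q))) (b : Fin 2)
    {I : ℕ → Type} (i : (κ : ℕ) → I κ → (Fin (N κ) → ZMod (q κ)) × Fin (N κ)) :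
    ∃ S : Code, S.PolyTime ∧
      CompIndist (fun κ x => (T.exec P.pub (otF N q) κ (i κ x)).map fun o => o.view b) fun κ x =>
        S.eval (Data.list [P.pub κ,
          (![Data.vec fun j => enc ((i κ x).1 j), Data.num (i κ x).2] : Fin 2 → Data) b,
          (![Data.list [], enc ((i κ x).1 (i κ x).2)] : Fin 2 → Data) b]) := by
  obtain ⟨S, hS, hi⟩ := SecurelyRealizes.view h (fun κ i => rfl) b
  exact ⟨S, hS, hi.reindex i⟩

/-- Replacement of the views in the subprotocols by simulated ones. -/
theorem views_context {X Y : (κ : ℕ) → QueryInput P κ × QueryCoins P κ → PMF Data}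
    (h : CompIndist X Y) :
    CompIndist (I := QueryInput P)
      (fun κ q => (queryCoins P κ).bind fun w =>
        (X κ (q, w)).map (shares q w (q.clientBit w.μ w.b)))
      fun κ q => (queryCoins P κ).bind fun w =>
        (Y κ (q, w)).map (shares q w (q.clientBit w.μ w.b)) := by
  refine (CompIndist.context h (J := QueryInput P) (τ := fun κ _ => QueryCoins P κ)
    (fun κ _ => queryCoins P κ)
    -- The shares alone serve as context: the postprocessing only appends them to the view.
    (fun κ q w => Data.list [enc (q.clientRecv (q.clientBit w.μ w.b) w.b w.ρ w.Δ w.α - w.Δ),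
      enc w.α]) (fun κ q w => (q, w))
    (fun κ q w x => PMF.pure (shares q w (q.clientBit w.μ w.b) x)) ?_ ?_).congr
    (fun _ _ => rfl) fun _ _ => rfl
  · exact Det.id.pair_snd.pair Det.id.pair_fst
  · obtain ⟨Q, hQ⟩ := PB.cons (PB.value P (I := fun κ => QueryInput P κ × QueryCoins P κ)
      (v := fun κ x => x.1.clientRecv (x.1.clientBit x.2.μ x.2.b) x.2.b x.2.ρ x.2.Δ x.2.α - x.2.Δ))
      (PB.cons (PB.value P (v := fun κ x => x.2.α)) PB.nil)
    exact ⟨Q, fun κ q w _ => hQ κ (q, w)⟩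

/-- The bit that the client obtains is the right one except when a subtraction wraps around. -/
theorem close_bit {P : Params} {κ : ℕ} (q : QueryInput P κ)
    (G : QueryCoins P κ → ZMod 2 → PMF Data) :
    Close (ENNReal.ofReal ((P.k κ : ℝ) * (1 / (P.p κ : ℝ))))
      ((queryCoins P κ).bind fun w => G w (q.clientBit w.μ w.b))
      ((queryCoins P κ).bind fun w => G w (w.b + q.bit)) := by
  simp only [queryCoins, PMF.bind_bind, PMF.pure_bind]
  refine (Close.bind_off (ε := 0) _ _ (wrap_prob_le P κ) fun μ hμ => ?_).mono (by simp)
  simp only [q.clientBit_eq μ _ (not_not.1 hμ)]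
  exact Close.refl _

/-- Indistinguishable ensembles of samples of polynomial size. -/
structure SizedIndist {I : ℕ → Type} (X Y : (κ : ℕ) → I κ → PMF Data) : Prop where
  ind : CompIndist X Y
  left : PolySized X
  right : PolySized Y

theorem SizedIndist.pairPMF {I : ℕ → Type} {A A' B B' : (κ : ℕ) → I κ → PMF Data}
    (hA : SizedIndist A A') (hB : SizedIndist B B') :
    SizedIndist (fun κ i => pairPMF (A κ i) (B κ i)) fun κ i => pairPMF (A' κ i) (B' κ i) :=
  ⟨hA.ind.pairPMF hB.ind hA.left hB.right, hA.left.pairPMF hB.left, hA.right.pairPMF hB.right⟩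

theorem SizedIndist.const {I : ℕ → Type} {f : (κ : ℕ) → I κ → Data} (hf : PB f) :
    SizedIndist (fun κ i => PMF.pure (f κ i)) fun κ i => PMF.pure (f κ i) :=
  ⟨CompIndist.refl _, hf.polySized, hf.polySized⟩

theorem bind_congr_right {α β : Type} (X : PMF α) {f g : α → PMF β} (h : ∀ a, f a = g a) :
    X.bind f = X.bind g := by
  rw [funext h]

theorem shares_eq {κ : ℕ} (q : QueryInput P κ) (w : QueryCoins P κ) :
    shares q w (w.b + q.bit) = fun v => Data.list [v, enc (q.result - w.α), enc w.α] := by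
  funext v
  rw [shares, q.clientRecv_eq]

/-- The passages from `μ` to `μ'`, from `b` to `b₀` and from `ρ` to `δ` are bijections, so the
values on the client's side are uniform and independent of `Δ` and `α`. The value received last is
forced to be the share plus `Δ`. Beyond the client's own data the view therefore depends on the
share only. -/
theorem client_reparam (S : Fin 5 → Code) {κ : ℕ} (q : QueryInput P κ) :
    ((queryCoins P κ).bind fun w => (clientViews S q.pos q.val
      (∑ a, q.BF (q.pos a) - w.μ) (w.b + q.bit) (q.delta w.ρ) w.Δ
      (q.clientRecv (w.b + q.bit) w.b w.ρ w.Δ w.α)).map (shares q w (w.b + q.bit))) =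
    (PMF.uniformOfFintype (P.Val κ)).bind fun α =>
      (clientSim S q.pos q.val (q.result - α)).map fun v =>
        Data.list [v, enc (q.result - α), enc α] := by
  simp only [queryCoins, PMF.bind_bind, PMF.pure_bind, clientSim, PMF.map_bind]
  refine Eq.trans ?_ (bind_comm₄ _ _ _ _ _ _)
  refine Eq.trans ?_ (uniform_bind_equiv (Equiv.subLeft (∑ a, q.BF (q.pos a))) _)
  refine bind_congr_right _ fun μ => ?_
  refine Eq.trans ?_ (uniform_bind_equiv (Equiv.addRight q.bit) _)
  refine bind_congr_right _ fun b => ?_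
  refine Eq.trans ?_ (uniform_bind_equiv (Equiv.subLeft (q.val * ∑ a, q.GBF (q.pos a))) _)
  refine bind_congr_right _ fun ρ => ?_
  refine bind_congr_right _ fun Δ => ?_
  refine bind_congr_right _ fun α => ?_
  simp only [Equiv.subLeft_apply, Equiv.coe_addRight, QueryInput.delta,
    ← sub_eq_iff_eq_add.1 (q.clientRecv_eq b ρ Δ α)]
  exact congrArg (fun f => PMF.map f _) (shares_eq q ⟨μ, b, ρ, Δ, α⟩)

/-- For fixed `μ`, `b`, `ρ` the received value is `Δ` plus a term without `Δ`, hence uniform. All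
other random values in the view are the server's own choices, among them its share `α`. -/
theorem server_reparam (S : Fin 5 → Code) {κ : ℕ} (q : QueryInput P κ) :
    ((queryCoins P κ).bind fun w => (serverViews S q.BF q.GBF w.μ w.b w.ρ
      (q.serverRecv (w.b + q.bit) w.b w.ρ w.Δ) w.α).map (shares q w (w.b + q.bit))) =
    (PMF.uniformOfFintype (P.Val κ)).bind fun α =>
      (serverSim S q.BF q.GBF α).map fun v =>
        Data.list [v, enc (q.result - α), enc α] := by
  simp only [queryCoins, PMF.bind_bind, PMF.pure_bind, serverSim, PMF.map_bind]
  refine Eq.trans ?_ (bind_comm₄ _ _ _ _ _ _)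
  refine bind_congr_right _ fun μ => ?_
  refine bind_congr_right _ fun b => ?_
  refine bind_congr_right _ fun ρ => ?_
  refine Eq.trans ?_ (uniform_bind_equiv (Equiv.addRight (q.serverRecv (b + q.bit) b ρ 0)) _)
  refine bind_congr_right _ fun Δ => ?_
  refine bind_congr_right _ fun α => ?_
  simp only [Equiv.coe_addRight, q.serverRecv_eq (b + q.bit) b ρ Δ]
  exact congrArg (fun f => PMF.map f _) (shares_eq q ⟨μ, b, ρ, Δ, α⟩)

/-- Three replacements: ideal inputs for the subprotocols (statistical), simulated views for the
real ones (computational), and the true membership bit for the one computed modulo `k + 1`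
(statistical, at most `k / p`). The change of variables then gives `clientSim`. -/
theorem client_query_indist
    (hp : Negligible fun κ => 1 / (P.p κ : ℝ))
    (hPIR : ∀ scaled : Bool, SecurelyRealizes P.pub (sumPIRF P scaled) (sumPIR P A scaled))
    (hOTBitEff : otBit.Efficient P.pub (otBitF P))
    (hOTBit : SecurelyRealizes P.pub (otBitF P) (otBit.exec P.pub (otBitF P)))
    (hOTValEff : otVal.Efficient P.pub (otValF P))
    (hOTVal : SecurelyRealizes P.pub (otValF P) (otVal.exec P.pub (otValF P))) :
    ∃ S : Fin 5 → Code, (∀ j, (S j).PolyTime) ∧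
      CompIndist (I := QueryInput P)
        (fun κ q => (processQuery P A otBit otVal κ q.BF q.GBF q.pos q.val).map fun o =>
          Data.list [o.clientView, enc o.clientShare, enc o.serverShare])
        fun κ q => (PMF.uniformOfFintype (P.Val κ)).bind fun α =>
          (clientSim S q.pos q.val (q.result - α)).map fun v =>
            Data.list [v, enc (q.result - α), enc α] := by
  obtain ⟨ε, hε, hclose⟩ := processQuery_close hPIR hOTBit hOTVal
  obtain ⟨S0, hS0, h0⟩ := subPIR_view (hPIR false) 0
  obtain ⟨S1, hS1, h1⟩ := ot_view hOTBit 1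
    fun κ (x : QueryInput P κ × QueryCoins P κ) =>
    (testBits P κ x.2.μ x.2.b, testIdx P κ (∑ a, x.1.BF (x.1.pos a) - x.2.μ))
  obtain ⟨S2, hS2, h2⟩ := subScaledPIR_view (hPIR true) 0
  obtain ⟨S3, hS3, h3⟩ := ot_view hOTVal 0 fun κ (x : QueryInput P κ × QueryCoins P κ) =>
    (clientMsgs bitVal (x.1.clientBit x.2.μ x.2.b) (x.1.delta x.2.ρ) x.2.Δ, choice x.2.b)
  obtain ⟨S4, hS4, h4⟩ := ot_view hOTVal 1 fun κ (x : QueryInput P κ × QueryCoins P κ) =>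
    (serverMsgs bitVal (x.1.serverRecv (x.1.clientBit x.2.μ x.2.b) x.2.b x.2.ρ x.2.Δ) x.2.b
      x.2.ρ x.2.α, choice (x.1.clientBit x.2.μ x.2.b))
  have hS : ∀ j, ((![S0, S1, S2, S3, S4] : Fin 5 → Code) j).PolyTime := by
    intro j
    fin_cases j <;> assumption
  refine ⟨![S0, S1, S2, S3, S4], hS, ?_⟩
  have hdecouple := CompIndist.of_close (I := QueryInput P) hε fun κ q => (hclose κ q).map fun o =>
    Data.list [o.clientView, enc o.clientShare, enc o.serverShare]
  -- The nesting follows that of `clientViews`, so that the simulated side agrees with it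
  -- definitionally.
  have hviews := (SizedIndist.mk h0 (subPIR_polySized 0) (PolySized.eval hS0
      (PB.cons (PB.pub P) (PB.cons (PB.cons (PB.vecPos P) PB.nil)
        (PB.cons (PB.value P) PB.nil))))).pairPMF <|
    (SizedIndist.mk h1 (subOTBit_polySized hOTBitEff 1) (PolySized.eval hS1
      (PB.cons (PB.pub P) (PB.cons (PB.num P.k_poly fun _ _ =>
        (natSize_le_self _).trans (Nat.lt_succ_iff.1 (Fin.is_lt _)))
        (PB.cons PB.bit PB.nil))))).pairPMF <|
    (SizedIndist.mk h2 (subScaledPIR_polySized 0) (PolySized.eval hS2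
      (PB.cons (PB.pub P) (PB.cons (PB.cons (PB.vecPos P)
        (PB.cons (PB.value P) PB.nil)) (PB.cons (PB.value P) PB.nil))))).pairPMF <|
    (SizedIndist.const (PB.value P (v := fun κ (x : QueryInput P κ × QueryCoins P κ) =>
      x.2.Δ))).pairPMF <|
    (SizedIndist.mk h3 (subOTClient_polySized hOTValEff 0) (PolySized.eval hS3
      (PB.cons (PB.pub P) (PB.cons (PB.vecTwo P) (PB.cons PB.nil PB.nil))))).pairPMF <|
    (SizedIndist.mk h4 (subOTServer_polySized hOTValEff 1) (PolySized.eval hS4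
      (PB.cons (PB.pub P) (PB.cons (PB.numFin (n := fun _ => 2) ⟨2, by simp⟩)
        (PB.cons (PB.value P) PB.nil))))).pairPMF
    (SizedIndist.const PB.nil)
  have hsimulate := views_context hviews.ind
  have hbit := CompIndist.of_close (I := QueryInput P) (hp.polyBounded_mul P.k_poly)
    fun κ q => close_bit q fun w b₀ => (clientViews ![S0, S1, S2, S3, S4] q.pos q.val
      (∑ a, q.BF (q.pos a) - w.μ) b₀ (q.delta w.ρ) w.Δ
      (q.clientRecv b₀ w.b w.ρ w.Δ w.α)).map (shares q w b₀)
  refine (hdecouple.trans (hsimulate.congr (fun κ q => ?_) fun κ q => rfl)).trans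
    (hbit.congr (fun κ q => rfl) fun κ q => client_reparam _ q)
  rw [decoupledQuery_eq]
  simp only [pairPMF, PMF.bind_map, PMF.map_bind, PMF.pure_map, PMF.pure_bind, PMF.bind_bind,
    Function.comp_def, shares]
  rfl

/-- The same three replacements as for the client. The server's own choices `μ`, `b`, `ρ`, `α` stand
as constants between the views that are replaced. -/
theorem server_query_indist
    (hp : Negligible fun κ => 1 / (P.p κ : ℝ))
    (hPIR : ∀ scaled : Bool, SecurelyRealizes P.pub (sumPIRF P scaled) (sumPIR P A scaled))
    (hOTBitEff : otBit.Efficient P.pub (otBitF P))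
    (hOTBit : SecurelyRealizes P.pub (otBitF P) (otBit.exec P.pub (otBitF P)))
    (hOTValEff : otVal.Efficient P.pub (otValF P))
    (hOTVal : SecurelyRealizes P.pub (otValF P) (otVal.exec P.pub (otValF P))) :
    ∃ S : Fin 5 → Code, (∀ j, (S j).PolyTime) ∧
      CompIndist (I := QueryInput P)
        (fun κ q => (processQuery P A otBit otVal κ q.BF q.GBF q.pos q.val).map fun o =>
          Data.list [o.serverView, enc o.clientShare, enc o.serverShare])
        fun κ q => (PMF.uniformOfFintype (P.Val κ)).bind fun α =>
          (serverSim S q.BF q.GBF α).map fun v =>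
            Data.list [v, enc (q.result - α), enc α] := by
  obtain ⟨ε, hε, hclose⟩ := processQuery_close hPIR hOTBit hOTVal
  obtain ⟨S0, hS0, h0⟩ := subPIR_view (hPIR false) 1
  obtain ⟨S1, hS1, h1⟩ := ot_view hOTBit 0
    fun κ (x : QueryInput P κ × QueryCoins P κ) =>
    (testBits P κ x.2.μ x.2.b, testIdx P κ (∑ a, x.1.BF (x.1.pos a) - x.2.μ))
  obtain ⟨S2, hS2, h2⟩ := subScaledPIR_view (hPIR true) 1
  obtain ⟨S3, hS3, h3⟩ := ot_view hOTVal 1 fun κ (x : QueryInput P κ × QueryCoins P κ) =>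
    (clientMsgs bitVal (x.1.clientBit x.2.μ x.2.b) (x.1.delta x.2.ρ) x.2.Δ, choice x.2.b)
  obtain ⟨S4, hS4, h4⟩ := ot_view hOTVal 0 fun κ (x : QueryInput P κ × QueryCoins P κ) =>
    (serverMsgs bitVal (x.1.serverRecv (x.1.clientBit x.2.μ x.2.b) x.2.b x.2.ρ x.2.Δ) x.2.b
      x.2.ρ x.2.α, choice (x.1.clientBit x.2.μ x.2.b))
  have hS : ∀ j, ((![S0, S1, S2, S3, S4] : Fin 5 → Code) j).PolyTime := by
    intro j
    fin_cases j <;> assumption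
  refine ⟨![S0, S1, S2, S3, S4], hS, ?_⟩
  have hdecouple := CompIndist.of_close (I := QueryInput P) hε fun κ q => (hclose κ q).map fun o =>
    Data.list [o.serverView, enc o.clientShare, enc o.serverShare]
  have hviews := (SizedIndist.const (PB.value P (v := fun κ (x : QueryInput P κ × QueryCoins P κ) =>
      x.2.μ))).pairPMF <|
    (SizedIndist.mk h0 (subPIR_polySized 1) (PolySized.eval hS0
      (PB.cons (PB.pub P) (PB.cons (PB.cons (PB.vecVal P) (PB.cons (PB.value P) PB.nil))
        (PB.cons PB.nil PB.nil))))).pairPMF <|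
    (SizedIndist.const (PB.bit (v := fun κ (x : QueryInput P κ × QueryCoins P κ) =>
      x.2.b))).pairPMF <|
    (SizedIndist.mk h1 (subOTBit_polySized hOTBitEff 0) (PolySized.eval hS1
      (PB.cons (PB.pub P) (PB.cons (PB.vecBits P) (PB.cons PB.nil PB.nil))))).pairPMF <|
    (SizedIndist.const (PB.value P (v := fun κ (x : QueryInput P κ × QueryCoins P κ) =>
      x.2.ρ))).pairPMF <|
    (SizedIndist.mk h2 (subScaledPIR_polySized 1) (PolySized.eval hS2
      (PB.cons (PB.pub P) (PB.cons (PB.cons (PB.vecVal P) (PB.cons (PB.value P) PB.nil))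
        (PB.cons PB.nil PB.nil))))).pairPMF <|
    (SizedIndist.mk h3 (subOTClient_polySized hOTValEff 1) (PolySized.eval hS3
      (PB.cons (PB.pub P) (PB.cons (PB.numFin (n := fun _ => 2) ⟨2, by simp⟩)
        (PB.cons (PB.value P) PB.nil))))).pairPMF <|
    (SizedIndist.const (PB.value P (v := fun κ (x : QueryInput P κ × QueryCoins P κ) =>
      x.2.α))).pairPMF <|
    (SizedIndist.mk h4 (subOTServer_polySized hOTValEff 0) (PolySized.eval hS4
      (PB.cons (PB.pub P) (PB.cons (PB.vecTwo P) (PB.cons PB.nil PB.nil))))).pairPMF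
    (SizedIndist.const PB.nil)
  have hsimulate := views_context hviews.ind
  have hbit := CompIndist.of_close (I := QueryInput P) (hp.polyBounded_mul P.k_poly)
    fun κ q => close_bit q fun w b₀ => (serverViews ![S0, S1, S2, S3, S4] q.BF q.GBF w.μ w.b w.ρ
      (q.serverRecv b₀ w.b w.ρ w.Δ) w.α).map (shares q w b₀)
  refine (hdecouple.trans (hsimulate.congr (fun κ q => ?_) fun κ q => rfl)).trans
    (hbit.congr (fun κ q => rfl) fun κ q => server_reparam _ q)
  rw [decoupledQuery_eq]
  simp only [pairPMF, PMF.bind_map, PMF.map_bind, PMF.pure_map, PMF.pure_bind, PMF.bind_bind,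
    Function.comp_def, shares]
  rfl

end Indist

/-! ## Sizes of the data of one query -/

section Sizes

variable {P : Params} {A : PIRScheme} {otBit otVal : Protocol}

/-- In the hybrid argument over the queries, real queries are part of the context, so their samples
must have polynomial size. -/
theorem processQuery_polySized (hOTBitEff : otBit.Efficient P.pub (otBitF P))
    (hOTValEff : otVal.Efficient P.pub (otValF P)) (b : Fin 2) :
    PolySized (I := QueryInput P) fun κ q =>
      (processQuery P A otBit otVal κ q.BF q.GBF q.pos q.val).map fun o =>
        Data.list [(![o.clientView, o.serverView] : Fin 2 → Data) b, enc o.clientShare,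
          enc o.serverShare] := by
  have hpir := fun scaled b => sumPIR_polySized P A scaled b
  have hbit := fun b => hOTBitEff.polySized b
  have hval := fun b => hOTValEff.polySized b
  choose Q1 hQ1 using hpir
  choose Q2 hQ2 using hbit
  choose Q3 hQ3 using hval
  obtain ⟨Qv, hQv⟩ := PB.value P (I := fun κ => P.Val κ) (v := fun _ v => v)
  have h1 : ∀ {κ scaled b i o}, o ∈ (sumPIR P A scaled κ i).support →
      (o.view b).size ≤ (Q1 scaled b).eval κ := fun ho =>
    hQ1 _ _ _ _ _ ((PMF.mem_support_map_iff _ _ _).2 ⟨_, ho, rfl⟩)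
  have h2 : ∀ {κ b i o}, o ∈ (otBit.exec P.pub (otBitF P) κ i).support →
      (o.view b).size ≤ (Q2 b).eval κ := fun ho =>
    hQ2 _ _ _ _ ((PMF.mem_support_map_iff _ _ _).2 ⟨_, ho, rfl⟩)
  have h3 : ∀ {κ b i o}, o ∈ (otVal.exec P.pub (otValF P) κ i).support →
      (o.view b).size ≤ (Q3 b).eval κ := fun ho =>
    hQ3 _ _ _ _ ((PMF.mem_support_map_iff _ _ _).2 ⟨_, ho, rfl⟩)
  have hb : ∀ x : ZMod 2, (enc x).size ≤ 3 := by
    intro x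
    rcases zmod_two_cases x with rfl | rfl
    · exact (by norm_num [enc, Data.size] : (enc (0 : ZMod 2)).size ≤ 3)
    · have h : (enc (1 : ZMod 2)) = Data.num 1 := rfl
      rw [h]
      norm_num [Data.size]
  refine ⟨Q1 false 0 + Q1 false 1 + Q1 true 0 + Q1 true 1 + Q2 0 + Q2 1 + 2 * Q3 0 + 2 * Q3 1 +
    5 * Qv + 30, fun κ q v hv => ?_⟩
  simp only [processQuery, bind_eq_bind, pure_eq_pure, PMF.mem_support_map_iff,
    PMF.mem_support_bind_iff, PMF.mem_support_pure_iff] at hv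
  obtain ⟨o, ⟨μ, -, o1, ho1, b', -, o2, ho2, ρ, -, o3, ho3, Δ, -, o4, ho4, α, -, o5, ho5, rfl⟩,
    rfl⟩ := hv
  have e1 := h1 (b := 0) ho1
  have e2 := h1 (b := 1) ho1
  have e3 := h2 (b := 0) ho2
  have e4 := h2 (b := 1) ho2
  have e5 := h1 (b := 0) ho3
  have e6 := h1 (b := 1) ho3
  have e7 := h3 (b := 0) ho4
  have e8 := h3 (b := 1) ho4
  have e9 := h3 (b := 0) ho5
  have e10 := h3 (b := 1) ho5
  have f1 : (enc μ).size ≤ Qv.eval κ := hQv κ μ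
  have f2 : (enc ρ).size ≤ Qv.eval κ := hQv κ ρ
  have f3 : (enc Δ).size ≤ Qv.eval κ := hQv κ Δ
  have f4 : (enc α).size ≤ Qv.eval κ := hQv κ α
  have f5 : (enc (((o5.out 1).toNat : P.Val κ) - Δ)).size ≤ Qv.eval κ := hQv κ _
  have f6 := hb b'
  simp only [Polynomial.eval_add, Polynomial.eval_mul, Polynomial.eval_ofNat]
  match b with
  | 0 =>
    simp only [Matrix.cons_val_zero, Data.list, Data.size, Nat.size_zero]
    omega
  | 1 =>
    simp only [Matrix.cons_val_one, Matrix.cons_val_fin_one, Data.list, Data.size, Nat.size_zero]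
    omega

theorem clientSim_polySized {S : Fin 5 → Code} (hS : ∀ j, (S j).PolyTime) :
    PolySized (I := QueryInput P) fun κ q =>
      (PMF.uniformOfFintype (P.Val κ)).bind fun α =>
        (clientSim S q.pos q.val (q.result - α)).map fun v =>
          Data.list [v, enc (q.result - α), enc α] := by
  refine PolySized.bind (τ := fun κ _ => P.Val κ) _ (PolySized.list3 ?_ (PB.value P) (PB.value P))
  obtain ⟨Q, hQ⟩ := clientViews_polySized hS (P := P) (I := fun κ => QueryInput P κ × P.Val κ ×
    ZMod 2 × P.Val κ × P.Val κ × P.Val κ) (pos := fun κ x => x.1.pos) (s := fun κ x => x.1.val)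
    (μ' := fun κ x => x.2.1) (b₀ := fun κ x => x.2.2.1) (δ := fun κ x => x.2.2.2.1)
    (Δ := fun κ x => x.2.2.2.2.1) (r' := fun κ x => x.2.2.2.2.2)
  refine ⟨Q, fun κ x v hv => ?_⟩
  simp only [clientSim, PMF.mem_support_bind_iff] at hv
  obtain ⟨μ', -, b₀, -, δ, -, Δ, -, hv⟩ := hv
  exact hQ κ (x.1, μ', b₀, δ, Δ, x.1.result - x.2 + Δ) v hv

theorem serverSim_polySized {S : Fin 5 → Code} (hS : ∀ j, (S j).PolyTime) :
    PolySized (I := QueryInput P) fun κ q =>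
      (PMF.uniformOfFintype (P.Val κ)).bind fun α =>
        (serverSim S q.BF q.GBF α).map fun v =>
          Data.list [v, enc (q.result - α), enc α] := by
  refine PolySized.bind (τ := fun κ _ => P.Val κ) _ (PolySized.list3 ?_ (PB.value P) (PB.value P))
  obtain ⟨Q, hQ⟩ := serverViews_polySized hS (P := P) (I := fun κ => QueryInput P κ × P.Val κ ×
    ZMod 2 × P.Val κ × P.Val κ × P.Val κ) (BF := fun κ x => x.1.BF) (GBF := fun κ x => x.1.GBF)
    (μ := fun κ x => x.2.1) (b := fun κ x => x.2.2.1) (ρ := fun κ x => x.2.2.2.1)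
    (r := fun κ x => x.2.2.2.2.1) (α := fun κ x => x.2.2.2.2.2)
  refine ⟨Q, fun κ x v hv => ?_⟩
  simp only [serverSim, PMF.mem_support_bind_iff] at hv
  obtain ⟨μ, -, b, -, ρ, -, r, -, hv⟩ := hv
  exact hQ κ (x.1, μ, b, ρ, r, x.2) v hv

end Sizes

/-! ## Bloom filters and garbled Bloom filters -/

section Filters

variable {P : Params} {κ : ℕ}

/-- Insertion that leaves the filter unchanged if no position is free. -/
def gbfInsertTotal (R : Fin (P.m κ) → P.Val κ) (pos : Fin (P.k κ) → Fin (P.m κ)) (g : P.Val κ)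
    (A : Fin (P.m κ) → Option (P.Val κ)) : Fin (P.m κ) → Option (P.Val κ) :=
  (gbfInsert P R pos g A).getD A

theorem exists_gbfInsert_eq_some {R : Fin (P.m κ) → P.Val κ} {pos : Fin (P.k κ) → Fin (P.m κ)} {g : P.Val κ}
    {A : Fin (P.m κ) → Option (P.Val κ)} (h : ∃ a, A (pos a) = none) :
    ∃ A', gbfInsert P R pos g A = some A' := by
  obtain ⟨a, ha⟩ := h
  unfold gbfInsert
  cases hf : (List.finRange (P.k κ)).find? (fun a => (A (pos a)).isNone) with
  | none =>
    rw [List.find?_eq_none] at hf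
    have := hf a (List.mem_finRange a)
    simp [ha] at this
  | some a0 => exact ⟨_, rfl⟩

/-- The solved position has a multiplicity between `1` and `k < p`, which is invertible in the
field, so solving for it makes the sum right. Entries that are set are never changed; this protects
the sums of earlier keys. -/
theorem gbfInsert_spec {R : Fin (P.m κ) → P.Val κ} {pos : Fin (P.k κ) → Fin (P.m κ)}
    {g : P.Val κ} {A A' : Fin (P.m κ) → Option (P.Val κ)} (h : gbfInsert P R pos g A = some A') :
    (∀ l v, A l = some v → A' l = some v) ∧
    (∀ l, (A' l).isSome → (A l).isSome ∨ ∃ a, pos a = l) ∧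
    (∀ a, (A' (pos a)).isSome) ∧
    ∑ a, (A' (pos a)).getD (R (pos a)) = g := by
  classical
  unfold gbfInsert at h
  cases hf : (List.finRange (P.k κ)).find? (fun a => (A (pos a)).isNone) with
  | none => simp [hf] at h
  | some a0 =>
    have ha0 : A (pos a0) = none := by
      have := List.find?_some hf
      simpa using this
    simp only [hf, Option.some.injEq] at h
    subst h
    refine ⟨fun l v hl => ?_, fun l hl => ?_, fun a => ?_, ?_⟩
    · have h1 : l ≠ pos a0 := by
        rintro rfl
        rw [ha0] at hl
        cases hl
      beta_reduce
      rw [if_neg h1]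
      split_ifs
      · rw [hl, Option.getD_some]
      · exact hl
    · by_cases h1 : l = pos a0
      · exact Or.inr ⟨a0, h1.symm⟩
      · by_cases h2 : ∃ a, pos a = l
        · exact Or.inr h2
        · beta_reduce at hl
          rw [if_neg h1, if_neg h2] at hl
          exact Or.inl hl
    · by_cases h1 : pos a = pos a0
      · simp [h1]
      · beta_reduce
        rw [if_neg h1, if_pos ⟨a, rfl⟩]
        rfl
    -- The solved position contributes its multiplicity times the solved value, that is `g - rest`,
    -- and the other positions contribute `rest`.
    · rw [← Finset.sum_filter_add_sum_filter_not Finset.univ fun a => pos a = pos a0]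
      have hmult : ((Finset.univ.filter fun a => pos a = pos a0).card : P.Val κ) ≠ 0 := by
        rw [Ne, ZMod.natCast_eq_zero_iff]
        refine Nat.not_dvd_of_pos_of_lt (Finset.card_pos.2 ⟨a0, by simp⟩) ?_
        refine lt_of_le_of_lt (Finset.card_filter_le _ _) ?_
        simpa using P.k_lt_p κ
      set rest : P.Val κ := ∑ a with pos a ≠ pos a0, (A (pos a)).getD (R (pos a)) with hrest
      have h1 : ∀ a ∈ Finset.univ.filter (fun a => pos a = pos a0),
          ((if pos a = pos a0 then
              some ((g - rest) / ((Finset.univ.filter fun a => pos a = pos a0).card : P.Val κ))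
            else if ∃ b, pos b = pos a then some ((A (pos a)).getD (R (pos a)))
            else A (pos a)).getD (R (pos a))) =
          (g - rest) / ((Finset.univ.filter fun a => pos a = pos a0).card : P.Val κ) := by
        intro a ha
        rw [if_pos (Finset.mem_filter.1 ha).2, Option.getD_some]
      have h2 : ∀ a ∈ Finset.univ.filter (fun a => ¬ pos a = pos a0),
          ((if pos a = pos a0 then
              some ((g - rest) / ((Finset.univ.filter fun a => pos a = pos a0).card : P.Val κ))
            else if ∃ b, pos b = pos a then some ((A (pos a)).getD (R (pos a)))
            else A (pos a)).getD (R (pos a))) = (A (pos a)).getD (R (pos a)) := by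
        intro a ha
        rw [if_neg (Finset.mem_filter.1 ha).2, if_pos ⟨a, rfl⟩, Option.getD_some]
      rw [Finset.sum_congr rfl h1, Finset.sum_congr rfl h2, Finset.sum_const, nsmul_eq_mul,
        mul_div_cancel₀ _ hmult, hrest]
      exact sub_add_cancel _ _

theorem foldlM_finRange {σ : Type} {n : ℕ} (f : σ → Fin n → Option σ) (st : ℕ → σ)
    (h : ∀ j : Fin n, f (st j) j = some (st (j + 1))) :
    (List.finRange n).foldlM f (st 0) = some (st n) := by
  induction n generalizing st with
  | zero => simp
  | succ n ih =>
    have h0 : f (st 0) 0 = some (st 1) := h 0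
    rw [List.finRange_succ, List.foldlM_cons, h0]
    have := ih (fun s j => f s j.succ) (fun j => st (j + 1)) fun j => by
      have := h j.succ
      rwa [Fin.val_succ] at this
    simpa [List.foldlM_map] using this

variable (P) (H : HashFamily)

/-- The garbled Bloom filter after the insertion of the first `i` pairs. -/
def gbfState (seed : P.Seed κ) (y : ServerInput P κ) (R : Fin (P.m κ) → P.Val κ) :
    ℕ → Fin (P.m κ) → Option (P.Val κ)
  | 0 => fun _ => none
  | i + 1 => if h : i < P.n κ then
      gbfInsertTotal R (fun a => hash P H seed a (y.key ⟨i, h⟩)) (y.val ⟨i, h⟩)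
        (gbfState seed y R i) else gbfState seed y R i

/-- The garbled Bloom filter, where insertions that fail are skipped. -/
def gbfTotal (seed : P.Seed κ) (y : ServerInput P κ) (R : Fin (P.m κ) → P.Val κ) :
    Fin (P.m κ) → P.Val κ :=
  fun l => (gbfState P H seed y R (P.n κ) l).getD (R l)

/-- The key passes the membership test for the set `Q` of keys. -/
def FalsePositive (seed : P.Seed κ) (Q : Finset (P.Key κ)) (x : P.Key κ) : Prop :=
  ∀ a, ∃ y ∈ Q, ∃ c, hash P H seed c y = hash P H seed a x

/-- Keys inserted before number `j`. -/
def keysBefore (y : ServerInput P κ) (j : ℕ) : Finset (P.Key κ) :=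
  (Finset.univ.filter fun l : Fin (P.n κ) => (l : ℕ) < j).image y.key

/-- Seeds for which an insertion fails or a query is a false positive. -/
def BadSeed (x : ClientInput P κ) (y : ServerInput P κ) (seed : P.Seed κ) : Prop :=
  (∃ j : Fin (P.n κ), FalsePositive P H seed (keysBefore P y j) (y.key j)) ∨
    ∃ j : Fin (P.t κ), x.key j ∉ keysBefore P y (P.n κ) ∧
      FalsePositive P H seed (keysBefore P y (P.n κ)) (x.key j)

variable {P} {H}

theorem mem_keysBefore {y : ServerInput P κ} {j : ℕ} {x : P.Key κ} :
    x ∈ keysBefore P y j ↔ ∃ l : Fin (P.n κ), (l : ℕ) < j ∧ y.key l = x := by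
  simp [keysBefore]

/-- Union bound over `n` insertions and `t` queries. A key that is being inserted does not lie among
the keys before it, since keys are distinct, so Bloom soundness applies to it in the same way as to
a query outside the server's set. -/
theorem badSeed_prob (hB : BloomSound P H) :
    ∃ ε : ℕ → ℝ, Negligible ε ∧ ∀ κ (x : ClientInput P κ) (y : ServerInput P κ),
      probOf (PMF.uniformOfFintype (P.Seed κ)) (BadSeed P H x y) ≤ ENNReal.ofReal (ε κ) := by
  obtain ⟨ε, hε, hle⟩ := hB
  refine ⟨fun κ => (P.n κ : ℝ) * |ε κ| + (P.t κ : ℝ) * |ε κ|,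
    (hε.abs.polyBounded_mul P.n_poly).add (hε.abs.polyBounded_mul P.t_poly), fun κ x y => ?_⟩
  have h1 : ∀ (Q : Finset (P.Key κ)) (z : P.Key κ), Q.card ≤ P.n κ → z ∉ Q →
      probOf (PMF.uniformOfFintype (P.Seed κ)) (fun seed => FalsePositive P H seed Q z) ≤
        ENNReal.ofReal |ε κ| := by
    intro Q z hQ hz
    have h2 := (hle κ Q z hQ hz).trans (le_abs_self _)
    have h3 := probOf_toOuterMeasure (PMF.uniformOfFintype (P.Seed κ))
      fun seed => FalsePositive P H seed Q z
    rw [← ENNReal.ofReal_toReal (ne_top_of_le_ne_top ENNReal.one_ne_top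
      (probOf_le_one (PMF.uniformOfFintype (P.Seed κ)) fun seed => FalsePositive P H seed Q z)), h3]
    exact ENNReal.ofReal_le_ofReal h2
  have hcard : ∀ j, (keysBefore P y j).card ≤ P.n κ := fun j =>
    Finset.card_image_le.trans ((Finset.card_filter_le _ _).trans (by simp))
  refine (probOf_or _ _ _).trans ?_
  rw [ENNReal.ofReal_add (by positivity) (by positivity), ENNReal.ofReal_mul (by positivity),
    ENNReal.ofReal_mul (by positivity), ENNReal.ofReal_natCast, ENNReal.ofReal_natCast]
  refine add_le_add ?_ ?_
  · refine (probOf_exists _ _ fun j => h1 _ _ (hcard _) ?_).trans (by simp)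
    rw [mem_keysBefore]
    rintro ⟨l, hl, he⟩
    rw [y.key_inj he] at hl
    exact lt_irrefl _ hl
  · refine (probOf_exists _ _ (c := ENNReal.ofReal |ε κ|) fun j => ?_).trans (by simp)
    -- For a query that is a server key the event is empty.
    by_cases hx : x.key j ∈ keysBefore P y (P.n κ)
    · have : probOf (PMF.uniformOfFintype (P.Seed κ)) (fun seed =>
          x.key j ∉ keysBefore P y (P.n κ) ∧
            FalsePositive P H seed (keysBefore P y (P.n κ)) (x.key j)) = 0 := by
        simp [probOf, expect, hx]
      rw [this]
      exact zero_le
    · exact (probOf_mono _ fun _ h => h.2).trans (h1 _ _ (hcard _) hx)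

/-! ### The filters for a seed that is not bad -/

section Good

variable {x : ClientInput P κ} {y : ServerInput P κ} {seed : P.Seed κ}
  {R : Fin (P.m κ) → P.Val κ}

/-- Entries get set only at hash positions of the inserted key. This links occupied positions of the
garbled filter with the membership test. -/
theorem gbfState_isSome (i : ℕ) : ∀ l, (gbfState P H seed y R i l).isSome →
    ∃ j : Fin (P.n κ), (j : ℕ) < i ∧ ∃ a, hash P H seed a (y.key j) = l := by
  induction i with
  | zero => simp [gbfState]
  | succ i ih =>
    intro l hl
    by_cases h : i < P.n κ
    · simp only [gbfState, dif_pos h, gbfInsertTotal] at hl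
      cases hg : gbfInsert P R (fun a => hash P H seed a (y.key ⟨i, h⟩)) (y.val ⟨i, h⟩)
          (gbfState P H seed y R i) with
      | none =>
        rw [hg, Option.getD_none] at hl
        obtain ⟨j, hj, ha⟩ := ih l hl
        exact ⟨j, by omega, ha⟩
      | some A' =>
        rw [hg, Option.getD_some] at hl
        rcases (gbfInsert_spec hg).2.1 l hl with h1 | h1
        · obtain ⟨j, hj, ha⟩ := ih l h1
          exact ⟨j, by omega, ha⟩
        · exact ⟨⟨i, h⟩, by simp, h1⟩
    · simp only [gbfState, dif_neg h] at hl
      obtain ⟨j, hj, ha⟩ := ih l hl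
      exact ⟨j, by omega, ha⟩

/-- If no position were free, each of them would be a hash position of an earlier key, which makes
the key a false positive. -/
theorem gbfInsert_state (hg : ¬ BadSeed P H x y seed) (j : Fin (P.n κ)) :
    gbfInsert P R (fun a => hash P H seed a (y.key j)) (y.val j) (gbfState P H seed y R j) =
      some (gbfState P H seed y R (j + 1)) := by
  obtain ⟨A', hA'⟩ := exists_gbfInsert_eq_some (R := R) (g := y.val j)
    (pos := fun a => hash P H seed a (y.key j)) (A := gbfState P H seed y R j) (by
      by_contra hne
      push Not at hne
      refine hg (Or.inl ⟨j, fun a => ?_⟩)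
      obtain ⟨l, hl, c, hc⟩ := gbfState_isSome (j : ℕ) _ (Option.isSome_iff_ne_none.2 (hne a))
      exact ⟨y.key l, mem_keysBefore.2 ⟨l, hl, rfl⟩, c, hc⟩)
  rw [hA', gbfState, dif_pos j.2, gbfInsertTotal, hA', Option.getD_some]

theorem gbf_eq (hg : ¬ BadSeed P H x y seed) :
    gbf P H seed y R = some (gbfTotal P H seed y R) := by
  unfold gbf
  have := foldlM_finRange (fun A j => gbfInsert P R (fun a => hash P H seed a (y.key j))
    (y.val j) A) (gbfState P H seed y R) fun j => gbfInsert_state hg j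
  simp only [gbfState] at this
  rw [this]
  rfl

theorem gbfState_mono (hg : ¬ BadSeed P H x y seed) {i j : ℕ} (hij : i ≤ j) (hj : j ≤ P.n κ) :
    ∀ l v, gbfState P H seed y R i l = some v → gbfState P H seed y R j l = some v := by
  induction j, hij using Nat.le_induction with
  | base => exact fun _ _ h => h
  | succ j _ ih =>
    intro l v hv
    exact (gbfInsert_spec (gbfInsert_state hg ⟨j, hj⟩)).1 l v (ih (by omega) l v hv)

/-- The sum is right immediately after insertion `j`, and later insertions keep all entries that are
set. -/
theorem gbfTotal_sum (hg : ¬ BadSeed P H x y seed) (j : Fin (P.n κ)) :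
    ∑ a, gbfTotal P H seed y R (hash P H seed a (y.key j)) = y.val j := by
  obtain ⟨-, -, h1, h2⟩ := gbfInsert_spec (gbfInsert_state (R := R) hg j)
  refine Eq.trans (Finset.sum_congr rfl fun a _ => ?_) h2
  obtain ⟨v, hv⟩ := Option.isSome_iff_exists.1 (h1 a)
  rw [gbfTotal, gbfState_mono hg j.2 le_rfl _ v hv, hv]

/-- The input of the processing of query number `j`. -/
def queryInput (P : Params) (H : HashFamily) {κ : ℕ} (x : ClientInput P κ) (y : ServerInput P κ)
    (seed : P.Seed κ) (R : Fin (P.m κ) → P.Val κ) (j : Fin (P.t κ)) : QueryInput P κ where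
  BF := bloom P H seed y
  zero_or_one l := by
    unfold bloom
    split_ifs <;> simp
  GBF := gbfTotal P H seed y R
  pos a := hash P H seed a (x.key j)
  val := x.val j

/-- The value to be shared for query number `j`. -/
def trueResult (x : ClientInput P κ) (y : ServerInput P κ) (j : Fin (P.t κ)) : P.Val κ :=
  ∑ l, if x.key j = y.key l then x.val j * y.val l else 0

/-- A query that is a server key passes the test, and its positions sum to the stored value. Any
other query that passed would be a false positive. -/
theorem queryInput_result (hg : ¬ BadSeed P H x y seed) (j : Fin (P.t κ)) :
    (queryInput P H x y seed R j).result = trueResult x y j := by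
  classical
  unfold QueryInput.result trueResult
  by_cases hx : ∃ l, x.key j = y.key l
  · obtain ⟨l, hl⟩ := hx
    rw [if_pos, Finset.sum_eq_single l]
    · rw [if_pos hl]
      simp only [queryInput, hl, gbfTotal_sum hg]
    · intro l' _ hne
      rw [if_neg]
      intro h
      exact hne (y.key_inj (h.symm.trans hl))
    · simp
    · intro a
      simp only [queryInput, bloom]
      rw [if_pos ⟨l, a, by rw [hl]⟩]
  · rw [if_neg, Finset.sum_eq_zero]
    · intro l _
      rw [if_neg fun h => hx ⟨l, h⟩]
    · intro hpass
      refine hg (Or.inr ⟨j, ?_, fun a => ?_⟩)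
      · rw [mem_keysBefore]
        rintro ⟨l, -, hl⟩
        exact hx ⟨l, hl.symm⟩
      · have := hpass a
        simp only [queryInput, bloom] at this
        by_cases h : ∃ l c, hash P H seed c (y.key l) = hash P H seed a (x.key j)
        · obtain ⟨l, c, hc⟩ := h
          exact ⟨y.key l, mem_keysBefore.2 ⟨l, l.2, rfl⟩, c, hc⟩
        · rw [if_neg h] at this
          exact absurd this zero_ne_one

end Good

end Filters

/-! ## Sampling, modular arithmetic and searches in polynomial time -/

section Sampling

variable {ι : Type} {inp : ι → Data}

/-- Not strict, because for `n = 0` the sample is `0`. -/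
theorem mem_uniformBelow_support {n a : ℕ} (h : a ∈ (uniformBelow n).support) : a ≤ n := by
  unfold uniformBelow at h
  split_ifs at h with hn
  · rw [PMF.mem_support_uniformOfFinset_iff, Finset.mem_range] at h
    exact h.le
  · rw [PMF.mem_support_pure_iff] at h
    omega

theorem Computes.uniformBelow {n : ι → ℕ} (hn : Det inp fun i => Data.num (n i)) :
    Computes inp fun i => (SSIP.uniformBelow (n i)).map Data.num := by
  refine Computes.app (F := fun d => (SSIP.uniformBelow d.toNat).map Data.num)
    ⟨Code.rand, ⟨2 * Polynomial.X + 1, fun d o ho => ?_⟩, Code.eval_rand⟩ hn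
  simp only [Code.run, PMF.mem_support_bind_iff, PMF.mem_support_pure_iff] at ho
  obtain ⟨a, ha, rfl⟩ := ho
  have h1 := natSize_le_of_le (mem_uniformBelow_support ha)
  have h2 := Data.size_num_toNat_le d
  simp only [Code.charge, Data.size, Polynomial.eval_add, Polynomial.eval_mul, Polynomial.eval_X,
    Polynomial.eval_one, Polynomial.eval_ofNat]
  omega

/-- By counting, the injection is onto the range. The instruction `rand` can therefore sample field
elements and seeds exactly. -/
theorem uniform_map_eq_uniformBelow {α : Type} [Fintype α] [Nonempty α] {f : α → ℕ}
    (hf : Function.Injective f) (hlt : ∀ a, f a < Fintype.card α) :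
    (PMF.uniformOfFintype α).map f = SSIP.uniformBelow (Fintype.card α) := by
  classical
  have himg : Finset.univ.image f = Finset.range (Fintype.card α) :=
    Finset.eq_of_subset_of_card_le (fun b hb => by
      obtain ⟨a, -, rfl⟩ := Finset.mem_image.1 hb
      exact Finset.mem_range.2 (hlt a)) (by
      rw [Finset.card_image_of_injective _ hf, Finset.card_range, Finset.card_univ])
  have hne : (Finset.range (Fintype.card α)).Nonempty :=
    Finset.nonempty_range_iff.2 Fintype.card_ne_zero
  rw [SSIP.uniformBelow, dif_pos hne]
  ext b
  rw [PMF.map_apply, PMF.uniformOfFinset_apply, Finset.card_range]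
  simp only [PMF.uniformOfFintype_apply]
  split_ifs with hb
  · rw [← himg] at hb
    obtain ⟨a, -, rfl⟩ := Finset.mem_image.1 hb
    rw [tsum_eq_single a]
    · simp
    · intro a' ha'
      rw [if_neg fun h => ha' (hf h.symm)]
  · refine ENNReal.tsum_eq_zero.2 fun a => if_neg ?_
    rintro rfl
    exact hb (Finset.mem_range.2 (hlt a))

theorem Computes.uniformZMod {q : ι → ℕ} [∀ i, NeZero (q i)]
    (hq : Det inp fun i => Data.num (q i)) :
    Computes inp fun i => (PMF.uniformOfFintype (ZMod (q i))).map enc := by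
  refine (Computes.uniformBelow hq).congr fun i => ?_
  have h := uniform_map_eq_uniformBelow (α := ZMod (q i)) (ZMod.val_injective (q i))
    fun a => by rw [ZMod.card]; exact ZMod.val_lt a
  rw [ZMod.card] at h
  rw [← h, PMF.map_comp]
  rfl

/-- The exponent is available in unary, so the result has size polynomial in the input and repeated
doubling is efficient. -/
theorem Det.twoPow {L : ι → ℕ} (hL : Det inp fun i => Data.unary (L i)) :
    Det inp fun i => Data.num (2 ^ L i) := by
  obtain ⟨Q, hQ⟩ := hL.size_bound
  refine Det.iterate hL (s := fun _ j => Data.num (2 ^ j)) ?_ ?_ (Q + 1) fun i j hj => ?_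
  · exact Det.num 1
  · have hs : Det (fun x : Σ i, Fin (L i) => Data.pair (inp x.1)
        (Data.pair (Data.num x.2) (Data.num (2 ^ (x.2 : ℕ))))) fun x => Data.num (2 ^ (x.2 : ℕ)) :=
      Det.id.pair_snd.pair_snd
    exact (hs.mul (Det.num 2)).congr fun x => by rw [pow_succ]
  · have := hQ i
    rw [Data.unary_size] at this
    have h2 : Nat.size (2 ^ j) = j + 1 := Nat.size_pow
    simp only [Data.size, Polynomial.eval_add, Polynomial.eval_one]
    omega

theorem Computes.uniformFin {L : ι → ℕ} (hL : Det inp fun i => Data.unary (L i)) :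
    Computes inp fun i => (PMF.uniformOfFintype (Fin (2 ^ L i))).map fun r : Fin (2 ^ L i) => Data.num r := by
  refine (Computes.uniformBelow hL.twoPow).congr fun i => ?_
  have h := uniform_map_eq_uniformBelow (α := Fin (2 ^ L i)) (f := Fin.val) Fin.val_injective
    fun a => by rw [Fintype.card_fin]; exact a.2
  rw [Fintype.card_fin] at h
  rw [← h, PMF.map_comp]
  rfl

end Sampling

/-! ### Arithmetic of residue classes -/

section Modular

variable {ι : Type} {inp : ι → Data} {q : ι → ℕ}

theorem Det.zcast (hq : Det inp fun i => Data.num (q i)) {n : ι → ℕ}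
    (hn : Det inp fun i => Data.num (n i)) : Det inp fun i => enc ((n i : ℕ) : ZMod (q i)) :=
  (hn.mod hq).congr fun i => by rw [enc, ZMod.val_natCast]

theorem Det.zmul (hq : Det inp fun i => Data.num (q i)) {a b : ∀ i, ZMod (q i)}
    (ha : Det inp fun i => enc (a i)) (hb : Det inp fun i => enc (b i)) :
    Det inp fun i => enc (a i * b i) :=
  ((Det.mul (a := fun i => (a i).val) (b := fun i => (b i).val) ha hb).mod hq).congr fun i => by
    rw [enc, ZMod.val_mul]

variable [∀ i, NeZero (q i)]

theorem Det.zadd (hq : Det inp fun i => Data.num (q i)) {a b : ∀ i, ZMod (q i)}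
    (ha : Det inp fun i => enc (a i)) (hb : Det inp fun i => enc (b i)) :
    Det inp fun i => enc (a i + b i) :=
  ((Det.add (a := fun i => (a i).val) (b := fun i => (b i).val) ha hb).mod hq).congr fun i => by
    rw [enc, ZMod.val_add]

theorem Det.zneg (hq : Det inp fun i => Data.num (q i)) {a : ∀ i, ZMod (q i)}
    (ha : Det inp fun i => enc (a i)) : Det inp fun i => enc (-a i) :=
  ((Det.sub (b := fun i => (a i).val) hq ha).mod hq).congr fun i => by
    rw [enc, ZMod.neg_val']

theorem Det.zsub (hq : Det inp fun i => Data.num (q i)) {a b : ∀ i, ZMod (q i)}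
    (ha : Det inp fun i => enc (a i)) (hb : Det inp fun i => enc (b i)) :
    Det inp fun i => enc (a i - b i) :=
  (Det.zadd hq ha (Det.zneg hq hb)).congr fun i => by rw [sub_eq_add_neg]

end Modular

/-! ### Folds, searches, sums and inverses -/

section Loops

variable {ι : Type} {inp : ι → Data} {n : ι → ℕ}

/-- Loops over `Fin n`, for states all of which have polynomial size. -/
theorem Det.foldr (hn : Det inp fun i => Data.unary (n i)) {σ : ι → Type} {e : ∀ i, σ i → Data}
    {g : ∀ i, Fin (n i) → σ i → σ i} {z : ∀ i, σ i} (hz : Det inp fun i => e i (z i))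
    (hg : Det (fun x : Σ i, Fin (n i) × σ i =>
      Data.pair (inp x.1) (Data.pair (Data.num x.2.1) (e x.1 x.2.2)))
      fun x => e x.1 (g x.1 x.2.1 x.2.2))
    (hQ : ∃ Q : Polynomial ℕ, ∀ i s, (e i s).size ≤ Q.eval (inp i).size) :
    Det inp fun i => e i ((List.finRange (n i)).foldr (g i) (z i)) := by
  obtain ⟨Q, hQ⟩ := hQ
  have h : Det inp fun i => e i (((List.finRange (n i)).drop (n i - n i)).foldr (g i) (z i)) := by
    refine Det.iterate hn
      -- A right fold begins with the last index: after `c` rounds the last `c` indices have been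
      -- processed.
      (s := fun i c => e i (((List.finRange (n i)).drop (n i - c)).foldr (g i) (z i)))
      (hz.congr fun i => ?_) ?_ Q fun i c _ => hQ i _
    · rw [Nat.sub_zero, List.drop_of_length_le (by simp)]
      rfl
    · have hx : Det (fun x : Σ i, Fin (n i) => Data.pair (inp x.1) (Data.pair (Data.num x.2)
          (e x.1 (((List.finRange (n x.1)).drop (n x.1 - x.2)).foldr (g x.1) (z x.1)))))
          fun x => inp x.1 := Det.id.pair_fst
      have hc : Det (fun x : Σ i, Fin (n i) => Data.pair (inp x.1) (Data.pair (Data.num x.2)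
          (e x.1 (((List.finRange (n x.1)).drop (n x.1 - x.2)).foldr (g x.1) (z x.1)))))
          fun x => Data.num x.2 := Det.id.pair_snd.pair_fst
      have hs : Det (fun x : Σ i, Fin (n i) => Data.pair (inp x.1) (Data.pair (Data.num x.2)
          (e x.1 (((List.finRange (n x.1)).drop (n x.1 - x.2)).foldr (g x.1) (z x.1)))))
          fun x => e x.1 (((List.finRange (n x.1)).drop (n x.1 - x.2)).foldr (g x.1) (z x.1)) :=
        Det.id.pair_snd.pair_snd
      have hnum : Det inp fun i => Data.num (n i) := Det.ofUnary hn
      have hr := Det.sub (hnum.weaken (g := fun x : Σ i, Fin (n i) => x.1)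
        (e := fun x => (Data.pair (Data.num x.2)
          (e x.1 (((List.finRange (n x.1)).drop (n x.1 - x.2)).foldr (g x.1) (z x.1))))))
        (hc.add (Det.num 1))
      refine ((hg.reindex fun x : Σ i, Fin (n i) => ⟨x.1, ⟨n x.1 - (x.2 + 1), by omega⟩,
        ((List.finRange (n x.1)).drop (n x.1 - x.2)).foldr (g x.1) (z x.1)⟩).precomp
        (hx.pair (hr.pair hs))).congr fun x => ?_
      have hlt : n x.1 - (x.2 + 1) < (List.finRange (n x.1)).length := by
        rw [List.length_finRange]
        omega
      beta_reduce
      rw [List.drop_eq_getElem_cons hlt, List.foldr_cons, List.getElem_finRange]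
      have h2 : n x.1 - (x.2 + 1) + 1 = n x.1 - x.2 := by omega
      rw [h2]
      rfl
  simpa using h

/-- Optional values, as data. -/
def optData {α : Type} (e : α → Data) : Option α → Data
  | none => Data.num 0
  | some a => Data.pair (Data.num 0) (e a)

theorem Det.isSome {α : ι → Type} {e : ∀ i, α i → Data} {o : ∀ i, Option (α i)}
    (ho : Det inp fun i => optData (e i) (o i)) : DetP inp fun i => (o i).isSome = true :=
  ((Det.num 1).sub ho.isNum).congr fun i => by
    beta_reduce
    cases o i <;> rfl

theorem Det.getD {α : ι → Type} {e : ∀ i, α i → Data} {o : ∀ i, Option (α i)} {d : ∀ i, α i}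
    (ho : Det inp fun i => optData (e i) (o i)) (hd : Det inp fun i => e i (d i)) :
    Det inp fun i => e i ((o i).getD (d i)) :=
  (Det.ite ho.isSome ho.snd hd).congr fun i => by cases o i <;> rfl

/-- In a right fold the earliest hit is processed last and overrides the others, so a search becomes
a loop without early exit. -/
theorem find_map_eq_foldr {α β : Type} (p : α → Bool) (f : α → β) (l : List α) :
    (l.find? p).map f = l.foldr (fun a acc => if p a = true then some (f a) else acc) none := by
  induction l with
  | nil => rfl
  | cons a l ih =>
    rw [List.find?_cons, List.foldr_cons, ← ih]
    cases p a <;> rfl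

/-- The image of the first index with a given property. -/
theorem Det.findMap (hn : Det inp fun i => Data.unary (n i)) {α : ι → Type}
    {e : ∀ i, α i → Data} {p : ∀ i, Fin (n i) → Bool} {f : ∀ i, Fin (n i) → α i}
    (hp : DetP (fun x : Σ i, Fin (n i) => Data.pair (inp x.1) (Data.num x.2))
      fun x => p x.1 x.2 = true)
    (hf : Det (fun x : Σ i, Fin (n i) => Data.pair (inp x.1) (Data.num x.2))
      fun x => e x.1 (f x.1 x.2))
    (hQ : ∃ Q : Polynomial ℕ, ∀ i a, (e i a).size ≤ Q.eval (inp i).size) :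
    Det inp fun i => optData (e i) (((List.finRange (n i)).find? (p i)).map (f i)) := by
  simp only [find_map_eq_foldr]
  obtain ⟨Q, hQ⟩ := hQ
  refine Det.foldr hn (σ := fun i => Option (α i)) (e := fun i => optData (e i))
    (z := fun _ => none)
    (g := fun i a acc => if p i a = true then some (f i a) else acc) (Det.num 0) ?_
    ⟨Q + 2, fun i s => ?_⟩
  · let inp' : (Σ i, Fin (n i) × Option (α i)) → Data := fun x =>
      Data.pair (inp x.1) (Data.pair (Data.num x.2.1) (optData (e x.1) x.2.2))
    have h0 : Det inp' inp' := Det.id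
    have hj : Det inp' fun x => Data.pair (inp x.1) (Data.num x.2.1) :=
      h0.pair_fst.pair h0.pair_snd.pair_fst
    have hs : Det inp' fun x => optData (e x.1) x.2.2 := h0.pair_snd.pair_snd
    have hp' : DetP inp' fun x => p x.1 x.2.1 = true :=
      (hp.reindex fun x : Σ i, Fin (n i) × Option (α i) => ⟨x.1, x.2.1⟩).precomp hj
    have hf' : Det inp' fun x => e x.1 (f x.1 x.2.1) :=
      (hf.reindex fun x : Σ i, Fin (n i) × Option (α i) => ⟨x.1, x.2.1⟩).precomp hj
    refine (Det.ite hp' ((Det.num 0).pair hf') hs).congr fun x => ?_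
    split_ifs <;> rfl
  · cases s with
    | none => simp [optData, Data.size]
    | some a =>
      have := hQ i a
      simp only [optData, Data.size, Polynomial.eval_add, Polynomial.eval_ofNat, Nat.size_zero]
      omega

theorem DetP.exists (hn : Det inp fun i => Data.unary (n i)) {p : ∀ i, Fin (n i) → Prop}
    [∀ i j, Decidable (p i j)] [∀ i, Decidable (∃ j, p i j)]
    (hp : DetP (fun x : Σ i, Fin (n i) => Data.pair (inp x.1) (Data.num x.2))
      fun x => p x.1 x.2) : DetP inp fun i => ∃ j, p i j := by
  refine (Det.isSome (Det.findMap hn (p := fun i j => decide (p i j)) (α := fun _ => Unit)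
    (e := fun _ _ => Data.num 0) (f := fun _ _ => ()) (hp.congr fun x => by simp) (Det.num 0)
    ⟨1, by simp [Data.size]⟩)).congr fun i => ?_
  simp

variable {q : ι → ℕ} [∀ i, NeZero (q i)]

theorem size_enc_le {c : ℕ} [NeZero c] (v : ZMod c) : (enc v).size ≤ (Data.num c).size :=
  Nat.succ_le_succ (natSize_le_of_le (ZMod.val_lt v).le)

theorem enc_size_bound (hq : Det inp fun i => Data.num (q i)) :
    ∃ Q : Polynomial ℕ, ∀ i (v : ZMod (q i)), (enc v).size ≤ Q.eval (inp i).size := by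
  obtain ⟨Q, hQ⟩ := hq.size_bound
  exact ⟨Q, fun i v => (size_enc_le v).trans (hQ i)⟩

theorem Det.zsum (hn : Det inp fun i => Data.unary (n i)) (hq : Det inp fun i => Data.num (q i))
    {f : ∀ i, Fin (n i) → ZMod (q i)}
    (hf : Det (fun x : Σ i, Fin (n i) => Data.pair (inp x.1) (Data.num x.2))
      fun x => enc (f x.1 x.2)) : Det inp fun i => enc (∑ j, f i j) := by
  have h := Det.foldr hn (σ := fun i => ZMod (q i)) (e := fun _ => enc) (z := fun _ => 0)
    (g := fun i j s => f i j + s) ((Det.num 0).congr fun i => by simp [enc]) ?_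
    (enc_size_bound hq)
  · refine h.congr fun i => ?_
    rw [Fin.sum_univ_def, List.sum_eq_foldr, List.foldr_map]
  · let inp' : (Σ i, Fin (n i) × ZMod (q i)) → Data := fun x =>
      Data.pair (inp x.1) (Data.pair (Data.num x.2.1) (enc x.2.2))
    have h0 : Det inp' inp' := Det.id
    have hj : Det inp' fun x => Data.pair (inp x.1) (Data.num x.2.1) :=
      h0.pair_fst.pair h0.pair_snd.pair_fst
    have hf' : Det inp' fun x => enc (f x.1 x.2.1) :=
      (hf.reindex fun x : Σ i, Fin (n i) × ZMod (q i) => ⟨x.1, x.2.1⟩).precomp hj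
    have hs : Det inp' fun x => enc x.2.2 := h0.pair_snd.pair_snd
    exact Det.zadd (q := fun x : Σ i, Fin (n i) × ZMod (q i) => q x.1) hq.weaken hf' hs

theorem foldr_hit {α β : Type} (p : α → Prop) [DecidablePred p] (f : α → β) (z b : β)
    (l : List α) (hf : ∀ a, p a → f a = b) (h : ∃ a ∈ l, p a) :
    l.foldr (fun a acc => if p a then f a else acc) z = b := by
  induction l with
  | nil => simp at h
  | cons a l ih =>
    rw [List.foldr_cons]
    split_ifs with ha
    · exact hf a ha
    · obtain ⟨c, hc, hpc⟩ := h
      rcases List.mem_cons.1 hc with rfl | hc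
      · exact absurd hpc ha
      · exact ih ⟨c, hc, hpc⟩

/-- For representatives, `a * a⁻¹ = j * c + 1` with a quotient `j < a`, so trying all `j < b` finds
the inverse; any hit yields it. For `a = 0` the remainder modulo `0` is never zero, and the default
`0` agrees with `0⁻¹`. The garbled filter divides only by multiplicities, which are at most `k`. -/
theorem inv_eq_foldr {c : ℕ} [Fact c.Prime] (a : ZMod c) {b : ℕ} (hb : a.val ≤ b) :
    (List.finRange b).foldr (fun (j : Fin b) acc => if (j * c + 1) % a.val = 0 then
      (((j * c + 1) / a.val : ℕ) : ZMod c) else acc) 0 = a⁻¹ := by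
  have hc : 1 < c := (Fact.out : c.Prime).one_lt
  by_cases ha : a = 0
  · subst ha
    simp only [ZMod.val_zero, Nat.mod_zero, Nat.succ_ne_zero, if_false, inv_zero]
    have : ∀ l : List (Fin b), l.foldr (fun _ (acc : ZMod c) => acc) 0 = 0 := fun l => by
      induction l <;> simp_all
    exact this _
  · refine foldr_hit (fun j : Fin b => (j * c + 1) % a.val = 0) _ _ _ _ (fun j hj => ?_) ?_
    · refine eq_inv_of_mul_eq_one_left ?_
      have h1 : (j * c + 1) / a.val * a.val = j * c + 1 :=
        Nat.div_mul_cancel (Nat.dvd_of_mod_eq_zero hj)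
      have h2 := congrArg (Nat.cast : ℕ → ZMod c) h1
      rw [Nat.cast_mul, ZMod.natCast_zmod_val] at h2
      rw [h2]
      simp
    · have h1 : a.val * (a⁻¹).val % c = 1 := by
        rw [← ZMod.val_mul, mul_inv_cancel₀ ha, ZMod.val_one]
      have h2 := Nat.div_add_mod (a.val * (a⁻¹).val) c
      rw [h1] at h2
      have h3 : a.val * (a⁻¹).val / c < a.val := by
        rw [Nat.div_lt_iff_lt_mul (by omega)]
        exact Nat.mul_lt_mul_of_pos_left (ZMod.val_lt _)
          (Nat.pos_of_ne_zero (by rwa [Ne, ZMod.val_eq_zero]))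
      refine ⟨⟨_, h3.trans_le hb⟩, List.mem_finRange _, ?_⟩
      change (a.val * (a⁻¹).val / c * c + 1) % a.val = 0
      rw [mul_comm _ c, h2, Nat.mul_mod_right]

/-- Inversion of small elements of a prime field. -/
theorem Det.zinv {q : ι → ℕ} [∀ i, Fact (q i).Prime] (hn : Det inp fun i => Data.unary (n i))
    (hq : Det inp fun i => Data.num (q i)) {a : ∀ i, ZMod (q i)}
    (ha : Det inp fun i => enc (a i)) (hle : ∀ i, (a i).val ≤ n i) :
    Det inp fun i => enc (a i)⁻¹ := by
  have h := Det.foldr hn (σ := fun i => ZMod (q i)) (e := fun _ => enc) (z := fun _ => 0)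
    (g := fun i j acc => if (j * q i + 1) % (a i).val = 0 then
      (((j * q i + 1) / (a i).val : ℕ) : ZMod (q i)) else acc)
    ((Det.num 0).congr fun i => by simp [enc]) ?_ (enc_size_bound hq)
  · exact h.congr fun i => by rw [inv_eq_foldr _ (hle i)]
  · let inp' : (Σ i, Fin (n i) × ZMod (q i)) → Data := fun x =>
      Data.pair (inp x.1) (Data.pair (Data.num x.2.1) (enc x.2.2))
    have h0 : Det inp' inp' := Det.id
    have hj : Det inp' fun x => Data.num x.2.1 := h0.pair_snd.pair_fst
    have hs : Det inp' fun x => enc x.2.2 := h0.pair_snd.pair_snd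
    have hq' : Det inp' fun x => Data.num (q x.1) := hq.weaken
    have ha' : Det inp' fun x => Data.num (a x.1).val := ha.weaken
    have hc : Det inp' fun x => Data.num (x.2.1 * q x.1 + 1) := (hj.mul hq').add (Det.num 1)
    refine (Det.ite (DetP.natEq (hc.mod ha') (Det.num 0))
      (Det.zcast hq' (hc.div ha')) hs).congr fun x => ?_
    split_ifs <;> rfl

end Loops

/-! ## The simulators are efficient -/

section Parameters

variable {P : Params} {ι : Type} {inp : ι → Data} {κ : ι → ℕ}

theorem Det.pubP (hpub : Det inp fun i => P.pub (κ i)) :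
    Det inp fun i => Data.num (P.p (κ i)) := hpub.snd.fst

theorem Det.pubK (hpub : Det inp fun i => P.pub (κ i)) :
    Det inp fun i => Data.unary (P.k (κ i)) := hpub.snd.snd.fst

theorem Det.pubM (hpub : Det inp fun i => P.pub (κ i)) :
    Det inp fun i => Data.unary (P.m (κ i)) := hpub.snd.snd.snd.fst

theorem Det.pubT (hpub : Det inp fun i => P.pub (κ i)) :
    Det inp fun i => Data.unary (P.t (κ i)) := hpub.snd.snd.snd.snd.fst

theorem Det.pubN (hpub : Det inp fun i => P.pub (κ i)) :
    Det inp fun i => Data.unary (P.n (κ i)) := hpub.snd.snd.snd.snd.snd.fst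

theorem Det.pubSeedLen (hpub : Det inp fun i => P.pub (κ i)) :
    Det inp fun i => Data.unary (P.seedLen (κ i)) := hpub.snd.snd.snd.snd.snd.snd.snd.fst

/-- Computations in an extended context. -/
theorem Computes.lift {ι' : Type} {inp' : ι' → Data} {X : ι → PMF Data} (h : Computes inp X)
    {g : ι' → ι} (hg : Det inp' fun x => inp (g x)) : Computes inp' fun x => X (g x) :=
  (h.reindex g).precomp hg

theorem Det.lift {ι' : Type} {inp' : ι' → Data} {f : ι → Data} (h : Det inp f)
    {g : ι' → ι} (hg : Det inp' fun x => inp (g x)) : Det inp' fun x => f (g x) :=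
  Computes.lift h hg

theorem Computes.bindVal (hpub : Det inp fun i => P.pub (κ i)) {out : ∀ i, P.Val (κ i) → PMF Data}
    (h : Computes (fun x : Σ i, P.Val (κ i) => Data.pair (inp x.1) (enc x.2))
      fun x => out x.1 x.2) :
    Computes inp fun i => (PMF.uniformOfFintype (P.Val (κ i))).bind (out i) :=
  Computes.bind (Computes.uniformZMod hpub.pubP) h

theorem Computes.bindBit {out : ι → ZMod 2 → PMF Data}
    (h : Computes (fun x : Σ _ : ι, ZMod 2 => Data.pair (inp x.1) (enc x.2))
      fun x => out x.1 x.2) :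
    Computes inp fun i => (PMF.uniformOfFintype (ZMod 2)).bind (out i) :=
  Computes.bind (τ := fun _ => ZMod 2) (e := fun _ => enc)
    (Computes.uniformZMod (q := fun _ => 2) (Det.num 2)) h

theorem Computes.code {S : Code} (hS : S.PolyTime) {f : ι → Data} (hf : Det inp f) :
    Computes inp fun i => S.eval (f i) :=
  Computes.app (F := S.eval) ⟨S, hS, fun _ => rfl⟩ hf

theorem Computes.pairPMF {X Y : ι → PMF Data} (hX : Computes inp X) (hY : Computes inp Y) :
    Computes inp fun i => SSIP.pairPMF (X i) (Y i) :=
  Computes.pair hX hY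

theorem Data.vec_two (f : Fin 2 → Data) : Data.vec f = Data.list [f 0, f 1] := by
  simp [Data.vec, List.ofFn_succ]

theorem Det.bitVal {b : ι → ZMod 2} (hpub : Det inp fun i => P.pub (κ i))
    (hb : Det inp fun i => enc (b i)) :
    Det inp fun i => enc (bitVal (b i) : P.Val (κ i)) :=
  Det.zcast (n := fun i => (b i).val) hpub.pubP hb

theorem Det.succK (hpub : Det inp fun i => P.pub (κ i)) :
    Det inp fun i => Data.num (P.k (κ i) + 1) :=
  (Det.ofUnary hpub.pubK).add (Det.num 1)

theorem Det.testIdx (hpub : Det inp fun i => P.pub (κ i)) {x : ∀ i, P.Val (κ i)}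
    (hx : Det inp fun i => enc (x i)) :
    Det inp fun i => Data.num (testIdx P (κ i) (x i)) :=
  Det.mod (a := fun i => (x i).val) hx hpub.succK

theorem Det.specialPos (hpub : Det inp fun i => P.pub (κ i)) {μ : ∀ i, P.Val (κ i)}
    (hμ : Det inp fun i => enc (μ i)) :
    Det inp fun i => Data.num (specialPos P (κ i) (μ i)) := by
  have h := Det.zsub hpub.pubP (Det.zcast hpub.pubP (Det.ofUnary hpub.pubK)) hμ
  exact Det.mod (a := fun i => ((P.k (κ i) : P.Val (κ i)) - μ i).val) h hpub.succK

theorem Det.testBits (hpub : Det inp fun i => P.pub (κ i)) {μ : ∀ i, P.Val (κ i)}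
    (hμ : Det inp fun i => enc (μ i)) {b : ι → ZMod 2} (hb : Det inp fun i => enc (b i)) :
    Det inp fun i => Data.vec fun a => enc (testBits P (κ i) (μ i) (b i) a) := by
  have hk : Det inp fun i => Data.unary (P.k (κ i) + 1) := (Det.num 0).pair hpub.pubK
  refine Det.vec hk ?_
  have hj : Det (fun x : Σ i, Fin (P.k (κ i) + 1) => Data.pair (inp x.1) (Data.num x.2))
    fun x => Data.num x.2 := Det.id.pair_snd
  have hb' : Det (fun x : Σ i, Fin (P.k (κ i) + 1) => Data.pair (inp x.1) (Data.num x.2))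
    fun x => enc (b x.1) := hb.weaken
  refine (Det.ite (DetP.natEq hj (hpub.specialPos hμ).weaken)
    (Det.zadd (q := fun _ => 2) (a := fun _ => 1) (Det.num 2) (Det.num 1) hb') hb').congr
    fun x => ?_
  unfold SSIP.testBits
  split_ifs <;> rfl

theorem Det.clientMsgs (hpub : Det inp fun i => P.pub (κ i)) {b : ι → ZMod 2}
    (hb : Det inp fun i => enc (b i)) {δ Δ : ∀ i, P.Val (κ i)}
    (hδ : Det inp fun i => enc (δ i)) (hΔ : Det inp fun i => enc (Δ i)) :
    Det inp fun i => Data.vec fun j => enc (clientMsgs SSIP.bitVal (b i) (δ i) (Δ i) j) := by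
  have hq := hpub.pubP
  have hv := hpub.bitVal hb
  have h1 : Det inp fun i => enc (1 : P.Val (κ i)) :=
    (Det.zcast hq (Det.num 1)).congr fun i => by rw [Nat.cast_one]
  refine ((Det.zadd hq hΔ (Det.zmul hq hv hδ)).cons
    ((Det.zadd hq hΔ (Det.zmul hq (Det.zsub hq h1 hv) hδ)).cons Det.nil)).congr fun i => ?_
  rw [Data.vec_two]
  rfl

theorem Det.serverMsgs (hpub : Det inp fun i => P.pub (κ i)) {b : ι → ZMod 2}
    (hb : Det inp fun i => enc (b i)) {r ρ α : ∀ i, P.Val (κ i)}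
    (hr : Det inp fun i => enc (r i)) (hρ : Det inp fun i => enc (ρ i))
    (hα : Det inp fun i => enc (α i)) :
    Det inp fun i => Data.vec fun j =>
      enc (serverMsgs SSIP.bitVal (r i) (b i) (ρ i) (α i) j) := by
  have hq := hpub.pubP
  have hv := hpub.bitVal hb
  have h1 : Det inp fun i => enc (1 : P.Val (κ i)) :=
    (Det.zcast hq (Det.num 1)).congr fun i => by rw [Nat.cast_one]
  have hw := Det.zsub hq h1 hv
  have hd := Det.zsub hq hρ hα
  refine ((Det.zsub hq (Det.zadd hq hr (Det.zmul hq hv hd)) (Det.zmul hq hw hα)).cons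
    ((Det.zsub hq (Det.zadd hq hr (Det.zmul hq hw hd)) (Det.zmul hq hv hα)).cons
      Det.nil)).congr fun i => ?_
  rw [Data.vec_two]
  rfl

theorem Computes.clientViews {S : Fin 5 → Code} (hS : ∀ j, (S j).PolyTime)
    (hpub : Det inp fun i => P.pub (κ i)) {pos : ∀ i, Fin (P.k (κ i)) → Fin (P.m (κ i))}
    (hpos : Det inp fun i => Data.vec fun a => Data.num (pos i a)) {b : ι → ZMod 2}
    {s μ' δ Δ r' : ∀ i, P.Val (κ i)} (hs : Det inp fun i => enc (s i))
    (hμ : Det inp fun i => enc (μ' i)) (hb : Det inp fun i => enc (b i))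
    (hδ : Det inp fun i => enc (δ i)) (hΔ : Det inp fun i => enc (Δ i))
    (hr : Det inp fun i => enc (r' i)) :
    Computes inp fun i => clientViews S (pos i) (s i) (μ' i) (b i) (δ i) (Δ i) (r' i) := by
  have n : Det inp fun _ => Data.list [] := Det.nil
  exact .pairPMF (.code (hS 0) (hpub.cons ((hpos.cons n).cons (hμ.cons n)))) <|
    .pairPMF (.code (hS 1) (hpub.cons ((hpub.testIdx hμ).cons (hb.cons n)))) <|
    .pairPMF (.code (hS 2) (hpub.cons ((hpos.cons (hs.cons n)).cons (hδ.cons n)))) <|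
    .pairPMF hΔ <|
    .pairPMF (.code (hS 3) (hpub.cons ((hpub.clientMsgs hb hδ hΔ).cons (n.cons n)))) <|
    .pairPMF (.code (hS 4) (hpub.cons (Det.cons (f := fun i => Data.num (choice (b i))) hb
      (hr.cons n)))) n

theorem Computes.serverViews {S : Fin 5 → Code} (hS : ∀ j, (S j).PolyTime)
    (hpub : Det inp fun i => P.pub (κ i)) {BF GBF : ∀ i, Fin (P.m (κ i)) → P.Val (κ i)}
    (hBF : Det inp fun i => Data.vec fun l => enc (BF i l))
    (hGBF : Det inp fun i => Data.vec fun l => enc (GBF i l)) {b : ι → ZMod 2}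
    {μ ρ r α : ∀ i, P.Val (κ i)}
    (hμ : Det inp fun i => enc (μ i)) (hb : Det inp fun i => enc (b i))
    (hρ : Det inp fun i => enc (ρ i)) (hr : Det inp fun i => enc (r i))
    (hα : Det inp fun i => enc (α i)) :
    Computes inp fun i => serverViews S (BF i) (GBF i) (μ i) (b i) (ρ i) (r i) (α i) := by
  have n : Det inp fun _ => Data.list [] := Det.nil
  exact .pairPMF hμ <|
    .pairPMF (.code (hS 0) (hpub.cons ((hBF.cons (hμ.cons n)).cons (n.cons n)))) <|
    .pairPMF hb <|
    .pairPMF (.code (hS 1) (hpub.cons ((hpub.testBits hμ hb).cons (n.cons n)))) <|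
    .pairPMF hρ <|
    .pairPMF (.code (hS 2) (hpub.cons ((hGBF.cons (hρ.cons n)).cons (n.cons n)))) <|
    .pairPMF (.code (hS 3) (hpub.cons (Det.cons (f := fun i => Data.num (choice (b i))) hb
      (hr.cons n)))) <|
    .pairPMF hα <|
    .pairPMF (.code (hS 4) (hpub.cons ((hpub.serverMsgs hb hr hρ hα).cons (n.cons n)))) n

theorem Computes.clientSim {S : Fin 5 → Code} (hS : ∀ j, (S j).PolyTime)
    (hpub : Det inp fun i => P.pub (κ i)) {pos : ∀ i, Fin (P.k (κ i)) → Fin (P.m (κ i))}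
    (hpos : Det inp fun i => Data.vec fun a => Data.num (pos i a))
    {s share : ∀ i, P.Val (κ i)} (hs : Det inp fun i => enc (s i))
    (hshare : Det inp fun i => enc (share i)) :
    Computes inp fun i => clientSim S (pos i) (s i) (share i) := by
  unfold SSIP.clientSim
  refine Computes.bindVal hpub (Computes.bindBit ?_)
  refine Computes.bindVal (κ := fun x : (Σ _ : (Σ i, P.Val (κ i)), ZMod 2) => κ x.1.1) ?_ ?_
  · exact hpub.lift Det.id.pair_fst.pair_fst
  refine Computes.bindVal
    (κ := fun x : (Σ x : (Σ _ : (Σ i, P.Val (κ i)), ZMod 2), P.Val (κ x.1.1)) => κ x.1.1.1) ?_ ?_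
  · exact hpub.lift Det.id.pair_fst.pair_fst.pair_fst
  -- Context of the innermost computation: the input followed by the samples `μ'`, `b₀`, `δ`, `Δ`.
  let J : Type := Σ x : (Σ x : (Σ _ : (Σ i, P.Val (κ i)), ZMod 2), P.Val (κ x.1.1)),
    P.Val (κ x.1.1.1)
  let inp' : J → Data := fun x => Data.pair (Data.pair (Data.pair (Data.pair
    (inp x.1.1.1.1) (enc x.1.1.1.2)) (enc x.1.1.2)) (enc x.1.2)) (enc x.2)
  have h0 : Det inp' inp' := Det.id
  have hr : Det inp' fun x => inp x.1.1.1.1 := h0.pair_fst.pair_fst.pair_fst.pair_fst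
  have hpub' : Det inp' fun x => P.pub (κ x.1.1.1.1) := hpub.lift hr
  have hΔ : Det inp' fun x => enc x.2 := h0.pair_snd
  exact Computes.clientViews (κ := fun x : J => κ x.1.1.1.1) hS hpub'
    (hpos.lift hr) (hs.lift hr)
    h0.pair_fst.pair_fst.pair_fst.pair_snd h0.pair_fst.pair_fst.pair_snd h0.pair_fst.pair_snd hΔ
    (Det.zadd hpub'.pubP (hshare.lift hr) hΔ)

theorem Computes.serverSim {S : Fin 5 → Code} (hS : ∀ j, (S j).PolyTime)
    (hpub : Det inp fun i => P.pub (κ i)) {BF GBF : ∀ i, Fin (P.m (κ i)) → P.Val (κ i)}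
    (hBF : Det inp fun i => Data.vec fun l => enc (BF i l))
    (hGBF : Det inp fun i => Data.vec fun l => enc (GBF i l))
    {share : ∀ i, P.Val (κ i)} (hshare : Det inp fun i => enc (share i)) :
    Computes inp fun i => serverSim S (BF i) (GBF i) (share i) := by
  unfold SSIP.serverSim
  refine Computes.bindVal hpub (Computes.bindBit ?_)
  refine Computes.bindVal (κ := fun x : (Σ _ : (Σ i, P.Val (κ i)), ZMod 2) => κ x.1.1) ?_ ?_
  · exact hpub.lift Det.id.pair_fst.pair_fst
  refine Computes.bindVal
    (κ := fun x : (Σ x : (Σ _ : (Σ i, P.Val (κ i)), ZMod 2), P.Val (κ x.1.1)) => κ x.1.1.1) ?_ ?_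
  · exact hpub.lift Det.id.pair_fst.pair_fst.pair_fst
  let J : Type := Σ x : (Σ x : (Σ _ : (Σ i, P.Val (κ i)), ZMod 2), P.Val (κ x.1.1)),
    P.Val (κ x.1.1.1)
  let inp' : J → Data := fun x => Data.pair (Data.pair (Data.pair (Data.pair
    (inp x.1.1.1.1) (enc x.1.1.1.2)) (enc x.1.1.2)) (enc x.1.2)) (enc x.2)
  have h0 : Det inp' inp' := Det.id
  have hr : Det inp' fun x => inp x.1.1.1.1 := h0.pair_fst.pair_fst.pair_fst.pair_fst
  exact Computes.serverViews (κ := fun x : J => κ x.1.1.1.1) hS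
    (hpub.lift hr) (hBF.lift hr)
    (hGBF.lift hr)
    h0.pair_fst.pair_fst.pair_fst.pair_snd h0.pair_fst.pair_fst.pair_snd h0.pair_fst.pair_snd
    h0.pair_snd (hshare.lift hr)

end Parameters

/-! ## The filters are computable in polynomial time -/

section Filters

variable {P : Params}

/-- The first position that is free. -/
def firstFree {κ : ℕ} (pos : Fin (P.k κ) → Fin (P.m κ)) (A : Fin (P.m κ) → Option (P.Val κ)) :
    Option (Fin (P.m κ)) :=
  ((List.finRange (P.k κ)).find? fun a => (A (pos a)).isNone).map pos

open Classical in
/-- The value for which an insertion solves, at position `w`. -/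
def solvedValue {κ : ℕ} (R : Fin (P.m κ) → P.Val κ) (pos : Fin (P.k κ) → Fin (P.m κ))
    (g : P.Val κ) (A : Fin (P.m κ) → Option (P.Val κ)) (w : Fin (P.m κ)) : P.Val κ :=
  (g - ∑ a, if pos a = w then 0 else (A (pos a)).getD (R (pos a))) *
    (∑ a, if pos a = w then 1 else 0)⁻¹

open Classical in
-- In this form an insertion consists of a search, sums and the inverse of a small number, all of
-- which are known to be efficient. The default position `0` is irrelevant: the branch that uses it
-- is entered only when a free position exists.
theorem gbfInsertTotal_eq {κ : ℕ} (R : Fin (P.m κ) → P.Val κ)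
    (pos : Fin (P.k κ) → Fin (P.m κ)) (g : P.Val κ) (A : Fin (P.m κ) → Option (P.Val κ))
    (l : Fin (P.m κ)) :
    gbfInsertTotal R pos g A l =
      if (firstFree pos A).isSome = true then
        if l = (firstFree pos A).getD ⟨0, P.m_pos κ⟩ then
          some (solvedValue R pos g A ((firstFree pos A).getD ⟨0, P.m_pos κ⟩))
        else if ∃ a, pos a = l then some ((A l).getD (R l)) else A l
      else A l := by
  unfold gbfInsertTotal gbfInsert firstFree
  cases hf : (List.finRange (P.k κ)).find? (fun a => (A (pos a)).isNone) with
  | none => simp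
  | some a0 =>
    have h1 : (∑ a, if pos a = pos a0 then (0 : P.Val κ) else (A (pos a)).getD (R (pos a))) =
        ∑ a with pos a ≠ pos a0, (A (pos a)).getD (R (pos a)) := by
      rw [Finset.sum_filter]
      refine Finset.sum_congr rfl fun a _ => ?_
      by_cases h : pos a = pos a0 <;> simp [h]
    have h2 : (∑ a, if pos a = pos a0 then (1 : P.Val κ) else 0) =
        ((Finset.univ.filter fun a => pos a = pos a0).card : P.Val κ) := by
      rw [Finset.card_filter, Nat.cast_sum]
      simp
    simp only [Option.map_some, Option.isSome_some, if_true, Option.getD_some, solvedValue, h1, h2,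
      div_eq_mul_inv]

variable {H : HashFamily} {ι : Type} {inp : ι → Data} {κ : ι → ℕ}

theorem Det.hash (hpub : Det inp fun i => P.pub (κ i)) {seed : ∀ i, P.Seed (κ i)}
    (hseed : Det inp fun i => Data.num (seed i)) {a : ∀ i, Fin (P.k (κ i))}
    (ha : Det inp fun i => Data.num (a i)) {x : ∀ i, P.Key (κ i)}
    (hx : Det inp fun i => Data.num (x i)) :
    Det inp fun i => Data.num (hash P H (seed i) (a i) (x i)) :=
  (Det.toNat (Det.polyFun H (hpub.cons (hseed.cons (ha.cons (hx.cons Det.nil)))))).mod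
    (Det.ofUnary hpub.pubM)

theorem Det.hashes (hpub : Det inp fun i => P.pub (κ i)) {seed : ∀ i, P.Seed (κ i)}
    (hseed : Det inp fun i => Data.num (seed i)) {x : ∀ i, P.Key (κ i)}
    (hx : Det inp fun i => Data.num (x i)) :
    Det inp fun i => Data.vec fun a => Data.num (SSIP.hash P H (seed i) a (x i)) := by
  refine Det.vec hpub.pubK ?_
  exact Det.hash (κ := fun x : Σ i, Fin (P.k (κ i)) => κ x.1) (seed := fun x => seed x.1)
    (a := fun x => x.2) hpub.weaken hseed.weaken Det.id.pair_snd hx.weaken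

theorem Det.bloom (hpub : Det inp fun i => P.pub (κ i)) {seed : ∀ i, P.Seed (κ i)}
    (hseed : Det inp fun i => Data.num (seed i)) {y : ∀ i, ServerInput P (κ i)}
    (hy : Det inp fun i => Data.vec fun l =>
      Data.pair (Data.num ((y i).key l)) (enc ((y i).val l))) :
    Det inp fun i => Data.vec fun l => enc (bloom P H (seed i) (y i) l) := by
  classical
  refine Det.vec hpub.pubM ?_
  -- Context of the innermost test: a filter position, a server key and a hash function; two nested
  -- searches run over the latter two.
  let K : Type := Σ x : (Σ x : (Σ i, Fin (P.m (κ i))), Fin (P.n (κ x.1))), Fin (P.k (κ x.1.1))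
  let inp' : K → Data := fun x => Data.pair (Data.pair (Data.pair (inp x.1.1.1)
    (Data.num x.1.1.2)) (Data.num x.1.2)) (Data.num x.2)
  have h0 : Det inp' inp' := Det.id
  have hr : Det inp' fun x => inp x.1.1.1 := h0.pair_fst.pair_fst.pair_fst
  have hpub' : Det inp' fun x => P.pub (κ x.1.1.1) := hpub.lift hr
  have hj : Det inp' fun x => Data.num x.1.2 := h0.pair_fst.pair_snd
  have hkey : Det inp' fun x => Data.num ((y x.1.1.1).key x.1.2) :=
    (Det.nth (j := fun x : K => x.1.2) (f := fun x : K => fun l =>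
      Data.pair (Data.num ((y x.1.1.1).key l)) (enc ((y x.1.1.1).val l)))
      hpub'.pubN (hy.lift hr) hj).pair_fst
  have hp : DetP inp' fun x => ((SSIP.hash P H (seed x.1.1.1) x.2 ((y x.1.1.1).key x.1.2) :
      Fin _) : ℕ) = x.1.1.2 :=
    DetP.natEq (Det.hash (κ := fun x : K => κ x.1.1.1) (seed := fun x => seed x.1.1.1)
      (a := fun x => x.2) hpub' (hseed.lift hr) h0.pair_snd hkey)
      h0.pair_fst.pair_fst.pair_snd
  have hp1 : DetP (fun x : Σ x : (Σ i, Fin (P.m (κ i))), Fin (P.n (κ x.1)) =>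
      Data.pair (Data.pair (inp x.1.1) (Data.num x.1.2)) (Data.num x.2)) fun x =>
      ∃ a, ((SSIP.hash P H (seed x.1.1) a ((y x.1.1).key x.2) : Fin _) : ℕ) = x.1.2 :=
    DetP.exists (n := fun x : Σ x : (Σ i, Fin (P.m (κ i))), Fin (P.n (κ x.1)) => P.k (κ x.1.1))
      (hpub.lift (g := fun x : Σ x : (Σ i, Fin (P.m (κ i))), Fin (P.n (κ x.1)) => x.1.1)
        Det.id.pair_fst.pair_fst).pubK hp
  have hp2 : DetP (fun x : Σ i, Fin (P.m (κ i)) => Data.pair (inp x.1) (Data.num x.2)) fun x =>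
      ∃ j a, ((SSIP.hash P H (seed x.1) a ((y x.1).key j) : Fin _) : ℕ) = x.2 :=
    DetP.exists (n := fun x : Σ i, Fin (P.m (κ i)) => P.n (κ x.1))
      (hpub.lift (g := fun x : Σ i, Fin (P.m (κ i)) => x.1) Det.id.pair_fst).pubN hp1
  have hone : Det (fun x : Σ i, Fin (P.m (κ i)) => Data.pair (inp x.1) (Data.num x.2))
      fun x => enc (1 : P.Val (κ x.1)) :=
    (Det.zcast (hpub.lift (g := fun x : Σ i, Fin (P.m (κ i)) => x.1) Det.id.pair_fst).pubP
      (Det.num 1)).congr fun x => by rw [Nat.cast_one]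
  refine (Det.ite hp2 hone (Det.num 0)).congr fun x => ?_
  simp only [SSIP.bloom, ← Fin.ext_iff]
  split_ifs
  · rfl
  · simp [enc]

theorem Det.firstFree (hpub : Det inp fun i => P.pub (κ i))
    {pos : ∀ i, Fin (P.k (κ i)) → Fin (P.m (κ i))}
    (hpos : Det inp fun i => Data.vec fun a => Data.num (pos i a))
    {A : ∀ i, Fin (P.m (κ i)) → Option (P.Val (κ i))}
    (hA : Det inp fun i => Data.vec fun l => optData enc (A i l)) :
    Det inp fun i => optData (fun l : Fin (P.m (κ i)) => Data.num l)
      (firstFree (pos i) (A i)) := by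
  let inp' : (Σ i, Fin (P.k (κ i))) → Data := fun x => Data.pair (inp x.1) (Data.num x.2)
  have h0 : Det inp' inp' := Det.id
  have hr : Det inp' fun x => inp x.1 := h0.pair_fst
  have hpub' : Det inp' fun x => P.pub (κ x.1) := hpub.lift hr
  have hpa : Det inp' fun x => Data.num (pos x.1 x.2) :=
    Det.nth (f := fun (x : Σ i, Fin (P.k (κ i))) a => Data.num (pos x.1 a)) (j := fun x => x.2)
      hpub'.pubK (hpos.lift hr) h0.pair_snd
  have hAa : Det inp' fun x => optData enc (A x.1 (pos x.1 x.2)) :=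
    Det.nth (f := fun (x : Σ i, Fin (P.k (κ i))) l => optData enc (A x.1 l))
      (j := fun x => pos x.1 x.2) hpub'.pubM (hA.lift hr) hpa
  obtain ⟨Q, hQ⟩ := (Det.ofUnary hpub.pubM).size_bound
  refine Det.findMap (e := fun i (l : Fin (P.m (κ i))) => Data.num l) hpub.pubK
    (p := fun i a => (A i (pos i a)).isNone) ?_ hpa ⟨Q, fun i l => ?_⟩
  · refine hAa.isNum.congr fun x => ?_
    beta_reduce
    cases A x.1 (pos x.1 x.2) <;> rfl
  · exact (Nat.succ_le_succ (natSize_le_of_le l.2.le)).trans (hQ i)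

theorem Det.getDVec (hpub : Det inp fun i => P.pub (κ i))
    {R : ∀ i, Fin (P.m (κ i)) → P.Val (κ i)} (hR : Det inp fun i => Data.vec fun l => enc (R i l))
    {A : ∀ i, Fin (P.m (κ i)) → Option (P.Val (κ i))}
    (hA : Det inp fun i => Data.vec fun l => optData enc (A i l)) :
    Det inp fun i => Data.vec fun l => enc ((A i l).getD (R i l)) := by
  refine Det.vec hpub.pubM ?_
  let inp' : (Σ i, Fin (P.m (κ i))) → Data := fun x => Data.pair (inp x.1) (Data.num x.2)
  have h0 : Det inp' inp' := Det.id
  have hr : Det inp' fun x => inp x.1 := h0.pair_fst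
  have hpub' : Det inp' fun x => P.pub (κ x.1) := hpub.lift hr
  exact Det.getD (e := fun x : Σ i, Fin (P.m (κ i)) => (enc : P.Val (κ x.1) → Data))
    (Det.nth (f := fun (x : Σ i, Fin (P.m (κ i))) l => optData enc (A x.1 l))
      (j := fun x => x.2) hpub'.pubM (hA.lift hr) h0.pair_snd)
    (Det.nth (f := fun (x : Σ i, Fin (P.m (κ i))) l => enc (R x.1 l))
      (j := fun x => x.2) hpub'.pubM (hR.lift hr) h0.pair_snd)

open Classical in
-- Since `k` is public in unary, this bound makes the inversion by search in `Det.zinv` efficient.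
theorem val_count_le {κ : ℕ} (pos : Fin (P.k κ) → Fin (P.m κ)) (w : Fin (P.m κ)) :
    (∑ a, if pos a = w then (1 : P.Val κ) else 0).val ≤ P.k κ := by
  have h : (∑ a, if pos a = w then (1 : P.Val κ) else 0) =
      ((Finset.univ.filter fun a => pos a = w).card : P.Val κ) := by
    rw [Finset.card_filter, Nat.cast_sum]
    simp
  rw [h, ZMod.val_natCast]
  refine (Nat.mod_le _ _).trans ((Finset.card_filter_le _ _).trans ?_)
  simp

theorem Det.solvedValue (hpub : Det inp fun i => P.pub (κ i))
    {R : ∀ i, Fin (P.m (κ i)) → P.Val (κ i)} (hR : Det inp fun i => Data.vec fun l => enc (R i l))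
    {pos : ∀ i, Fin (P.k (κ i)) → Fin (P.m (κ i))}
    (hpos : Det inp fun i => Data.vec fun a => Data.num (pos i a))
    {g : ∀ i, P.Val (κ i)} (hg : Det inp fun i => enc (g i))
    {A : ∀ i, Fin (P.m (κ i)) → Option (P.Val (κ i))}
    (hA : Det inp fun i => Data.vec fun l => optData enc (A i l))
    {w : ∀ i, Fin (P.m (κ i))} (hw : Det inp fun i => Data.num (w i)) :
    Det inp fun i => enc (solvedValue (R i) (pos i) (g i) (A i) (w i)) := by
  classical
  let inp' : (Σ i, Fin (P.k (κ i))) → Data := fun x => Data.pair (inp x.1) (Data.num x.2)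
  have h0 : Det inp' inp' := Det.id
  have hr : Det inp' fun x => inp x.1 := h0.pair_fst
  have hpub' : Det inp' fun x => P.pub (κ x.1) := hpub.lift hr
  have hpa : Det inp' fun x => Data.num (pos x.1 x.2) :=
    Det.nth (f := fun (x : Σ i, Fin (P.k (κ i))) a => Data.num (pos x.1 a)) (j := fun x => x.2)
      hpub'.pubK (hpos.lift hr) h0.pair_snd
  have hfa : Det inp' fun x => enc ((A x.1 (pos x.1 x.2)).getD (R x.1 (pos x.1 x.2))) :=
    Det.nth (f := fun (x : Σ i, Fin (P.k (κ i))) l => enc ((A x.1 l).getD (R x.1 l)))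
      (j := fun x => pos x.1 x.2) hpub'.pubM ((hpub.getDVec hR hA).lift hr) hpa
  have heq : DetP inp' fun x => (pos x.1 x.2 : ℕ) = w x.1 := DetP.natEq hpa (hw.lift hr)
  have hone : Det inp' fun x => enc (1 : P.Val (κ x.1)) :=
    (Det.zcast hpub'.pubP (Det.num 1)).congr fun x => by rw [Nat.cast_one]
  have hzero : Det inp' fun x => enc (0 : P.Val (κ x.1)) :=
    (Det.zcast hpub'.pubP (Det.num 0)).congr fun x => by rw [Nat.cast_zero]
  have hrest : Det inp fun i => enc (∑ a, if pos i a = w i then (0 : P.Val (κ i)) else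
      (A i (pos i a)).getD (R i (pos i a))) :=
    Det.zsum hpub.pubK hpub.pubP ((Det.ite heq hzero hfa).congr fun x => by
      simp only [← Fin.ext_iff]
      split_ifs <;> rfl)
  have hmult : Det inp fun i => enc (∑ a, if pos i a = w i then (1 : P.Val (κ i)) else 0) :=
    Det.zsum hpub.pubK hpub.pubP ((Det.ite heq hone hzero).congr fun x => by
      simp only [← Fin.ext_iff]
      split_ifs <;> rfl)
  exact Det.zmul hpub.pubP (Det.zsub hpub.pubP hg hrest)
    (Det.zinv hpub.pubK hpub.pubP hmult fun i => val_count_le _ _)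

theorem Det.gbfInsertTotal (hpub : Det inp fun i => P.pub (κ i))
    {R : ∀ i, Fin (P.m (κ i)) → P.Val (κ i)} (hR : Det inp fun i => Data.vec fun l => enc (R i l))
    {pos : ∀ i, Fin (P.k (κ i)) → Fin (P.m (κ i))}
    (hpos : Det inp fun i => Data.vec fun a => Data.num (pos i a))
    {g : ∀ i, P.Val (κ i)} (hg : Det inp fun i => enc (g i))
    {A : ∀ i, Fin (P.m (κ i)) → Option (P.Val (κ i))}
    (hA : Det inp fun i => Data.vec fun l => optData enc (A i l)) :
    Det inp fun i => Data.vec fun l => optData enc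
      (gbfInsertTotal (R i) (pos i) (g i) (A i) l) := by
  classical
  have hfree := hpub.firstFree hpos hA
  -- If no position is free, the values computed for position `0` are discarded by the outer test
  -- `hsome`.
  have hw := Det.getD (d := fun i => ⟨0, P.m_pos (κ i)⟩) hfree (Det.num 0)
  have hv := hpub.solvedValue hR hpos hg hA hw
  refine Det.vec hpub.pubM ?_
  let inp' : (Σ i, Fin (P.m (κ i))) → Data := fun x => Data.pair (inp x.1) (Data.num x.2)
  have h0 : Det inp' inp' := Det.id
  have hr : Det inp' fun x => inp x.1 := h0.pair_fst
  have hl : Det inp' fun x => Data.num x.2 := h0.pair_snd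
  have hpub' : Det inp' fun x => P.pub (κ x.1) := hpub.lift hr
  have hAl : Det inp' fun x => optData enc (A x.1 x.2) :=
    Det.nth (f := fun (x : Σ i, Fin (P.m (κ i))) l => optData enc (A x.1 l))
      (j := fun x => x.2) hpub'.pubM (hA.lift hr) hl
  have hfl : Det inp' fun x => enc ((A x.1 x.2).getD (R x.1 x.2)) :=
    Det.nth (f := fun (x : Σ i, Fin (P.m (κ i))) l => enc ((A x.1 l).getD (R x.1 l)))
      (j := fun x => x.2) hpub'.pubM ((hpub.getDVec hR hA).lift hr) hl
  have hmem : DetP inp' fun x => ∃ a, (pos x.1 a : ℕ) = x.2 := by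
    refine DetP.exists (n := fun x : Σ i, Fin (P.m (κ i)) => P.k (κ x.1)) hpub'.pubK ?_
    let inp2 : (Σ x : (Σ i, Fin (P.m (κ i))), Fin (P.k (κ x.1))) → Data := fun x =>
      Data.pair (inp' x.1) (Data.num x.2)
    have h2 : Det inp2 inp2 := Det.id
    have hr2 : Det inp2 fun x => inp x.1.1 := h2.pair_fst.pair_fst
    exact DetP.natEq (Det.nth
      (f := fun (x : Σ x : (Σ i, Fin (P.m (κ i))), Fin (P.k (κ x.1))) a =>
        Data.num (pos x.1.1 a)) (j := fun x => x.2) (hpub.lift hr2).pubK (hpos.lift hr2)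
      h2.pair_snd) h2.pair_fst.pair_snd
  have hsome : DetP inp' fun x => (SSIP.firstFree (pos x.1) (A x.1)).isSome = true :=
    Det.isSome (e := fun x : Σ i, Fin (P.m (κ i)) => fun l : Fin (P.m (κ x.1)) => Data.num l)
      (hfree.lift hr)
  refine (Det.ite hsome (Det.ite (DetP.natEq hl (hw.lift hr)) ((Det.num 0).pair (hv.lift hr))
    (Det.ite hmem ((Det.num 0).pair hfl) hAl)) hAl).congr fun x => ?_
  rw [gbfInsertTotal_eq]
  simp only [← Fin.ext_iff]
  split_ifs <;> rfl

theorem Det.gbfTotal (hpub : Det inp fun i => P.pub (κ i)) {seed : ∀ i, P.Seed (κ i)}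
    (hseed : Det inp fun i => Data.num (seed i)) {y : ∀ i, ServerInput P (κ i)}
    (hy : Det inp fun i => Data.vec fun l =>
      Data.pair (Data.num ((y i).key l)) (enc ((y i).val l)))
    {R : ∀ i, Fin (P.m (κ i)) → P.Val (κ i)}
    (hR : Det inp fun i => Data.vec fun l => enc (R i l)) :
    Det inp fun i => Data.vec fun l => enc (gbfTotal P H (seed i) (y i) (R i) l) := by
  refine hpub.getDVec (A := fun i => gbfState P H (seed i) (y i) (R i) (P.n (κ i))) hR ?_
  obtain ⟨Q1, hQ1⟩ := hpub.pubP.size_bound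
  obtain ⟨Q2, hQ2⟩ := hpub.pubM.size_bound
  -- Every state has `m` entries, each an optional field element, so its size is bounded
  -- independently of the number of insertions.
  refine Det.iterate hpub.pubN
    (s := fun i j => Data.vec fun l => optData enc (gbfState P H (seed i) (y i) (R i) j l))
    (Det.vec hpub.pubM (Det.num 0)) ?_ (Q2 * (Q1 + 2 + 1) + 1) fun i j _ => ?_
  · let inp' : (Σ i, Fin (P.n (κ i))) → Data := fun x => Data.pair (inp x.1) (Data.pair
      (Data.num x.2) (Data.vec fun l => optData enc
        (gbfState P H (seed x.1) (y x.1) (R x.1) x.2 l)))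
    have h0 : Det inp' inp' := Det.id
    have hr : Det inp' fun x => inp x.1 := h0.pair_fst
    have hpub' : Det inp' fun x => P.pub (κ x.1) := hpub.lift hr
    have hs : Det inp' fun x => Data.vec fun l => optData enc
        (gbfState P H (seed x.1) (y x.1) (R x.1) x.2 l) := h0.pair_snd.pair_snd
    have hj : Det inp' fun x => Data.num x.2 := h0.pair_snd.pair_fst
    have hyj : Det inp' fun x => Data.pair (Data.num ((y x.1).key x.2)) (enc ((y x.1).val x.2)) :=
      Det.nth (f := fun (x : Σ i, Fin (P.n (κ i))) l =>
        Data.pair (Data.num ((y x.1).key l)) (enc ((y x.1).val l))) (j := fun x => x.2)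
        hpub'.pubN (hy.lift hr) hj
    refine (Det.gbfInsertTotal (κ := fun x : Σ i, Fin (P.n (κ i)) => κ x.1) hpub'
      (R := fun x => R x.1) (hR.lift hr)
      (hpub'.hashes (H := H) (seed := fun x => seed x.1) (hseed.lift hr) hyj.pair_fst)
      hyj.pair_snd hs).congr fun x => ?_
    simp only [gbfState, dif_pos x.2.2]
  · have h1 : ∀ l, (optData enc (gbfState P H (seed i) (y i) (R i) j l)).size ≤
        Q1.eval (inp i).size + 2 := by
      intro l
      cases gbfState P H (seed i) (y i) (R i) j l with
      | none => simp [optData, Data.size]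
      | some v =>
        have h2 := (size_enc_le v).trans (hQ1 i)
        simp only [optData, Data.size, Nat.size_zero] at h2 ⊢
        omega
    refine (Data.size_vec_le h1).trans ?_
    have h2 := hQ2 i
    rw [Data.unary_size] at h2
    have h3 : P.m (κ i) ≤ Q2.eval (inp i).size := by omega
    simp only [Polynomial.eval_add, Polynomial.eval_mul, Polynomial.eval_one,
      Polynomial.eval_ofNat]
    exact Nat.succ_le_succ (Nat.mul_le_mul_right _ h3)

end Filters

/-! ## The simulators for the whole protocol -/

section Simulators

variable {P : Params}

/-- The client's simulator: a random seed and simulated views of the queries. -/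
theorem exists_clientCode (H : HashFamily) {S : Fin 5 → Code} (hS : ∀ j, (S j).PolyTime) :
    ∃ C : Code, C.PolyTime ∧ ∀ κ (i : (ssipF P).Inp κ) (share : Fin (P.t κ) → P.Val κ),
      C.eval (Data.list [P.pub κ, (ssipF P).input κ i 0, Data.vec fun j => enc (share j)]) =
        (PMF.uniformOfFintype (P.Seed κ)).bind fun seed =>
          (indep fun j => clientSim S (fun a => hash P H seed a (i.1.key j)) (i.1.val j)
            (share j)).map fun v =>
            Data.list [(ssipF P).input κ i 0, Data.num seed, Data.vec v] := by
  let ι : Type := Σ κ, (ClientInput P κ × ServerInput P κ) × (Fin (P.t κ) → P.Val κ)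
  let inp : ι → Data := fun x => Data.list [P.pub x.1, (ssipF P).input x.1 x.2.1 0,
    Data.vec fun j => enc (x.2.2 j)]
  have h0 : Det inp inp := Det.id
  have hpub : Det inp fun x => P.pub x.1 := h0.pair_fst
  have hin : Det inp fun x => Data.vec fun j =>
    Data.pair (Data.num (x.2.1.1.key j)) (enc (x.2.1.1.val j)) := h0.pair_snd.pair_fst
  have hsh : Det inp fun x => Data.vec fun j => enc (x.2.2 j) := h0.pair_snd.pair_snd.pair_fst
  -- The simulated views are passed on as one piece of data, in the form in which `Computes.vec`
  -- delivers them.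
  suffices h : Computes inp fun x => (PMF.uniformOfFintype (P.Seed x.1)).bind fun seed =>
      ((indep fun j => clientSim S (fun a => hash P H seed a (x.2.1.1.key j)) (x.2.1.1.val j)
        (x.2.2 j)).map Data.vec).bind fun v =>
        PMF.pure (Data.list [(ssipF P).input x.1 x.2.1 0, Data.num seed, v]) by
    obtain ⟨C, hC, hCe⟩ := h
    refine ⟨C, hC, fun κ i share => (hCe ⟨κ, i, share⟩).trans ?_⟩
    refine bind_congr_right _ fun seed => ?_
    rw [PMF.bind_map]
    rfl
  refine Computes.bind (Computes.uniformFin hpub.pubSeedLen) ?_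
  refine Computes.bind (e := fun _ v => v) (τ := fun _ => Data) ?_ ?_
  · refine Computes.congr ?_ fun x => (PMF.map_id _).symm
    let ι' : Type := Σ x : ι, P.Seed x.1
    let inp' : ι' → Data := fun x => Data.pair (inp x.1) (Data.num x.2)
    have hr' : Det inp' fun x => inp x.1 := Det.id.pair_fst
    refine Computes.vec (n := fun x : ι' => P.t x.1.1) (hpub.lift hr').pubT ?_
    let J : Type := Σ x : ι', Fin (P.t x.1.1)
    let inpJ : J → Data := fun x => Data.pair (inp' x.1) (Data.num x.2)
    have hJ : Det inpJ inpJ := Det.id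
    have hr : Det inpJ fun x => inp x.1.1 := hJ.pair_fst.pair_fst
    have hpubJ : Det inpJ fun x => P.pub x.1.1.1 := hpub.lift hr
    have hj : Det inpJ fun x => Data.num x.2 := hJ.pair_snd
    have hseed : Det inpJ fun x => Data.num x.1.2 := hJ.pair_fst.pair_snd
    have hx : Det inpJ fun x => Data.pair (Data.num (x.1.1.2.1.1.key x.2))
        (enc (x.1.1.2.1.1.val x.2)) :=
      Det.nth (f := fun (x : J) j => Data.pair (Data.num (x.1.1.2.1.1.key j))
        (enc (x.1.1.2.1.1.val j))) (j := fun x => x.2) hpubJ.pubT (hin.lift hr) hj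
    exact Computes.clientSim (κ := fun x : J => x.1.1.1) hS hpubJ
      (hpubJ.hashes (H := H) (seed := fun x => x.1.2) hseed hx.pair_fst) hx.pair_snd
      (Det.nth (f := fun (x : J) j => enc (x.1.1.2.2 j)) (j := fun x => x.2) hpubJ.pubT
        (hsh.lift hr) hj)
  · have h1 : Det (fun x : Σ _ : (Σ x : ι, P.Seed x.1), Data => Data.pair (Data.pair
        (inp x.1.1) (Data.num x.1.2)) x.2) fun x => Data.pair (Data.pair
        (inp x.1.1) (Data.num x.1.2)) x.2 := Det.id
    exact h1.pair_fst.pair_fst.pair_snd.pair_fst.cons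
      (h1.pair_fst.pair_snd.cons (h1.pair_snd.cons Det.nil))

/-- The server's simulator: a random seed, random filter entries, and simulated views of the
queries. -/
theorem exists_serverCode (H : HashFamily) {S : Fin 5 → Code} (hS : ∀ j, (S j).PolyTime) :
    ∃ C : Code, C.PolyTime ∧ ∀ κ (i : (ssipF P).Inp κ) (share : Fin (P.t κ) → P.Val κ),
      C.eval (Data.list [P.pub κ, (ssipF P).input κ i 1, Data.vec fun j => enc (share j)]) =
        (PMF.uniformOfFintype (P.Seed κ)).bind fun seed =>
        (PMF.uniformOfFintype (Fin (P.m κ) → P.Val κ)).bind fun R =>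
          (indep fun j => serverSim S (bloom P H seed i.2) (gbfTotal P H seed i.2 R)
            (share j)).map fun v =>
            Data.list [(ssipF P).input κ i 1, Data.num seed, Data.vec fun l => enc (R l),
              Data.vec v] := by
  let ι : Type := Σ κ, (ClientInput P κ × ServerInput P κ) × (Fin (P.t κ) → P.Val κ)
  let inp : ι → Data := fun x => Data.list [P.pub x.1, (ssipF P).input x.1 x.2.1 1,
    Data.vec fun j => enc (x.2.2 j)]
  have h0 : Det inp inp := Det.id
  have hpub : Det inp fun x => P.pub x.1 := h0.pair_fst
  have hin : Det inp fun x => Data.vec fun l =>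
    Data.pair (Data.num (x.2.1.2.key l)) (enc (x.2.1.2.val l)) := h0.pair_snd.pair_fst
  have hsh : Det inp fun x => Data.vec fun j => enc (x.2.2 j) := h0.pair_snd.pair_snd.pair_fst
  suffices h : Computes inp fun x => (PMF.uniformOfFintype (P.Seed x.1)).bind fun seed =>
      (PMF.uniformOfFintype (Fin (P.m x.1) → P.Val x.1)).bind fun R =>
      ((indep fun j => serverSim S (bloom P H seed x.2.1.2) (gbfTotal P H seed x.2.1.2 R)
        (x.2.2 j)).map Data.vec).bind fun v =>
        PMF.pure (Data.list [(ssipF P).input x.1 x.2.1 1, Data.num seed,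
          Data.vec fun l => enc (R l), v]) by
    obtain ⟨C, hC, hCe⟩ := h
    refine ⟨C, hC, fun κ i share => (hCe ⟨κ, i, share⟩).trans ?_⟩
    refine bind_congr_right _ fun seed => bind_congr_right _ fun R => ?_
    rw [PMF.bind_map]
    rfl
  refine Computes.bind (Computes.uniformFin hpub.pubSeedLen) ?_
  let ι' : Type := Σ x : ι, P.Seed x.1
  let inp' : ι' → Data := fun x => Data.pair (inp x.1) (Data.num x.2)
  have hr' : Det inp' fun x => inp x.1 := Det.id.pair_fst
  have hpub' : Det inp' fun x => P.pub x.1.1 := hpub.lift hr'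
  refine Computes.bind (ι := ι') (τ := fun x => Fin (P.m x.1.1) → P.Val x.1.1)
    (e := fun _ R => Data.vec fun l => enc (R l)) ?_ ?_
  -- A uniform vector has independent uniform entries, which a loop can draw one by one.
  · have h1 : Computes inp' fun x => (indep fun _ : Fin (P.m x.1.1) =>
        (PMF.uniformOfFintype (P.Val x.1.1)).map enc).map Data.vec :=
      Computes.vec hpub'.pubM (Computes.uniformZMod (q := fun x : Σ x : ι', Fin (P.m x.1.1) =>
        P.p x.1.1.1) (hpub'.lift (g := fun x : Σ x : ι', Fin (P.m x.1.1) => x.1) Det.id.pair_fst).pubP)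
    refine h1.congr fun x => ?_
    rw [indep_uniform, indep_map (fun _ => PMF.uniformOfFintype (P.Val x.1.1)) fun _ => enc,
      PMF.map_comp]
    rfl
  let ι2 : Type := Σ x : ι', Fin (P.m x.1.1) → P.Val x.1.1
  let inp2 : ι2 → Data := fun x => Data.pair (inp' x.1) (Data.vec fun l => enc (x.2 l))
  have h2 : Det inp2 inp2 := Det.id
  have hr2 : Det inp2 fun x => inp x.1.1 := h2.pair_fst.pair_fst
  have hpub2 : Det inp2 fun x => P.pub x.1.1.1 := hpub.lift hr2
  have hseed2 : Det inp2 fun x => Data.num x.1.2 := h2.pair_fst.pair_snd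
  have hR2 : Det inp2 fun x => Data.vec fun l => enc (x.2 l) := h2.pair_snd
  have hBF2 := hpub2.bloom (H := H) (seed := fun x => x.1.2) hseed2
    (y := fun x => x.1.1.2.1.2) (hin.lift hr2)
  have hGBF2 := hpub2.gbfTotal (H := H) (seed := fun x => x.1.2) hseed2
    (y := fun x => x.1.1.2.1.2) (hin.lift hr2) hR2
  refine Computes.bind (ι := ι2) (e := fun _ v => v) (τ := fun _ => Data) ?_ ?_
  · refine Computes.congr ?_ fun x => (PMF.map_id _).symm
    refine Computes.vec (n := fun x : ι2 => P.t x.1.1.1) hpub2.pubT ?_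
    let J : Type := Σ x : ι2, Fin (P.t x.1.1.1)
    let inpJ : J → Data := fun x => Data.pair (inp2 x.1) (Data.num x.2)
    have hJ : Det inpJ inpJ := Det.id
    have hr : Det inpJ fun x => inp2 x.1 := hJ.pair_fst
    have hpubJ : Det inpJ fun x => P.pub x.1.1.1.1 := hpub2.lift hr
    exact Computes.serverSim (κ := fun x : J => x.1.1.1.1) hS hpubJ (hBF2.lift hr)
      (hGBF2.lift hr)
      (Det.nth (f := fun (x : J) j => enc (x.1.1.1.2.2 j)) (j := fun x => x.2) hpubJ.pubT
        ((hsh.lift hr2).lift hr) hJ.pair_snd)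
  · have h1 : Det (fun x : Σ _ : ι2, Data => Data.pair (inp2 x.1) x.2)
        fun x => Data.pair (inp2 x.1) x.2 := Det.id
    exact h1.pair_fst.pair_fst.pair_fst.pair_snd.pair_fst.cons
      (h1.pair_fst.pair_fst.pair_snd.cons (h1.pair_fst.pair_snd.cons (h1.pair_snd.cons Det.nil)))

end Simulators

/-! ## Security of the whole protocol -/

/-- The samples of the queries, assembled to a view and the outputs of both parties. -/
def assemble (wrap : Data → Data → Data) (t : ℕ) (hdr x : Data) : Data :=
  Data.list [wrap hdr (Data.vec fun j : Fin t => (x.entry j).fst),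
    Data.vec fun j : Fin t => (x.entry j).snd.fst, Data.vec fun j : Fin t => (x.entry j).snd.snd.fst]

theorem assemble_vec (wrap : Data → Data → Data) {t : ℕ} (hdr : Data) (v a b : Fin t → Data) :
    assemble wrap t hdr (Data.vec fun j => Data.list [v j, a j, b j]) =
      Data.list [wrap hdr (Data.vec v), Data.vec a, Data.vec b] := by
  simp only [assemble, Data.entry_vec]
  rfl

/-- Reassembling the view and the outputs from the per-query triples has to be an efficient
postprocessing for `CompIndist.context` to apply. -/
theorem Det.assemble {ι : Type} {inp : ι → Data} {wrap : Data → Data → Data}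
    (hwrap : Det (fun d : Data => d) fun d => wrap d.fst d.snd) {t : ι → ℕ}
    (ht : Det inp fun i => Data.unary (t i)) {hdr x : ι → Data} (hh : Det inp hdr)
    (hx : Det inp x) : Det inp fun i => assemble wrap (t i) (hdr i) (x i) := by
  have hj : Det (fun y : Σ i, Fin (t i) => Data.pair (inp y.1) (Data.num y.2))
      fun y => (x y.1).entry y.2 :=
    Det.entry (n := fun y : Σ i, Fin (t i) => t y.1) (j := fun y => y.2) ht.weaken hx.weaken
      Det.id.pair_snd
  have h1 : Det inp fun i => wrap (hdr i) (Data.vec fun j : Fin (t i) => ((x i).entry j).fst) :=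
    Computes.app hwrap (hh.pair (Det.vec ht hj.fst))
  exact h1.cons ((Det.vec ht hj.snd.fst).cons ((Det.vec ht hj.snd.snd.fst).cons Det.nil))

theorem Close.of_eq {α : Type*} {X Y : PMF α} (h : X = Y) : Close 0 X Y := h ▸ Close.refl X

section Protocol

variable {P : Params} {H : HashFamily} {A : PIRScheme} {otBit otVal : Protocol}

/-- The view of a party in a query. -/
def QueryOutcome.view {κ : ℕ} (o : QueryOutcome P κ) (b : Fin 2) : Data :=
  (![o.clientView, o.serverView] : Fin 2 → Data) b

/-- The real world when the seed is good. -/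
theorem realWorld_close (hB : BloomSound P H) (b : Fin 2) {wrap : Data → Data → Data}
    {hdr : ∀ κ, (ssipF P).Inp κ → P.Seed κ → (Fin (P.m κ) → P.Val κ) → Data}
    (hview : ∀ κ (i : (ssipF P).Inp κ) (seed : P.Seed κ) R (c s : Data),
      wrap (hdr κ i seed R) ((![c, s] : Fin 2 → Data) b) =
        (![Data.list [(ssipF P).input κ i 0, Data.num seed, c],
          Data.list [(ssipF P).input κ i 1, Data.num seed, Data.vec fun l => enc (R l), s]] :
            Fin 2 → Data) b) :
    ∃ ε : ℕ → ℝ, Negligible ε ∧ ∀ κ (i : (ssipF P).Inp κ), Close (ENNReal.ofReal (ε κ))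
      (realWorld (ssipF P) (ssip2 P H A otBit otVal) b κ i)
      ((PMF.uniformOfFintype (P.Seed κ)).bind fun seed =>
        (PMF.uniformOfFintype (Fin (P.m κ) → P.Val κ)).bind fun R =>
        ((indep fun j => (processQuery P A otBit otVal κ (queryInput P H i.1 i.2 seed R j).BF
            (queryInput P H i.1 i.2 seed R j).GBF (queryInput P H i.1 i.2 seed R j).pos
            (queryInput P H i.1 i.2 seed R j).val).map fun o =>
          Data.list [o.view b, enc o.clientShare, enc o.serverShare]).map Data.vec).bind fun x =>
        PMF.pure (assemble wrap (P.t κ) (hdr κ i seed R) x)) := by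
  obtain ⟨ε, hε, hbad⟩ := badSeed_prob hB
  refine ⟨ε, hε, fun κ i => ?_⟩
  unfold realWorld ssip2
  simp only [bind_eq_bind, PMF.map_bind]
  -- Bad seeds, among them all for which the protocol can abort, are paid for by their probability.
  -- For the other seeds the garbled filter is `gbfTotal`.
  refine (Close.bind_off (ε := 0) _ _ (hbad κ i.1 i.2) fun seed hg => ?_).mono (by simp)
  refine Close.bind _ fun R _ => ?_
  simp only [gbf_eq hg, mapM_finRange, pure_eq_pure, PMF.map_bind, PMF.bind_map]
  rw [indep_map _ fun _ (o : QueryOutcome P κ) =>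
    Data.list [o.view b, enc o.clientShare, enc o.serverShare], PMF.bind_map]
  refine Close.of_eq (bind_congr_right _ fun a => ?_)
  simp only [Function.comp_def, assemble_vec, PMF.pure_map, QueryOutcome.view, List.map_ofFn]
  have hv : (Data.vec fun j => (![(a j).clientView, (a j).serverView] : Fin 2 → Data) b) =
      (![Data.vec fun j => (a j).clientView, Data.vec fun j => (a j).serverView] :
        Fin 2 → Data) b := by
    match b with
    | 0 => rfl
    | 1 => rfl
  rw [hv, hview]
  rfl

/-- Secure realization for one party, from a simulator `sim` of its view in a query, which may
depend on the shares `s₀`, `s₁`. -/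
theorem ssip_party (hB : BloomSound P H) (b : Fin 2)
    {sim : ∀ κ, QueryInput P κ → P.Val κ → P.Val κ → PMF Data}
    (hind : CompIndist (I := QueryInput P)
      (fun κ q => (processQuery P A otBit otVal κ q.BF q.GBF q.pos q.val).map fun o =>
        Data.list [o.view b, enc o.clientShare, enc o.serverShare])
      fun κ q => (PMF.uniformOfFintype (P.Val κ)).bind fun α =>
        (sim κ q (q.result - α) α).map fun v => Data.list [v, enc (q.result - α), enc α])
    (hleft : PolySized (I := QueryInput P) fun κ q =>
      (processQuery P A otBit otVal κ q.BF q.GBF q.pos q.val).map fun o =>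
        Data.list [o.view b, enc o.clientShare, enc o.serverShare])
    (hright : PolySized (I := QueryInput P) fun κ q =>
      (PMF.uniformOfFintype (P.Val κ)).bind fun α =>
        (sim κ q (q.result - α) α).map fun v => Data.list [v, enc (q.result - α), enc α])
    {wrap : Data → Data → Data} (hwrap : Det (fun d : Data => d) fun d => wrap d.fst d.snd)
    {hdr : ∀ κ, (ssipF P).Inp κ → P.Seed κ → (Fin (P.m κ) → P.Val κ) → Data}
    (hhdr : PB (I := fun κ => (ssipF P).Inp κ × P.Seed κ × (Fin (P.m κ) → P.Val κ))
      fun κ x => hdr κ x.1 x.2.1 x.2.2)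
    (hview : ∀ κ (i : (ssipF P).Inp κ) (seed : P.Seed κ) R (c s : Data),
      wrap (hdr κ i seed R) ((![c, s] : Fin 2 → Data) b) =
        (![Data.list [(ssipF P).input κ i 0, Data.num seed, c],
          Data.list [(ssipF P).input κ i 1, Data.num seed, Data.vec fun l => enc (R l), s]] :
            Fin 2 → Data) b)
    {C : Code} (hC : C.PolyTime)
    (hCe : ∀ κ (i : (ssipF P).Inp κ) (r : Fin (P.t κ) → P.Val κ),
      C.eval (Data.list [P.pub κ, (ssipF P).input κ i b,
        (![Data.vec fun j => enc (trueResult i.1 i.2 j - r j), Data.vec fun j => enc (r j)] :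
          Fin 2 → Data) b]) =
        (PMF.uniformOfFintype (P.Seed κ)).bind fun seed =>
        (PMF.uniformOfFintype (Fin (P.m κ) → P.Val κ)).bind fun R =>
        (indep fun j => sim κ (queryInput P H i.1 i.2 seed R j) (trueResult i.1 i.2 j - r j)
          (r j)).map fun v => wrap (hdr κ i seed R) (Data.vec v)) :
    ∃ S : Code, S.PolyTime ∧ CompIndist (realWorld (ssipF P) (ssip2 P H A otBit otVal) b)
      (idealWorld P.pub (ssipF P) S b) := by
  refine ⟨C, hC, ?_⟩
  obtain ⟨ε, hε, hreal⟩ := realWorld_close (A := A) (otBit := otBit) (otVal := otVal) hB b hview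
  obtain ⟨ε', hε', hbad⟩ := badSeed_prob hB
  have h1 := CompIndist.of_close hε hreal
  -- The seed and the filter randomness are the random context; they determine the inputs of all
  -- queries, which are replaced by simulated ones.
  have h2 := CompIndist.context (hind.vec hleft hright P.t_poly) (J := (ssipF P).Inp)
    (τ := fun κ _ => P.Seed κ × (Fin (P.m κ) → P.Val κ))
    (fun κ _ => (PMF.uniformOfFintype (P.Seed κ)).bind fun seed =>
      (PMF.uniformOfFintype (Fin (P.m κ) → P.Val κ)).bind fun R => PMF.pure (seed, R))
    (fun κ i z => Data.pair (Data.unary (P.t κ)) (hdr κ i z.1 z.2))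
    (fun κ i z j => queryInput P H i.1 i.2 z.1 z.2 j)
    (fun κ i z x => PMF.pure (assemble wrap (P.t κ) (hdr κ i z.1 z.2) x))
    (Det.assemble (ι := Σ κ, Σ _ : (ssipF P).Inp κ, (P.Seed κ × (Fin (P.m κ) → P.Val κ)) × Data)
      hwrap Det.id.pair_fst.pair_fst Det.id.pair_fst.pair_snd Det.id.pair_snd) (by
      obtain ⟨Q, hQ⟩ := PB.pair (PB.unary P.t_poly) hhdr
      exact ⟨Q, fun κ i z _ => hQ κ (i, z)⟩)
  refine h1.trans ((h2.congr (fun κ i => ?_) fun κ i => ?_).trans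
    (CompIndist.of_close (I := (ssipF P).Inp) (X := fun κ i =>
      (PMF.uniformOfFintype (P.Seed κ)).bind fun seed =>
      (PMF.uniformOfFintype (Fin (P.m κ) → P.Val κ)).bind fun R =>
      ((indep fun j => (PMF.uniformOfFintype (P.Val κ)).bind fun α =>
        (sim κ (queryInput P H i.1 i.2 seed R j)
          ((queryInput P H i.1 i.2 seed R j).result - α) α).map fun v => Data.list
            [v, enc ((queryInput P H i.1 i.2 seed R j).result - α), enc α]).map Data.vec).bind
        fun x => PMF.pure (assemble wrap (P.t κ) (hdr κ i seed R) x)) hε' fun κ i => ?_))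
  · simp only [PMF.bind_bind, PMF.pure_bind]
  · simp only [PMF.bind_bind, PMF.pure_bind]
  -- The functionality draws the shares before the simulator draws the seed and `R`. These draws are
  -- independent, so the seed can come first, as in the protocol.
  · have hideal : idealWorld P.pub (ssipF P) C b κ i =
        (PMF.uniformOfFintype (P.Seed κ)).bind fun seed =>
        (PMF.uniformOfFintype (Fin (P.m κ) → P.Val κ)).bind fun R =>
        (PMF.uniformOfFintype (Fin (P.t κ) → P.Val κ)).bind fun r =>
        (indep fun j => sim κ (queryInput P H i.1 i.2 seed R j) (trueResult i.1 i.2 j - r j)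
          (r j)).map fun v => Data.list [wrap (hdr κ i seed R) (Data.vec v),
            Data.vec fun j => enc (trueResult i.1 i.2 j - r j), Data.vec fun j => enc (r j)] := by
      rw [bind_comm₂]
      simp only [idealWorld, ssipF, bind_eq_bind, pure_eq_pure, PMF.bind_bind, PMF.pure_bind]
      refine bind_congr_right _ fun r => ?_
      refine (congrArg (fun X : PMF Data => X.bind _) (hCe κ i r)).trans ?_
      simp only [PMF.bind_bind, PMF.bind_map]
      rfl
    rw [hideal]
    -- For a good seed the filters give the true results, so the shares are those of the
    -- functionality. The bad seeds are charged here a second time.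
    refine (Close.bind_off (ε := 0) _ _ (hbad κ i.1 i.2) fun seed hg => ?_).mono (by simp)
    refine Close.bind _ fun R _ => Close.of_eq ?_
    simp only [queryInput_result hg]
    rw [indep_uniform, indep_bind, PMF.map_bind, PMF.bind_bind]
    refine bind_congr_right _ fun r => ?_
    rw [indep_map _ fun j v => Data.list [v, enc (trueResult i.1 i.2 j - r j), enc (r j)],
      PMF.map_comp, PMF.bind_map]
    simp only [Function.comp_def, assemble_vec]
    rfl

end Protocol

/-- The protocol S-SIP₂ is secure against a semi-honest client and a semi-honest server. -/
theorem ssip2_securelyRealizes (P : Params) (H : HashFamily) (A : PIRScheme)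
    (otBit otVal : Protocol)
    (hp : Negligible fun κ => 1 / (P.p κ : ℝ))
    (hBloom : BloomSound P H)
    (hPIR : ∀ scaled : Bool,
      SecurelyRealizes P.pub (sumPIRF P scaled) (sumPIR P A scaled))
    (hOTBitEff : otBit.Efficient P.pub (otBitF P))
    (hOTBit : SecurelyRealizes P.pub (otBitF P) (otBit.exec P.pub (otBitF P)))
    (hOTValEff : otVal.Efficient P.pub (otValF P))
    (hOTVal : SecurelyRealizes P.pub (otValF P) (otVal.exec P.pub (otValF P))) :
    SecurelyRealizes P.pub (ssipF P) (ssip2 P H A otBit otVal) := by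
  have hinC : PB fun κ (i : (ssipF P).Inp κ) => (ssipF P).input κ i 0 :=
    PB.vec P.t_poly (f := fun κ (i : (ssipF P).Inp κ) j =>
      Data.pair (Data.num (i.1.key j)) (enc (i.1.val j)))
      (PB.pair (PB.coins P.keyLen_poly) (PB.value P))
  have hinS : PB fun κ (i : (ssipF P).Inp κ) => (ssipF P).input κ i 1 :=
    PB.vec P.n_poly (f := fun κ (i : (ssipF P).Inp κ) j =>
      Data.pair (Data.num (i.2.key j)) (enc (i.2.val j)))
      (PB.pair (PB.coins P.keyLen_poly) (PB.value P))
  intro b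
  match b with
  | 0 =>
    obtain ⟨S, hS, hind⟩ := client_query_indist hp hPIR hOTBitEff hOTBit hOTValEff hOTVal
    obtain ⟨C, hC, hCe⟩ := exists_clientCode (P := P) H hS
    refine ssip_party hBloom 0 (sim := fun κ q s₀ _ => clientSim S q.pos q.val s₀) hind
      (processQuery_polySized hOTBitEff hOTValEff 0) (clientSim_polySized hS)
      (wrap := fun d v => Data.list [d.fst, d.snd.fst, v])
      (Det.id.fst.fst.cons (Det.id.fst.snd.fst.cons (Det.id.snd.cons Det.nil)))
      (hdr := fun κ i seed _ => Data.list [(ssipF P).input κ i 0, Data.num seed])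
      (PB.cons (hinC.reindex _) (PB.cons (PB.coins P.seedLen_poly) PB.nil))
      (fun _ _ _ _ _ _ => rfl) hC fun κ i r => (hCe κ i _).trans ?_
    -- The client's simulator does not draw `R`; a draw on which nothing depends may be inserted.
    exact bind_congr_right _ fun seed => (PMF.bind_const _ _).symm
  | 1 =>
    obtain ⟨S, hS, hind⟩ := server_query_indist hp hPIR hOTBitEff hOTBit hOTValEff hOTVal
    obtain ⟨C, hC, hCe⟩ := exists_serverCode (P := P) H hS
    exact ssip_party hBloom 1 (sim := fun κ q _ s₁ => serverSim S q.BF q.GBF s₁) hind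
      (processQuery_polySized hOTBitEff hOTValEff 1) (serverSim_polySized hS)
      (wrap := fun d v => Data.list [d.fst, d.snd.fst, d.snd.snd.fst, v])
      (Det.id.fst.fst.cons (Det.id.fst.snd.fst.cons (Det.id.fst.snd.snd.fst.cons
        (Det.id.snd.cons Det.nil))))
      (hdr := fun κ i seed R => Data.list [(ssipF P).input κ i 1, Data.num seed,
        Data.vec fun l => enc (R l)])
      (PB.cons (hinS.reindex _) (PB.cons (PB.coins P.seedLen_poly) (PB.cons (PB.vecVal P) PB.nil)))
      (fun _ _ _ _ _ _ => rfl) hC fun κ i r => (hCe κ i _).trans rfl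

end SSIP

end

theorem theorem2 (P : SSIP.Params) (H : SSIP.HashFamily) (A : SSIP.PIRScheme)
    (otBit otVal : SSIP.Protocol)
    (hp : SSIP.Negligible fun κ => 1 / (P.p κ : ℝ))
    (hBloom : SSIP.BloomSound P H)
    (hPIR : ∀ scaled : Bool,
      SSIP.SecurelyRealizes P.pub (SSIP.sumPIRF P scaled) (SSIP.sumPIR P A scaled))
    (hOTBitEff : otBit.Efficient P.pub (SSIP.otBitF P))
    (hOTBit : SSIP.SecurelyRealizes P.pub (SSIP.otBitF P) (otBit.exec P.pub (SSIP.otBitF P)))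
    (hOTValEff : otVal.Efficient P.pub (SSIP.otValF P))
    (hOTVal : SSIP.SecurelyRealizes P.pub (SSIP.otValF P) (otVal.exec P.pub (SSIP.otValF P))) :
    SSIP.SecurelyRealizes P.pub (SSIP.ssipF P) (SSIP.ssip2 P H A otBit otVal) :=
  SSIP.ssip2_securelyRealizes P H A otBit otVal hp hBloom hPIR hOTBitEff hOTBit hOTValEff hOTVal
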